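/- Let $p$ be a prime and $F/\mathbb{Q}_p$ a finite extension with ring of integers $\mathcal{O}$, uniformizer $\pi$, residue field $k$ of order $q=p^2$, and ramification index $e$. Write $G=\mathrm{GL}_2(F)$, $K=\mathrm{GL}_2(\mathcal{O})$, $\Gamma=\mathrm{GL}_2(k)$, $Z$ for the center of $G$, $B\le\Gamma$ for the upper triangular subgroup, $U\le B$ for its unipotent elements, $K(1)=\ker(K\to\Gamma)$, $I$ and $I(1)$ for the preimages of $B$ and $U$ in $K$, and $N$ for the normalizer of $I(1)$ in $G$. All representations are over $\overline{\mathbb{F}}_p$. Fix an embedding $\varepsilon_0:k\hookrightarrow\overline{\mathbb{F}}_p$, put $\varepsilon_1=\varepsilon_0^p$, and write $\det^m\otimes(a_0,a_1)$ for the representation $(\mathrm{Sym}^{a_0}k^2\otimes_{\varepsilon_0}\overline{\mathbb{F}}_p)\otimes(\mathrm{Sym}^{a_1}k^2\otimes_{\varepsilon_1}\overline{\mathbb{F}}_p)\otimes(\varepsilon_0\circ\det)^m$ of $\Gamma$ and for its inflation to $K$, where $0\le a_0,a_1\le p-1$. For $\sigma=\det^m\otimes(s_0,s_1)$ and $(s_0-a_0)+p(s_1-a_1)$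 even, put $$(a_0,a_1)_\sigma^+=\det\nolimits^{m+\frac12(s_0-a_0+p(s_1-a_1))}\otimes(a_0,a_1),\qquad (a_0,a_1)_\sigma^-=\det\nolimits^{m+\frac12(p^2-1+s_0-a_0+p(s_1-a_1))}\otimes(a_0,a_1).$$ Let $\chi(\kappa)$ be the character by which $B$ acts on the line $\kappa^U$. For $\sigma=\det^m\otimes(s_0,s_1)$ with $0\le s_0,s_1\le p-2$, let $Q_{\{0\}}(\sigma)$ and $Q_{\{1\}}(\sigma)$ be the quotients with socle $\sigma$ of $\mathrm{Ind}_B^\Gamma\chi((p-2-s_0,s_1+1)_\sigma^+)$ and $\mathrm{Ind}_B^\Gamma\chi((s_0+1,p-2-s_1)_\sigma^-)$, respectively. Let $\omega_4$ be a fundamental character of level $4$ of the inertia group $I_F$, corresponding to an embedding of the quadratic extension of $k$ in $\overline{\mathbb{F}}_p$ extending $\varepsilon_0$. Let $\rho$ be a continuous irreducible two-dimensional representation of the absolute Galois group of $F$ that is generic: $\rho|_{I_F}$ is isomorphic to the twist by $\omega_4^{m(p^2+1)}$ of $\omega_4^{(r_0+1)+p(r_1+1)}\oplus\omega_4^{p^2((r_0+1)+p(r_1+1))}$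 with $2e-1\le r_0\le p-2$ and $2e-2\le r_1\le p-3$. Put $\tau=\det^m\otimes(r_0,r_1)$ and $\Delta=\{0,\dots,e-1\}^2$. Let $\mathcal{D}(\rho)$ be the set of the $4e^2$ pairwise distinct Serre weights attached as follows to the pairs $(\underline\delta,J)$ with $\underline\delta=(\delta_0,\delta_1)\in\Delta$ and $J\subseteq\{0,1\}$: $$\begin{array}{ll} J=\varnothing: & (r_0-2\delta_0,\ r_1-2\delta_1)_\tau^+\\ J=\{0\}: & (r_0-2\delta_0-1,\ p-r_1+2\delta_1-2)_\tau^-\\ J=\{1\}: & (p-r_0+2\delta_0-2,\ r_1-2\delta_1+1)_\tau^+\\ J=\{0,1\}: & (p-r_0+2\delta_0-1,\ p-r_1+2\delta_1-3)_\tau^-. \end{array}$$ View $\Delta$ as the $e\times e$ square lattice graph. A Hamiltonian walk $\gamma$ is an undirected path in it that traverses each vertex exactly once; two vertices are $\gamma$-adjacent if $\gamma$ contains the edge joining them. For $\sigma\in\mathcal{D}(\rho)$ attached to $(\underline\delta,J)$ let $D^\gamma_{0,\sigma}=Q_{\{0\}}(\sigma)$ if $|J|=1$ and $D^\gamma_{0,\sigma}=Q_{\{1\}}(\sigma)$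 otherwise, except that $Q_{\{0\}}(\sigma)$ and $Q_{\{1\}}(\sigma)$ are interchanged if $\underline\delta$ is $\gamma$-adjacent to $(\delta_0,\delta_1+1)$ and $J=\{0\}$, or to $(\delta_0,\delta_1-1)$ and $J=\{1\}$, or to $(\delta_0+1,\delta_1)$ and $J=\{0,1\}$, or to $(\delta_0-1,\delta_1)$ and $J=\varnothing$. Put $D_0^\gamma(\rho)=\bigoplus_{\sigma\in\mathcal{D}(\rho)}D^\gamma_{0,\sigma}$, viewed as a $KZ$-module by inflation with $\pi\,\mathrm{Id}_2$ acting trivially. A diagram $(D_0,D_1,r)$ consists of a smooth representation $D_0$ of $KZ$, a smooth representation $D_1$ of $N$ and an $IZ$-equivariant map $r:D_1\to D_0$. It belongs to the family attached to $\gamma$ if $D_0\simeq D_0^\gamma(\rho)$, $r$ is injective with image $D_0^{I(1)}$, and the action of $N$ pairs the characters of $D_0^{I(1)}$ arising from the socle of $D_0$ with those arising from the cosocle, that is, no $N$-orbit of a nonzero vector of $D_1$ is mapped by $r$ into $\mathrm{soc}_K D_0$. Let $\gamma\ne\gamma'$ be distinct Hamiltonian walks, and let $(D_0,D_1,r)$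 and $(D_0',D_1',r')$ be diagrams belonging to the families attached to $\gamma$ and $\gamma'$, respectively. Let $V$ be a smooth admissible representation of $G$ such that 1. $\mathrm{soc}_K V\simeq\bigoplus_{\sigma\in\mathcal{D}(\rho)}\sigma$; 2. there is an embedding of diagrams $(D_0,D_1,r)\hookrightarrow(V^{K(1)},V^{I(1)},\mathrm{can})$; 3. $V$ is generated by the image of $D_0$ as a representation of $G$. Let $V'$ be a smooth admissible representation of $G$ satisfying the same conditions relative to $(D_0',D_1',r')$. Then $V$ and $V'$ are not isomorphic as representations of $G$. -/

import Mathlib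

open scoped ValuativeRel TensorProduct

noncomputable section

namespace GLTwo

/-! ### General representation theory -/

section Rep

/-- The twist of a representation by a multiplicative character. -/
def twist {E G V : Type*} [Field E] [AddCommMonoid V] [Module E V] [Monoid G] (χ : G →* E)
    (ρ : Representation E G V) : Representation E G V where
  toFun g := χ g • ρ g
  map_one' := by simp
  map_mul' g h := by
    ext v
    simp only [map_mul, LinearMap.smul_apply, Module.End.mul_apply, map_smul, smul_smul,
      mul_comm]

variable {E G V : Type*} [Field E] [AddCommGroup V] [Module E V]

/-- The socle: the sum of all irreducible subrepresentations. -/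
def socle [Monoid G] (ρ : Representation E G V) : Subrepresentation ρ where
  toSubmodule := ⨆ (W : Subrepresentation ρ)
    (_ : Representation.IsIrreducible W.toRepresentation), W.toSubmodule
  apply_mem_toSubmodule g := by
    intro v hv
    have h : (⨆ (W : Subrepresentation ρ)
        (_ : Representation.IsIrreducible W.toRepresentation), W.toSubmodule) ≤
        (⨆ (W : Subrepresentation ρ)
        (_ : Representation.IsIrreducible W.toRepresentation), W.toSubmodule).comap (ρ g) := by
      refine iSup₂_le fun W hW x hx => ?_
      exact Submodule.mem_iSup_of_mem W
        (Submodule.mem_iSup_of_mem hW (W.apply_mem_toSubmodule g hx))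
    exact h hv

/-- Smooth representations of a topological group: every vector has open stabilizer. -/
def IsSmooth [Monoid G] [TopologicalSpace G] (ρ : Representation E G V) : Prop :=
  ∀ v : V, IsOpen {g : G | ρ g v = v}

/-- Vectors fixed by all elements of `S` at which the representation is defined. -/
def fixedBy [Group G] {A : Subgroup G} (ρ : Representation E A V) (S : Subgroup G) :
    Submodule E V where
  carrier := {v | ∀ g : A, (g : G) ∈ S → ρ g v = v}
  add_mem' ha hb g hg := by rw [map_add, ha g hg, hb g hg]
  zero_mem' g _ := map_zero _
  smul_mem' c v hv g hg := by rw [map_smul, hv g hg]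

/-- Smooth admissible representations: moreover the invariants under every open subgroup are
finite-dimensional. -/
def IsAdmissible [Group G] [TopologicalSpace G] (ρ : Representation E G V) : Prop :=
  IsSmooth ρ ∧ ∀ S : Subgroup G, IsOpen (S : Set G) →
    FiniteDimensional E (Representation.invariants (ρ.comp S.subtype))

end Rep

/-! ### Serre weights for a field `k` with `p ^ 2` elements -/

section SymPow

variable {E : Type*} [Field E]

/-- `g` acts on polynomials in the basis vectors `X 0, X 1` of the standard representation by
`X j ↦ ∑ i, g i j * X i`. -/
def linSubst (g : Matrix (Fin 2) (Fin 2) E) :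
    MvPolynomial (Fin 2) E →ₐ[E] MvPolynomial (Fin 2) E :=
  MvPolynomial.aeval fun j => ∑ i, MvPolynomial.C (g i j) * MvPolynomial.X i

theorem linSubst_one : linSubst (1 : Matrix (Fin 2) (Fin 2) E) = AlgHom.id E _ := by
  ext j : 1
  fin_cases j <;> simp [linSubst, Fin.sum_univ_two]

theorem linSubst_mul (g h : Matrix (Fin 2) (Fin 2) E) :
    linSubst (g * h) = (linSubst g).comp (linSubst h) := by
  ext j : 1
  simp only [linSubst, MvPolynomial.aeval_X, AlgHom.comp_apply, Fin.sum_univ_two, Matrix.mul_apply,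
    map_add, map_mul, MvPolynomial.aeval_C, MvPolynomial.algebraMap_eq]
  ring

theorem linSubst_mem (g : Matrix (Fin 2) (Fin 2) E) (r : ℕ) (P : MvPolynomial (Fin 2) E)
    (hP : P ∈ MvPolynomial.homogeneousSubmodule (Fin 2) E r) :
    linSubst g P ∈ MvPolynomial.homogeneousSubmodule (Fin 2) E r := by
  have h := MvPolynomial.IsHomogeneous.aeval (R := E) (S := E) (n := 1)
    ((MvPolynomial.mem_homogeneousSubmodule _ _).1 hP)
    (fun j => ∑ i, MvPolynomial.C (g i j) * MvPolynomial.X i)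
    (fun j => MvPolynomial.IsHomogeneous.sum _ _ _ fun i _ => by
      simpa using (MvPolynomial.isHomogeneous_C (Fin 2) (g i j)).mul
        (MvPolynomial.isHomogeneous_X E i))
  rw [one_mul] at h
  exact (MvPolynomial.mem_homogeneousSubmodule _ _).2 h

/-- The representation `Sym^r` of `GL₂(E)`, on homogeneous polynomials of degree `r` in the
standard basis vectors. -/
def symPow (E : Type*) [Field E] (r : ℕ) :
    Representation E (GL (Fin 2) E) (MvPolynomial.homogeneousSubmodule (Fin 2) E r) where
  toFun g := (linSubst (g : Matrix (Fin 2) (Fin 2) E)).toLinearMap.restrict (linSubst_mem _ r)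
  map_one' := by
    ext P : 2
    simp [linSubst_one]
  map_mul' g h := by
    ext P : 2
    simp only [Units.val_mul, linSubst_mul]
    rfl

end SymPow

/-- The parameters of `det ^ m ⊗ (a₀, a₁)`. -/
@[ext]
structure Weight where
  m : ℤ
  a₀ : ℕ
  a₁ : ℕ

/-- `(a₀, a₁)_σ^+`; only used when the numerator is even, so that the division is exact. -/
def Weight.plus (p : ℕ) (σ : Weight) (a₀ a₁ : ℕ) : Weight :=
  ⟨σ.m + ((σ.a₀ - a₀ : ℤ) + p * (σ.a₁ - a₁ : ℤ)) / 2, a₀, a₁⟩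

/-- `(a₀, a₁)_σ^-`; only used when the numerator is even, so that the division is exact. -/
def Weight.minus (p : ℕ) (σ : Weight) (a₀ a₁ : ℕ) : Weight :=
  ⟨σ.m + ((p : ℤ) ^ 2 - 1 + (σ.a₀ - a₀ : ℤ) + p * (σ.a₁ - a₁ : ℤ)) / 2, a₀, a₁⟩

section Weights

variable (p : ℕ) [Fact p.Prime] {k E : Type*} [Field k] [Field E] [CharP E p] (ε₀ : k →+* E)

/-- The underlying space of `det ^ m ⊗ (a₀, a₁)`. -/
abbrev Weight.Space (E : Type*) [Field E] (σ : Weight) : Type _ :=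
  MvPolynomial.homogeneousSubmodule (Fin 2) E σ.a₀ ⊗[E]
    MvPolynomial.homogeneousSubmodule (Fin 2) E σ.a₁

/-- The character `ε₀ ∘ det ^ m` of `GL₂(k)`. -/
def detChar (m : ℤ) : GL (Fin 2) k →* E where
  toFun g := ε₀ (Matrix.det (g : Matrix (Fin 2) (Fin 2) k)) ^ m
  map_one' := by simp
  map_mul' g h := by simp [mul_zpow]

/-- The representation `det ^ m ⊗ (a₀, a₁)` of `GL₂(k)`, namely
`(Sym^a₀ k² ⊗_{ε₀} E) ⊗ (Sym^a₁ k² ⊗_{ε₁} E) ⊗ (ε₀ ∘ det) ^ m` with `ε₁ = ε₀ ^ p`. -/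
def serreWeight (σ : Weight) : Representation E (GL (Fin 2) k) (σ.Space E) :=
  twist (detChar ε₀ σ.m)
    (Representation.tprod
      ((symPow E σ.a₀).comp (Matrix.GeneralLinearGroup.map ε₀))
      ((symPow E σ.a₁).comp (Matrix.GeneralLinearGroup.map ((frobenius E p).comp ε₀))))

end Weights

/-- The upper triangular subgroup `B` of `GL₂(k)`. -/
def borel (k : Type*) [Field k] : Subgroup (GL (Fin 2) k) where
  carrier := {g | g 1 0 = 0}
  one_mem' := by simp
  mul_mem' {a b} ha hb := by
    simp only [Set.mem_ofPred_eq] at ha hb ⊢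
    simp [Matrix.mul_apply, Fin.sum_univ_two, ha, hb]
  inv_mem' {a} ha := by
    simp only [Set.mem_ofPred_eq] at ha ⊢
    rw [Matrix.coe_units_inv, Matrix.inv_def, Matrix.adjugate_fin_two]
    simp [ha]

/-- The subgroup `U` of unipotent upper triangular matrices. -/
def unipotent (k : Type*) [Field k] : Subgroup (GL (Fin 2) k) where
  carrier := {g | g 1 0 = 0 ∧ g 0 0 = 1 ∧ g 1 1 = 1}
  one_mem' := by simp
  mul_mem' {a b} ha hb := by
    simp only [Set.mem_ofPred_eq] at ha hb ⊢
    simp [Matrix.mul_apply, Fin.sum_univ_two, ha, hb]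
  inv_mem' {a} ha := by
    simp only [Set.mem_ofPred_eq] at ha ⊢
    rw [Matrix.coe_units_inv, Matrix.inv_def, Matrix.adjugate_fin_two]
    simp [ha, Matrix.det_fin_two]

section Ind

variable (p : ℕ) {k E : Type*} [Field k] [Field E] (ε₀ : k →+* E)

/-- The character `χ(σ)` of `B` giving the action on `σ^U`, a line spanned by
`X 0 ^ a₀ ⊗ X 0 ^ a₁` for a Serre weight `σ = det ^ m ⊗ (a₀, a₁)`. -/
def weightChar (σ : Weight) : borel k →* E where
  toFun b := ε₀ ((b : GL (Fin 2) k) 0 0) ^ (σ.m + σ.a₀ + p * σ.a₁) *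
    ε₀ ((b : GL (Fin 2) k) 1 1) ^ σ.m
  map_one' := by simp
  map_mul' a b := by
    have ha : (a : GL (Fin 2) k) 1 0 = 0 := a.2
    have hb : (b : GL (Fin 2) k) 1 0 = 0 := b.2
    simp only [Subgroup.coe_mul, Units.val_mul, Matrix.mul_apply, Fin.sum_univ_two, ha, hb,
      mul_zero, zero_mul, add_zero, zero_add, map_mul, mul_zpow]
    ring

/-- The principal series `Ind_B^{GL₂(k)} χ`: functions with `f (b * g) = χ b * f g`, with the
action by right translation. -/
def indBorel (χ : borel k →* E) :=
  Representation.coind (borel k).subtype (twist χ (Representation.trivial E (borel k) E))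

/-- The cosocle of `Q_{j}(σ)`, for `j = 0, 1`: the Serre weights `(p-2-a₀, a₁+1)_σ^+` and
`(a₀+1, p-2-a₁)_σ^-`. -/
def Weight.cosocle (σ : Weight) (j : Fin 2) : Weight :=
  if j = 0 then σ.plus p (p - 2 - σ.a₀) (σ.a₁ + 1) else σ.minus p (σ.a₀ + 1) (p - 2 - σ.a₁)

/-- `X` is (a model of) `Q_{j}(σ)`, the quotient with socle `σ` of `Ind_B χ(κ)`, where `κ` is
`(p-2-a₀, a₁+1)_σ^+` for `j = 0` and `(a₀+1, p-2-a₁)_σ^-` for `j = 1`. -/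
def IsQ [Fact p.Prime] [CharP E p] (j : Fin 2) (σ : Weight) {X : Type*} [AddCommGroup X]
    [Module E X] (ρX : Representation E (GL (Fin 2) k) X) : Prop :=
  (∃ f : Representation.IntertwiningMap (indBorel (weightChar p ε₀ (σ.cosocle p j))) ρX,
    Function.Surjective f) ∧
  Nonempty ((socle ρX).toRepresentation.Equiv (serreWeight p ε₀ σ))

end Ind

/-! ### Hamiltonian walks and the weights in `𝒟(ρ)` -/

/-- The `e × e` square lattice. -/
def lattice (e : ℕ) : SimpleGraph (Fin e × Fin e) :=
  SimpleGraph.boxProd (SimpleGraph.pathGraph e) (SimpleGraph.pathGraph e)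

/-- Undirected Hamiltonian walks in the lattice, recorded by their sets of edges. -/
def HamiltonianWalk (e : ℕ) : Type :=
  {S : Set (Sym2 (Fin e × Fin e)) // ∃ (u v : Fin e × Fin e) (w : (lattice e).Walk u v),
    w.IsHamiltonian ∧ S = {x | x ∈ w.edges}}

/-- `δ` is `γ`-adjacent to the vertex with coordinates `x` (in particular the latter lies in the
lattice). -/
def HamiltonianWalk.Adjacent {e : ℕ} (γ : HamiltonianWalk e) (δ : Fin e × Fin e) (x : ℤ × ℤ) :
    Prop :=
  ∃ δ' : Fin e × Fin e, ((δ'.1 : ℕ) : ℤ) = x.1 ∧ ((δ'.2 : ℕ) : ℤ) = x.2 ∧ s(δ, δ') ∈ γ.1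

/-- The pairs `(δ, J)` that index `𝒟(ρ)`. -/
abbrev WeightIndex (e : ℕ) : Type := (Fin e × Fin e) × Finset (Fin 2)

/-- The Serre weight in `𝒟(ρ)` associated to `(δ, J)`, in terms of `τ = det ^ m ⊗ (r₀, r₁)`. The
truncated subtractions are true ones under the genericity bounds. -/
def modularWeight (p : ℕ) (τ : Weight) {e : ℕ} (i : WeightIndex e) : Weight :=
  let d₀ : ℕ := i.1.1
  let d₁ : ℕ := i.1.2
  if i.2 = ∅ then τ.plus p (τ.a₀ - 2 * d₀) (τ.a₁ - 2 * d₁)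
  else if i.2 = {0} then τ.minus p (τ.a₀ - 2 * d₀ - 1) (p + 2 * d₁ - τ.a₁ - 2)
  else if i.2 = {1} then τ.plus p (p + 2 * d₀ - τ.a₀ - 2) (τ.a₁ - 2 * d₁ + 1)
  else τ.minus p (p + 2 * d₀ - τ.a₀ - 1) (p + 2 * d₁ - τ.a₁ - 3)

open Classical in
/-- The `j` with `D^γ_{0,σ} = Q_{j}(σ)`, for `σ` associated to `(δ, J)`. -/
def summandType {e : ℕ} (γ : HamiltonianWalk e) (i : WeightIndex e) : Fin 2 :=
  let d₀ : ℤ := ((i.1.1 : ℕ) : ℤ)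
  let d₁ : ℤ := ((i.1.2 : ℕ) : ℤ)
  if i.2 = {0} then (if γ.Adjacent i.1 (d₀, d₁ + 1) then 1 else 0)
  else if i.2 = {1} then (if γ.Adjacent i.1 (d₀, d₁ - 1) then 1 else 0)
  else if i.2 = {0, 1} then (if γ.Adjacent i.1 (d₀ + 1, d₁) then 0 else 1)
  else (if γ.Adjacent i.1 (d₀ - 1, d₁) then 0 else 1)

/-! ### The group `GL₂(F)` and diagrams -/

section LocalField

variable (F : Type*) [Field F] [ValuativeRel F]

/-- The inclusion of `GL₂(𝒪)` in `GL₂(F)`. -/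
def incl : GL (Fin 2) 𝒪[F] →* GL (Fin 2) F :=
  Matrix.GeneralLinearGroup.map (algebraMap 𝒪[F] F)

/-- The reduction map from `GL₂(𝒪)` to `GL₂(k)`. -/
def red : GL (Fin 2) 𝒪[F] →* GL (Fin 2) 𝓀[F] :=
  Matrix.GeneralLinearGroup.map (IsLocalRing.residue 𝒪[F])

/-- `K(1)`. -/
def K1 : Subgroup (GL (Fin 2) F) := (red F).ker.map (incl F)

/-- `I`. -/
def Iw : Subgroup (GL (Fin 2) F) := ((borel 𝓀[F]).comap (red F)).map (incl F)

/-- `I(1)`. -/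
def Iw1 : Subgroup (GL (Fin 2) F) := ((unipotent 𝓀[F]).comap (red F)).map (incl F)

/-- `KZ`. -/
def KZ : Subgroup (GL (Fin 2) F) := (incl F).range ⊔ Subgroup.center _

/-- `IZ`. -/
def IZ : Subgroup (GL (Fin 2) F) := Iw F ⊔ Subgroup.center _

/-- The normalizer `N` of `I(1)`. -/
def Nm : Subgroup (GL (Fin 2) F) := Subgroup.normalizer (Iw1 F : Set (GL (Fin 2) F))

/-- The map from `GL₂(𝒪)` to `KZ`. -/
def inclKZ : GL (Fin 2) 𝒪[F] →* KZ F :=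
  (incl F).codRestrict (KZ F) fun g => Subgroup.mem_sup_left ⟨g, rfl⟩

/-- A diagram `(D₀, D₁, ι)`: a smooth representation of `KZ`, a smooth representation of `N`, and
an `IZ`-equivariant map from the latter to the former. -/
structure Diagram (E : Type*) [Field E] [TopologicalSpace F] where
  D₀ : Type*
  D₁ : Type*
  [addCommGroup₀ : AddCommGroup D₀]
  [addCommGroup₁ : AddCommGroup D₁]
  [module₀ : Module E D₀]
  [module₁ : Module E D₁]
  ρ₀ : Representation E (KZ F) D₀
  ρ₁ : Representation E (Nm F) D₁
  smooth₀ : IsSmooth ρ₀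
  smooth₁ : IsSmooth ρ₁
  ι : D₁ →ₗ[E] D₀
  equivariant : ∀ (g : GL (Fin 2) F) (h₀ : g ∈ KZ F) (h₁ : g ∈ Nm F), g ∈ IZ F →
    ∀ x, ι (ρ₁ ⟨g, h₁⟩ x) = ρ₀ ⟨g, h₀⟩ (ι x)

attribute [instance] Diagram.addCommGroup₀ Diagram.addCommGroup₁ Diagram.module₀ Diagram.module₁

variable {F} {E : Type*} [Field E] [TopologicalSpace F]

/-- `D` is a basic `0`-diagram arising from the family `(D₀^γ(ρ), { , })`, where
`τ = det ^ m ⊗ (r₀, r₁)` is the weight attached to `ρ`. -/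
structure Diagram.ArisesFrom (p : ℕ) [Fact p.Prime] [CharP E p] (D : Diagram F E) (ϖ : 𝒪[F])
    (ε₀ : 𝓀[F] →+* E) (τ : Weight) {e : ℕ} (γ : HamiltonianWalk e) : Prop where
  /-- `D₀` is the inflation of `D₀^γ(ρ)`, the direct sum of the `D^γ_{0,σ}` for `σ ∈ 𝒟(ρ)`. -/
  inflation : ∃ R : Representation E (GL (Fin 2) 𝓀[F]) D.D₀,
    (∀ g : GL (Fin 2) 𝒪[F], D.ρ₀ (inclKZ F g) = R (red F g)) ∧
    ∃ X : WeightIndex e → Subrepresentation R,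
      DirectSum.IsInternal (fun i => (X i).toSubmodule) ∧
      ∀ i, IsQ p ε₀ (summandType γ i) (modularWeight p τ i) (X i).toRepresentation
  /-- The scalar matrix `ϖ` acts trivially. -/
  uniformizer : ∀ z : KZ F,
    ((z : GL (Fin 2) F) : Matrix (Fin 2) (Fin 2) F) = Matrix.scalar (Fin 2) (ϖ : F) →
    D.ρ₀ z = 1
  /-- `ι` identifies `D₁` with the `I(1)`-invariants of `D₀`. -/
  injective : Function.Injective D.ι
  range_eq : LinearMap.range D.ι = fixedBy D.ρ₀ (Iw1 F)
  /-- The action of `N` pairs characters arising from the socle with characters arising from the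
  cosocle: no orbit of `N` on nonzero vectors is contained in the socle of `D₀`. -/
  pairing : ∀ x : D.D₁, x ≠ 0 → ∃ n : Nm F,
    D.ι (D.ρ₁ n x) ∉ socle (D.ρ₀.comp (inclKZ F))

/-- The hypotheses on a representation `V` of `GL₂(F)` relative to a diagram `D`: it is smooth
admissible, its `K`-socle is the direct sum of the weights in `𝒟(ρ)`, the diagram `D` embeds in
`(V^{K(1)}, V^{I(1)}, can)`, and the image of `D₀` generates `V`. -/
structure SatisfiesHypotheses (p : ℕ) [Fact p.Prime] [CharP E p] {V : Type*} [AddCommGroup V]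
    [Module E V] (π : Representation E (GL (Fin 2) F) V) (D : Diagram F E) (ε₀ : 𝓀[F] →+* E)
    (τ : Weight) (e : ℕ) : Prop where
  admissible : IsAdmissible π
  socle_equiv : Nonempty ((socle (π.comp (incl F))).toRepresentation.Equiv
    (Representation.directSum fun i : WeightIndex e =>
      (serreWeight p ε₀ (modularWeight p τ i)).comp (red F)))
  embedding : ∃ (i₀ : D.D₀ →ₗ[E] V) (i₁ : D.D₁ →ₗ[E] V),
    Function.Injective i₀ ∧ Function.Injective i₁ ∧
    (∀ x, ∀ g ∈ K1 F, π g (i₀ x) = i₀ x) ∧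
    (∀ x, ∀ g ∈ Iw1 F, π g (i₁ x) = i₁ x) ∧
    (∀ (g : KZ F) x, i₀ (D.ρ₀ g x) = π g (i₀ x)) ∧
    (∀ (g : Nm F) x, i₁ (D.ρ₁ g x) = π g (i₁ x)) ∧
    (∀ x, i₀ (D.ι x) = i₁ x) ∧
    ∀ W : Subrepresentation π, (∀ x, i₀ x ∈ W) → W = ⊤

end LocalField

/-! ### Generic Galois representations -/

section Galois

variable (F : Type*) [Field F] [ValuativeRel F]

/-- The ring of integers of the algebraic closure of `F`. -/
abbrev IntegersAlg : Type _ := integralClosure 𝒪[F] (AlgebraicClosure F)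

/-- The inertia group: automorphisms inducing the identity on the residue field of the local ring
`IntegersAlg F`, whose Jacobson radical is its maximal ideal. -/
def inertia : Set (Field.absoluteGaloisGroup F) :=
  {g | ∀ a b : IntegersAlg F, (b : AlgebraicClosure F) =
    (show AlgebraicClosure F ≃ₐ[F] AlgebraicClosure F from g) (a : AlgebraicClosure F) →
      b - a ∈ (⊥ : Ideal (IntegersAlg F)).jacobson}

variable {F}

/-- A chosen `n`-th root of `ϖ` in the algebraic closure. -/
def chosenRoot (ϖ : 𝒪[F]) (n : ℕ) [NeZero n] : AlgebraicClosure F :=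
  Classical.choose (IsAlgClosed.exists_pow_nat_eq
    (algebraMap 𝒪[F] (AlgebraicClosure F) ϖ) (Nat.pos_of_neZero n))

theorem chosenRoot_pow (ϖ : 𝒪[F]) (n : ℕ) [NeZero n] :
    chosenRoot ϖ n ^ n = algebraMap 𝒪[F] (AlgebraicClosure F) ϖ :=
  Classical.choose_spec (IsAlgClosed.exists_pow_nat_eq
    (algebraMap 𝒪[F] (AlgebraicClosure F) ϖ) (Nat.pos_of_neZero n))

/-- The root of unity `g(x) / x`, where `x` is the chosen `n`-th root of `ϖ`. -/
def kummer (ϖ : 𝒪[F]) (n : ℕ) [NeZero n] (g : Field.absoluteGaloisGroup F) : IntegersAlg F :=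
  ⟨(show AlgebraicClosure F ≃ₐ[F] AlgebraicClosure F from g) (chosenRoot ϖ n) / chosenRoot ϖ n, by
    refine IsIntegral.of_pow (Nat.pos_of_neZero n) ?_
    have h : (show AlgebraicClosure F ≃ₐ[F] AlgebraicClosure F from g)
        (algebraMap 𝒪[F] (AlgebraicClosure F) ϖ) = algebraMap 𝒪[F] (AlgebraicClosure F) ϖ := by
      rw [IsScalarTower.algebraMap_apply 𝒪[F] F (AlgebraicClosure F)]
      exact AlgEquiv.commutes _ _
    rw [div_pow, ← map_pow, chosenRoot_pow, h]
    by_cases h0 : algebraMap 𝒪[F] (AlgebraicClosure F) ϖ = 0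
    · rw [h0, div_zero]; exact isIntegral_zero
    · rw [div_self h0]; exact isIntegral_one⟩

/-- For a uniformizer `ϖ`, an `E`-valued point `θ` of the ring of integers of the algebraic closure
(that is, an embedding in `E` of its residue field), and `n = p ^ 4 - 1`: on inertia, this is the
fundamental character of level `4` of a field `F` with residue field of order `p ^ 2`. -/
def fundamentalCharacter {E : Type*} [Field E] (ϖ : 𝒪[F]) (θ : IntegersAlg F →+* E) (n : ℕ)
    [NeZero n] (g : Field.absoluteGaloisGroup F) : E := θ (kummer ϖ n g)

instance (p : ℕ) [Fact p.Prime] : NeZero (p ^ 4 - 1) :=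
  ⟨Nat.sub_ne_zero_of_lt (Nat.one_lt_pow (by decide) (Fact.out : p.Prime).one_lt)⟩

/-- A continuous irreducible two-dimensional representation `ρ` of the absolute Galois group of `F`
(with residue field of order `p ^ 2` and ramification index `e`) is generic, its restriction to
inertia being
`ω₄ ^ ((r₀+1) + p(r₁+1)) ⊕ ω₄ ^ (p²((r₀+1) + p(r₁+1)))` twisted by `ω₄ ^ (m(p²+1))`, where
`τ = det ^ m ⊗ (r₀, r₁)`. The open kernel expresses continuity for the discrete topology of `E`. -/
structure IsGenericOfType {E : Type*} [Field E] (p : ℕ) [Fact p.Prime] (e : ℕ) (ϖ : 𝒪[F])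
    (θ : IntegersAlg F →+* E)
    (ρ : Representation E (Field.absoluteGaloisGroup F) (Fin 2 → E)) (τ : Weight) : Prop where
  continuous : IsOpen {g : Field.absoluteGaloisGroup F | ρ g = 1}
  irreducible : Representation.IsIrreducible ρ
  le_r₀ : 2 * e ≤ τ.a₀ + 1
  r₀_le : τ.a₀ + 2 ≤ p
  le_r₁ : 2 * e ≤ τ.a₁ + 2
  r₁_le : τ.a₁ + 3 ≤ p
  restrict_inertia : ∃ b : Module.Basis (Fin 2) E (Fin 2 → E), ∀ g ∈ inertia F,
    ρ g (b 0) = fundamentalCharacter ϖ θ (p ^ 4 - 1) g ^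
      (((τ.a₀ + 1 : ℤ) + p * (τ.a₁ + 1)) + τ.m * (p ^ 2 + 1)) • b 0 ∧
    ρ g (b 1) = fundamentalCharacter ϖ θ (p ^ 4 - 1) g ^
      ((p : ℤ) ^ 2 * ((τ.a₀ + 1 : ℤ) + p * (τ.a₁ + 1)) + τ.m * (p ^ 2 + 1)) • b 1

end Galois

end GLTwo

end

open GLTwo

/-! The walk can be read off from `V` alone. Write `M` for the `I(1)`-invariants of the `K`-socle of
`V` and `Π` for the matrix `(0, 1; ϖ, 0)`, which together with `IZ` generates `N`. The prescribed
socle of `V` is no bigger than the sum of the socles of the summands of `D₀`, so the two coincide in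
`V`. Each summand `Q_{j}(σ)` has at most two lines of unipotent invariants: that of its socle `σ`,
and that of the image of the canonical generator of the principal series, on which `B` acts by the
character of the cosocle. Hence `dim D₀^{I(1)} ≤ 2 * 4e²`, while `dim M ≥ 4e²`. The pairing
condition forces `M ∩ ΠM = 0`, and counting dimensions gives `D₀^{I(1)} = M ⊕ ΠM` inside `V`, a
description that does not mention the diagram (`IsModel.fixed_iff_mem_normalizerSpan`).

If `V ≃ V'`, then `D₀` and `D₀'` both embed in `V` with the same `I(1)`-invariants. The generator of
the summand of `D₀` with socle `σ` therefore lies in `D₀'`. Its component in the summand of `D₀'`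
with socle `σ` is nonzero, since otherwise the whole summand, and with it `σ`, would have zero
component there, although `σ` occurs only once in the socle (`IsModel.component_ne_zero`). The
character of this component is that of a cosocle of `Q_{0}(σ)` or `Q_{1}(σ)`. As those two differ
from each other and from the character of `σ`, both walks select the same `j` for every `σ`
(`IsModel.summandType_eq`). These choices record every edge of the walk
(`HamiltonianWalk.ext_of_summandType`).

The bound of two lines (`invariants_mem_span`) comes from an explicit computation with the moments
`∑ λ ^ i u(λ) w v` of the generator `v`. They are torus eigenvectors, the unipotent group acts on
them by binomial coefficients, and Lucas' congruence shows which of them can be invariant. -/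

noncomputable section

namespace GLTwo

/-! ### Matrices generating `GL₂` -/

section Gens

variable {A : Type*} [CommRing A]

/-- The upper triangular unipotent matrix with entry `x`. -/
def upp (x : A) : GL (Fin 2) A :=
  ⟨!![1, x; 0, 1], !![1, -x; 0, 1], by simp [Matrix.one_fin_two],
    by simp [Matrix.one_fin_two]⟩

/-- The diagonal matrix with entries `a` and `d`. -/
def dia (a d : Aˣ) : GL (Fin 2) A :=
  ⟨!![(a : A), 0; 0, (d : A)], !![((a⁻¹ : Aˣ) : A), 0; 0, ((d⁻¹ : Aˣ) : A)],
    by simp [Matrix.one_fin_two],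
    by simp [Matrix.one_fin_two]⟩

/-- The nontrivial permutation matrix. -/
def wey : GL (Fin 2) A :=
  ⟨!![0, 1; 1, 0], !![0, 1; 1, 0], by simp [Matrix.one_fin_two],
    by simp [Matrix.one_fin_two]⟩

theorem coe_upp (x : A) : (upp x : Matrix (Fin 2) (Fin 2) A) = !![1, x; 0, 1] := rfl

theorem coe_dia (a d : Aˣ) :
    (dia a d : Matrix (Fin 2) (Fin 2) A) = !![(a : A), 0; 0, (d : A)] := rfl

theorem coe_wey : ((wey : GL (Fin 2) A) : Matrix (Fin 2) (Fin 2) A) = !![0, 1; 1, 0] := rfl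

theorem upp_mul_upp (x y : A) : upp x * upp y = upp (x + y) := by
  apply Units.ext
  simp [coe_upp, add_comm]

theorem upp_zero : upp (0 : A) = 1 := by
  apply Units.ext
  simp [coe_upp, Matrix.one_fin_two]

theorem wey_mul_wey : (wey : GL (Fin 2) A) * wey = 1 := by
  apply Units.ext
  simp [coe_wey, Matrix.one_fin_two]

theorem dia_mul_upp (a d : Aˣ) (x : A) :
    dia a d * upp x = upp (a * x * (d⁻¹ : Aˣ)) * dia a d := by
  apply Units.ext
  simp [coe_upp, coe_dia]

theorem dia_mul_wey (a d : Aˣ) : dia a d * wey = wey * dia d a := by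
  apply Units.ext
  simp [coe_wey, coe_dia]

variable {k : Type*} [Field k]

theorem wey_mul_upp_mul_wey (x : kˣ) :
    wey * upp (x : k) * wey = upp ((x⁻¹ : kˣ) : k) * wey * (dia x (-x⁻¹) * upp ((x⁻¹ : kˣ) : k)) := by
  apply Units.ext
  simp [coe_wey, coe_upp, coe_dia]

theorem eq_upp_mul_dia {g : GL (Fin 2) k} (hg : g 1 0 = 0) :
    ∃ (x : k) (a d : kˣ), g = upp x * dia a d ∧ (a : k) = g 0 0 ∧ (d : k) = g 1 1 := by
  have hdet : g 0 0 * g 1 1 ≠ 0 := by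
    have := (Matrix.isUnit_iff_isUnit_det _).1 g.isUnit
    rw [Matrix.det_fin_two, hg] at this
    simpa using this
  have h0 := left_ne_zero_of_mul hdet
  have h1 := right_ne_zero_of_mul hdet
  refine ⟨g 0 1 / g 1 1, Units.mk0 _ h0, Units.mk0 _ h1, ?_, rfl, rfl⟩
  apply Units.ext
  ext i j
  fin_cases i <;> fin_cases j <;> simp [coe_upp, coe_dia, hg, h1]

theorem eq_upp_mul_wey_mul {g : GL (Fin 2) k} (hg : g 1 0 ≠ 0) :
    ∃ (x : k) (b : GL (Fin 2) k), b 1 0 = 0 ∧ g = upp x * (wey * b) := by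
  refine ⟨g 0 0 / g 1 0, wey * (upp (-(g 0 0 / g 1 0)) * g), ?_, ?_⟩
  · have : ∀ h : Matrix (Fin 2) (Fin 2) k, Matrix.vecMul ![1, -(g 0 0 / g 1 0)] h 0 =
        h 0 0 - g 0 0 / g 1 0 * h 1 0 := by
      intro h
      simp [Matrix.vecMul, dotProduct, Fin.sum_univ_two, sub_eq_add_neg]
    simp [coe_wey, coe_upp, this, hg]
  · rw [← mul_assoc wey wey, wey_mul_wey, one_mul, ← mul_assoc, upp_mul_upp, add_neg_cancel,
      upp_zero, one_mul]

theorem gl_induction {P : GL (Fin 2) k → Prop} (hmul : ∀ g h, P g → P h → P (g * h))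
    (hu : ∀ x, P (upp x)) (hd : ∀ a d, P (dia a d)) (hw : P wey) (g : GL (Fin 2) k) : P g := by
  have key : ∀ b : GL (Fin 2) k, b 1 0 = 0 → P b := by
    intro b hb
    obtain ⟨x, a, d, rfl, -⟩ := eq_upp_mul_dia hb
    exact hmul _ _ (hu _) (hd _ _)
  by_cases hg : g 1 0 = 0
  · exact key g hg
  · obtain ⟨x, b, hb, rfl⟩ := eq_upp_mul_wey_mul hg
    exact hmul _ _ (hu _) (hmul _ _ hw (key b hb))

end Gens

/-! ### Eigenvectors -/

section Eigen

variable {E Q : Type*} [Field E] [AddCommGroup Q] [Module E Q]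

theorem aeval_eigen {T : Q →ₗ[E] Q} {y : Q} {μ : E} (h : T y = μ • y) (P : Polynomial E) :
    Polynomial.aeval T P y = P.eval μ • y := by
  induction P using Polynomial.induction_on' with
  | add P P' h h' => simp [h, h', add_smul]
  | monomial n a =>
    have : ∀ n : ℕ, (T ^ n) y = μ ^ n • y := by
      intro n
      induction n with
      | zero => simp
      | succ n ih => rw [pow_succ', Module.End.mul_apply, ih, map_smul, h, smul_smul, pow_succ]
    simp [this, smul_smul, Polynomial.aeval_monomial, mul_comm]

/-- A stable subspace containing a sum of eigenvectors for distinct eigenvalues contains each of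
them. -/
theorem mem_of_sum_eigen {ι : Type*} {s : Finset ι} {T : Q →ₗ[E] Q} {S : Submodule E Q}
    (hS : ∀ x ∈ S, T x ∈ S) {y : ι → Q} {μ : ι → E} (hy : ∀ i ∈ s, T (y i) = μ i • y i)
    (hμ : Set.InjOn μ s) (hsum : ∑ i ∈ s, y i ∈ S) {i : ι} (hi : i ∈ s) : y i ∈ S := by
  classical
  have hP : ∀ P : Polynomial E, ∀ x ∈ S, Polynomial.aeval T P x ∈ S := by
    intro P x hx
    induction P using Polynomial.induction_on' with
    | add P P' h h' => rw [map_add]; exact S.add_mem h h'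
    | monomial n a =>
      rw [Polynomial.aeval_monomial]
      refine S.smul_mem a ?_
      induction n with
      | zero => simpa using hx
      | succ n ih => rw [pow_succ']; exact hS _ ih
  -- The Lagrange basis polynomial, evaluated at `T`, projects the sum onto its `i`-th eigenvector.
  have h := hP (Lagrange.basis s μ i) _ hsum
  rw [map_sum, Finset.sum_eq_single_of_mem i hi, aeval_eigen (hy i hi),
    Lagrange.eval_basis_self hμ hi, one_smul] at h
  · exact h
  · intro j hj hji
    rw [aeval_eigen (hy j hj), Lagrange.eval_basis_of_ne hji.symm hj, zero_smul]

theorem eq_zero_of_sum_eigen {ι : Type*} {s : Finset ι} {T : Q →ₗ[E] Q}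
    {y : ι → Q} {μ : ι → E} (hy : ∀ i ∈ s, T (y i) = μ i • y i)
    (hμ : Set.InjOn μ s) (hsum : ∑ i ∈ s, y i = 0) {i : ι} (hi : i ∈ s) : y i = 0 := by
  simpa using mem_of_sum_eigen (S := ⊥) (by simp) hy hμ (by simp [hsum]) hi

end Eigen

/-! ### Moments of a vector under the unipotent group -/

section Moments

variable {k E Q : Type*} [Field k] [Fintype k] [Field E] [AddCommGroup Q] [Module E Q]
  (ε : k →+* E) (R : Representation E (GL (Fin 2) k) Q)

/-- The moment `∑ λ ^ i u(λ) x`. -/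
def mom (x : Q) (i : ℕ) : Q := ∑ t : k, ε t ^ i • R (upp t) x

theorem mom_mem {S : Submodule E Q} (hS : ∀ t, ∀ x ∈ S, R (upp t) x ∈ S) {x : Q} (hx : x ∈ S)
    (i : ℕ) : mom ε R x i ∈ S :=
  S.sum_mem fun t _ => S.smul_mem _ (hS t x hx)

/-- Translating the summation variable by `μ` and expanding `(λ - μ) ^ i` makes the action
triangular with binomial coefficients; which of these vanish modulo `p` decides later which moments
can be invariant. -/
theorem upp_mom (x : Q) (i : ℕ) (μ : k) :
    R (upp μ) (mom ε R x i) =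
      ∑ j ∈ Finset.range (i + 1), ((-ε μ) ^ (i - j) * (i.choose j : E)) • mom ε R x j := by
  have h1 : R (upp μ) (mom ε R x i) = ∑ t : k, (ε t + -ε μ) ^ i • R (upp t) x := by
    rw [mom, map_sum]
    refine Fintype.sum_equiv (Equiv.addLeft μ) _ _ fun t => ?_
    rw [map_smul, ← Module.End.mul_apply, ← map_mul, upp_mul_upp]
    simp
  rw [h1]
  simp only [add_pow, Finset.sum_smul, mom, Finset.smul_sum, smul_smul]
  rw [Finset.sum_comm]
  refine Finset.sum_congr rfl fun j _ => Finset.sum_congr rfl fun t _ => ?_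
  congr 1
  ring

/-- The powers `t ^ i` with `i < q` span the functions on `k`; it suffices to produce the indicator
function of `0`, since translates are handled by `upp_mom`. -/
theorem upp_mem_span_mom (x : Q) (μ : k) :
    R (upp μ) x ∈ Submodule.span E (mom ε R x '' {i | i < Fintype.card k}) := by
  classical
  have hpos : 0 < Fintype.card k := Fintype.card_pos
  -- On `k` the function `t ^ 0 - t ^ (q - 1)` is the indicator of `t = 0`, with the convention `0 ^
  -- 0 = 1`.
  have h0 : x = mom ε R x 0 - mom ε R x (Fintype.card k - 1) := by
    have : ∀ t : k, ε t ^ 0 • R (upp t) x - ε t ^ (Fintype.card k - 1) • R (upp t) x =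
        if t = 0 then x else 0 := by
      intro t
      split_ifs with ht
      · subst ht
        have := Fintype.one_lt_card (α := k)
        rw [upp_zero, map_one, map_zero, zero_pow (n := Fintype.card k - 1) (by omega)]
        simp
      · rw [← map_pow ε t (Fintype.card k - 1), FiniteField.pow_card_sub_one_eq_one t ht]
        simp
    simp only [mom, ← Finset.sum_sub_distrib, this]
    simp
  have hmem : ∀ i, i < Fintype.card k → R (upp μ) (mom ε R x i) ∈
      Submodule.span E (mom ε R x '' {i | i < Fintype.card k}) := by
    intro i hi
    rw [upp_mom]
    refine Submodule.sum_mem _ fun j hj => Submodule.smul_mem _ _ (Submodule.subset_span ⟨j, ?_, rfl⟩)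
    have := Finset.mem_range.1 hj
    simp only [Set.mem_ofPred_eq]
    omega
  have h1 := Submodule.sub_mem _ (hmem 0 hpos) (hmem (Fintype.card k - 1) (by omega))
  rwa [← map_sub, ← h0] at h1

/-- A nonzero subspace stable under the unipotent group contains a nonzero fixed vector. -/
theorem exists_fixed (ε : k →+* E) {S : Submodule E Q} (hS : ∀ t, ∀ x ∈ S, R (upp t) x ∈ S) (h0 : S ≠ ⊥) :
    ∃ y ∈ S, y ≠ 0 ∧ ∀ t, R (upp t) y = y := by
  classical
  obtain ⟨x, hx, hx0⟩ := Submodule.exists_mem_ne_zero_of_ne_bot h0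
  have hex : ∃ i, mom ε R x i ≠ 0 := by
    by_contra! h
    apply hx0
    have := upp_mem_span_mom ε R x 0
    rw [upp_zero, map_one, Module.End.one_apply] at this
    have h2 : Submodule.span E (mom ε R x '' {i | i < Fintype.card k}) ≤ ⊥ := by
      rw [Submodule.span_le]
      rintro _ ⟨i, -, rfl⟩
      simpa using h i
    simpa using h2 this
  -- In the triangular formula for the first nonvanishing moment, only the diagonal term survives.
  refine ⟨mom ε R x (Nat.find hex), mom_mem ε R hS hx _, Nat.find_spec hex, fun t => ?_⟩
  rw [upp_mom, Finset.sum_range_succ, Finset.sum_eq_zero, Nat.sub_self]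
  · simp
  · intro j hj
    have := Nat.find_min hex (Finset.mem_range.1 hj)
    simp only [not_not] at this
    rw [this, smul_zero]

theorem dia_mom {x : Q} {a d : kˣ} {ν : E} (hx : R (dia a d) x = ν • x) (i : ℕ) :
    R (dia a d) (mom ε R x i) = (ν * (ε ((a⁻¹ * d : kˣ) : k)) ^ i) • mom ε R x i := by
  rw [mom, map_sum, Finset.smul_sum]
  refine Fintype.sum_equiv ((a * d⁻¹).mulLeft) _ _ fun t => ?_
  have h : (ε a * (ε d)⁻¹) * (ε d * (ε a)⁻¹) = 1 := by
    have ha : ε a ≠ 0 := by simp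
    have hd : ε d ≠ 0 := by simp
    field_simp
  rw [map_smul, ← Module.End.mul_apply, ← map_mul, dia_mul_upp, map_mul, Module.End.mul_apply,
    hx, map_smul, smul_smul, smul_smul]
  have h1 : (a * d⁻¹).mulLeft t = a * t * (d⁻¹ : kˣ) := by
    simp only [Units.mulLeft_apply, Units.val_mul]
    ring
  rw [h1]
  congr 1
  simp only [Units.val_mul, map_mul, Units.val_inv_eq_inv_val, map_inv₀]
  rw [mul_assoc, ← mul_pow, mul_comm, show (ε (a : k))⁻¹ * ε d * (ε a * ε t * (ε d)⁻¹) =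
    (ε (a : k) * (ε d)⁻¹ * (ε d * (ε a)⁻¹)) * ε t by ring, h, one_mul]

end Moments

/-! ### Powers of a generator of the multiplicative group of `k` -/

section Characters

variable {k E : Type*} [Field k] [Fintype k] [Field E] (ε : k →+* E)

theorem exists_generator : ∃ g : kˣ, orderOf g = Fintype.card k - 1 := by
  classical
  obtain ⟨g, hg⟩ := IsCyclic.exists_generator (α := kˣ)
  exact ⟨g, by rw [orderOf_eq_card_of_forall_mem_zpowers hg, Nat.card_eq_fintype_card,
    Fintype.card_units]⟩

theorem dvd_of_zpow_eq {g : kˣ} (hg : orderOf g = Fintype.card k - 1) {i j : ℤ}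
    (h : ε g ^ i = ε g ^ j) : ((Fintype.card k - 1 : ℕ) : ℤ) ∣ i - j := by
  rw [← hg, orderOf_dvd_iff_zpow_eq_one, ← Units.val_inj]
  apply ε.injective
  have h0 : ε g ≠ 0 := by simp
  rw [Units.val_zpow_eq_zpow_val, map_zpow₀, zpow_sub₀ h0, h, div_self (zpow_ne_zero _ h0)]
  simp

end Characters

theorem mem_span_image_iff_exists_sum {E Q ι : Type*} [Field E] [AddCommGroup Q] [Module E Q]
    {f : ι → Q} {s : Finset ι} {x : Q} :
    x ∈ Submodule.span E (f '' s) ↔ ∃ a : ι → E, ∑ i ∈ s, a i • f i = x := by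
  classical
  rw [Submodule.mem_span_image_finset_iff_exists_fun]
  constructor
  · rintro ⟨a, rfl⟩
    refine ⟨fun i => if h : i ∈ s then a ⟨i, h⟩ else 0, ?_⟩
    rw [← Finset.sum_coe_sort]
    exact Finset.sum_congr rfl fun i _ => by simp
  · rintro ⟨a, rfl⟩
    exact ⟨fun i => a i, Finset.sum_coe_sort s fun i => a i • f i⟩

/-! ### Moments of the generator in a quotient of a principal series -/

section PrincipalSeriesQuotient

variable {k E Q : Type*} [Field k] [Fintype k] [Field E] [AddCommGroup Q] [Module E Q]
  {ε : k →+* E} {R : Representation E (GL (Fin 2) k) Q} {v : Q} {n : ℤ} {c : ℕ}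

theorem dia_wey_mom
    (ht : ∀ a d : kˣ, R (dia a d) v = (ε a ^ (n - c) * ε d ^ n) • v) (a d : kˣ) (i : ℕ) :
    R (dia a d) (mom ε R (R wey v) i) =
      (ε a ^ (n - i) * ε d ^ (n - c + i)) • mom ε R (R wey v) i := by
  have h : R (dia a d) (R wey v) = (ε d ^ (n - c) * ε a ^ n) • R wey v := by
    rw [← Module.End.mul_apply, ← map_mul, dia_mul_wey, map_mul, Module.End.mul_apply, ht,
      map_smul]
  rw [dia_mom ε R h]
  congr 1
  have ha : ε (a : k) ≠ 0 := by simp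
  have hd : ε (d : k) ≠ 0 := by simp
  simp only [Units.val_mul, map_mul, Units.val_inv_eq_inv_val, map_inv₀]
  rw [mul_pow, zpow_sub₀ ha, zpow_add₀ hd, zpow_natCast, zpow_natCast, inv_pow]
  ring

/-- For `t ≠ 0`, the identity `w u(t) w = u(t⁻¹) w diag(t, -t⁻¹) u(t⁻¹)` turns the `t`-term of the
`i`-th moment into the `t⁻¹`-term of the `(c - i)`-th. The term `t = 0` contributes `v`, and only
when `i = 0`. The condition `i < c` ensures that the moment on the right has no term at `0`. -/
theorem wey_wey_mom (hu : ∀ t, R (upp t) v = v)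
    (ht : ∀ a d : kˣ, R (dia a d) v = (ε a ^ (n - c) * ε d ^ n) • v) {i : ℕ} (hi : i < c) :
    R wey (mom ε R (R wey v) i) =
      (0 : E) ^ i • v + ((-1 : E) ^ n) • mom ε R (R wey v) (c - i) := by
  classical
  have key : ∀ t : k, R wey (ε t ^ i • R (upp t) (R wey v)) =
      (if t = 0 then (0 : E) ^ i • v else 0) +
        (-1 : E) ^ n • ε t⁻¹ ^ (c - i) • R (upp t⁻¹) (R wey v) := by
    intro t
    split_ifs with h0
    · subst h0
      rw [inv_zero, map_zero, zero_pow (n := c - i) (by omega), zero_smul, smul_zero, add_zero,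
        upp_zero, map_one, Module.End.one_apply, map_smul, ← Module.End.mul_apply, ← map_mul,
        wey_mul_wey, map_one, Module.End.one_apply]
    · obtain ⟨t, rfl⟩ : ∃ u : kˣ, (u : k) = t := ⟨Units.mk0 t h0, rfl⟩
      have h1 : R wey (R (upp (t : k)) (R wey v)) =
          R (upp ((t⁻¹ : kˣ) : k)) (R wey (R (dia t (-t⁻¹)) (R (upp ((t⁻¹ : kˣ) : k)) v))) := by
        simp only [← Module.End.mul_apply, ← map_mul]
        rw [← mul_assoc wey, wey_mul_upp_mul_wey]
        simp only [mul_assoc]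
      rw [zero_add, map_smul, h1, hu, ht, map_smul, map_smul, smul_smul, smul_smul,
        Units.val_inv_eq_inv_val]
      congr 1
      have h2 : ε (t : k) ≠ 0 := by simp
      have h3 : ε ((-t⁻¹ : kˣ) : k) = -1 * (ε (t : k))⁻¹ := by simp
      rw [h3, mul_zpow, map_inv₀, inv_pow, inv_zpow, ← zpow_natCast, ← zpow_natCast,
        Nat.cast_sub hi.le, zpow_sub₀ h2, zpow_sub₀ h2]
      field_simp
  rw [mom, map_sum, Finset.sum_congr rfl fun t _ => key t, Finset.sum_add_distrib,
    ← Finset.smul_sum]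
  congr 1
  · simp
  · congr 1
    exact Fintype.sum_equiv (Equiv.inv k) _ _ fun t => rfl

omit [Fintype k] in
theorem stable_of_generators {Y : Submodule E Q} (hu : ∀ t, ∀ x ∈ Y, R (upp t) x ∈ Y)
    (hd : ∀ a d, ∀ x ∈ Y, R (dia a d) x ∈ Y) (hw : ∀ x ∈ Y, R wey x ∈ Y) (g : GL (Fin 2) k) :
    ∀ x ∈ Y, R g x ∈ Y := by
  induction g using gl_induction with
  | hmul g h hg hh => intro x hx; rw [map_mul]; exact hg _ (hh x hx)
  | hu t => exact hu t
  | hd a d => exact hd a d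
  | hw => exact hw

theorem not_dvd_choose {p : ℕ} (hp : p.Prime) {a b : ℕ} (ha : a < p) (hb : b ≤ a) :
    ¬ p ∣ a.choose b := fun h =>
  absurd ((hp.dvd_factorial).1 (h.trans
    ⟨b.factorial * (a - b).factorial, by rw [← mul_assoc, Nat.choose_mul_factorial_mul_factorial hb]⟩))
    (by omega)

/-- Binomial coefficients of numbers with dominated base `p` digits are prime to `p`. -/
theorem not_dvd_choose_of_digits {p : ℕ} [hp : Fact p.Prime] {i j : ℕ} (h0 : j % p ≤ i % p)
    (h1 : j / p ≤ i / p) (hi : i / p < p) : ¬ p ∣ i.choose j := by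
  have h := Choose.choose_modEq_choose_mod_mul_choose_div_nat (n := i) (k := j) (p := p)
  rw [(Nat.ModEq.dvd_iff h dvd_rfl), hp.out.dvd_mul, not_or]
  exact ⟨not_dvd_choose hp.out (Nat.mod_lt _ hp.out.pos) h0, not_dvd_choose hp.out hi h1⟩

variable {p : ℕ} [hp : Fact p.Prime] [CharP E p] {l w : Q}

/-- The sum of the submodule of the principal series that meets neither the constituents `σ` nor
`κ` vanishes in a quotient all of whose submodules contain a vector of the weight of `σ`. -/
theorem mom_eq_zero (hu : ∀ t, R (upp t) v = v)
    (ht : ∀ a d : kˣ, R (dia a d) v = (ε a ^ (n - c) * ε d ^ n) • v) (hc : 1 ≤ c) {b : ℕ}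
    (hcb : c < b) (hb : b < Fintype.card k - 1)
    (hl0 : l ≠ 0) (hl : ∀ a : kˣ, R (dia a 1) l = ε a ^ (n - b) • l)
    (hY : ∀ Y : Submodule E Q, (∀ g, ∀ x ∈ Y, R g x ∈ Y) → Y ≠ ⊥ → l ∈ Y) :
    (∀ i < c, mom ε R (R wey v) i = 0) ∧ v + (-1 : E) ^ n • mom ε R (R wey v) c = 0 := by
  classical
  set f := mom ε R (R wey v) with hf
  -- The moments below `c`, completed by the Weyl conjugate of the zeroth one, span a
  -- subrepresentation: the unipotent group acts triangularly, and `w` exchanges the indices `i` and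
  -- `c - i` up to sign, as for monomials of degree `c`.
  let y : ℕ → Q := fun i => if i = c then v + (-1 : E) ^ n • f c else f i
  have hyi : ∀ i, i < c → y i = f i := fun i hi => if_neg hi.ne
  have hyc : y c = v + (-1 : E) ^ n • f c := if_pos rfl
  have hy0 : R wey (f 0) = y c := by
    rw [hyc, hf, wey_wey_mom hu ht (by omega)]
    simp
  have heig : ∀ a : kˣ, ∀ i, R (dia a 1) (y i) = ε a ^ (n - i) • y i := by
    intro a i
    have h := dia_wey_mom ht a 1
    simp only [Units.val_one, map_one, one_zpow, mul_one] at h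
    by_cases hi : i = c
    · subst hi
      have := ht a 1
      simp only [Units.val_one, map_one, one_zpow, mul_one] at this
      rw [hyc, map_add, map_smul, this, hf, h, smul_add, smul_comm]
    · simp only [y, if_neg hi]
      exact h i
  set Y : Submodule E Q := Submodule.span E (y '' {i | i ≤ c}) with hYdef
  have hmem : ∀ i, i ≤ c → y i ∈ Y := fun i hi => Submodule.subset_span ⟨i, hi, rfl⟩
  have hext : ∀ {g}, (∀ i, i ≤ c → R g (y i) ∈ Y) → ∀ x ∈ Y, R g x ∈ Y := by
    intro g h
    have : Y ≤ Y.comap (R g) := by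
      rw [hYdef, Submodule.span_le]
      rintro _ ⟨i, hi, rfl⟩
      exact h i hi
    exact this
  have hstab : ∀ g, ∀ x ∈ Y, R g x ∈ Y := by
    refine stable_of_generators (fun t => hext fun i hi => ?_) (fun a d => hext fun i hi => ?_)
      (hext fun i hi => ?_)
    · have hlow : ∀ m, m ≤ c → ∑ j ∈ Finset.range m, ((-ε t) ^ (i - j) * (i.choose j : E)) • f j ∈ Y :=
        fun m hm => Submodule.sum_mem _ fun j hj => Submodule.smul_mem _ _ (by
          have := Finset.mem_range.1 hj
          rw [← hyi j (by omega)]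
          exact hmem j (by omega))
      rcases hi.lt_or_eq with hi | rfl
      · rw [hyi i hi, hf, upp_mom]
        exact hlow (i + 1) hi
      · rw [hyc, map_add, hu, map_smul, hf, upp_mom, Finset.sum_range_succ, smul_add, add_left_comm]
        refine Submodule.add_mem _ (Submodule.smul_mem _ _ (hlow _ le_rfl)) ?_
        have := hmem i le_rfl
        rw [hyc] at this
        simpa using this
    · rcases hi.lt_or_eq with hi' | rfl
      · rw [hyi i hi', hf, dia_wey_mom ht, ← hf, ← hyi i hi']
        exact Submodule.smul_mem _ _ (hmem i hi)
      · rw [← hy0, ← Module.End.mul_apply, ← map_mul, dia_mul_wey, map_mul, Module.End.mul_apply,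
          hf, dia_wey_mom ht, map_smul, ← hf, hy0]
        exact Submodule.smul_mem _ _ (hmem i hi)
    · rcases hi.lt_or_eq with hi' | rfl
      · rcases Nat.eq_zero_or_pos i with rfl | h0
        · rw [hyi 0 hi', hy0]
          exact hmem c le_rfl
        · rw [hyi i hi', hf, wey_wey_mom hu ht hi', zero_pow h0.ne', zero_smul, zero_add, ← hf,
            ← hyi (c - i) (by omega)]
          exact Submodule.smul_mem _ _ (hmem _ (by omega))
      · rw [← hy0, ← Module.End.mul_apply, ← map_mul, wey_mul_wey, map_one, Module.End.one_apply,
          ← hyi 0 (by omega)]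
        exact hmem 0 (by omega)
  -- A nonzero `Y` would contain `l`. But the torus exponents on `Y` are `n - i` with `i ≤ c`,
  -- whereas that of `l` is `n - b` with `c < b < q - 1`, so `l` would be zero.
  have hbot : Y = ⊥ := by
    by_contra hne
    have hlY := hY Y hstab hne
    apply hl0
    rw [hYdef, show {i | i ≤ c} = ((Finset.range (c + 1) : Finset ℕ) : Set ℕ) by ext; simp,
      mem_span_image_iff_exists_sum] at hlY
    obtain ⟨a, ha⟩ := hlY
    obtain ⟨g, hg⟩ := exists_generator (k := k)
    let z : ℕ → Q := fun i => if i = b then -l else a i • y i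
    have hz : ∀ i ∈ insert b (Finset.range (c + 1)), R (dia g 1) (z i) = ε g ^ (n - i) • z i := by
      intro i _
      by_cases hib : i = b
      · subst hib
        simp only [z, if_true, map_neg, hl, smul_neg]
      · simp only [z, if_neg hib, map_smul, heig, smul_comm (a i)]
    have hinj : Set.InjOn (fun i : ℕ => ε g ^ (n - i : ℤ))
        (insert b (Finset.range (c + 1)) : Finset ℕ) := by
      intro i hi j hj hij
      have h := dvd_of_zpow_eq ε hg hij
      have hi' : i ≤ b := by
        simp only [Finset.coe_insert, Finset.coe_range, Set.mem_insert_iff, Set.mem_Iio] at hi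
        omega
      have hj' : j ≤ b := by
        simp only [Finset.coe_insert, Finset.coe_range, Set.mem_insert_iff, Set.mem_Iio] at hj
        omega
      have := Int.eq_zero_of_abs_lt_dvd h (by rw [abs_lt]; omega)
      omega
    have hbn : b ∉ Finset.range (c + 1) := by simp; omega
    have hsum : ∑ i ∈ insert b (Finset.range (c + 1)), z i = 0 := by
      rw [Finset.sum_insert hbn, Finset.sum_congr rfl (g := fun i => a i • y i), ha]
      · simp [z]
      · intro i hi
        exact if_neg fun h : i = b => hbn (h ▸ hi)
    have := eq_zero_of_sum_eigen hz hinj hsum (Finset.mem_insert_self b _)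
    simpa [z] using this
  have hzero : ∀ i, i ≤ c → y i = 0 := fun i hi => by
    have := hmem i hi
    rwa [hbot, Submodule.mem_bot] at this
  exact ⟨fun i hi => by rw [← hyi i hi, hzero i hi.le], by rw [← hyc, hzero c le_rfl]⟩

/-- The unipotent invariants of a quotient of a principal series whose socle has the weight of the
middle constituent `σ`. -/
theorem invariants_mem_span (hk : Fintype.card k = p ^ 2) {c₀ c₁ : ℕ} (hc₀ : 1 ≤ c₀)
    (hc₀' : c₀ < p) (hc₁ : c₁ + 1 < p) (hu : ∀ t, R (upp t) v = v)
    (ht : ∀ a d : kˣ, R (dia a d) v = (ε a ^ (n - (c₀ + p * c₁ : ℕ)) * ε d ^ n) • v)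
    (hspan : ⊤ ≤ Submodule.span E ({v} ∪ Set.range fun t => R (upp t) (R wey v)))
    (hl0 : l ≠ 0) (hl : ∀ a : kˣ, R (dia a 1) l = ε a ^ (n - (p * (c₁ + 1) : ℕ)) • l)
    (hY : ∀ Y : Submodule E Q, (∀ g, ∀ x ∈ Y, R g x ∈ Y) → Y ≠ ⊥ → l ∈ Y)
    (hw : ∀ t, R (upp t) w = w) : w ∈ Submodule.span E {v, l} := by
  classical
  have hcb : c₀ + p * c₁ < p * (c₁ + 1) := by rw [mul_add]; omega
  have hbq : p * (c₁ + 1) < Fintype.card k - 1 := by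
    rw [hk]
    have h1 : p * (c₁ + 1) + p ≤ p ^ 2 := by
      rw [pow_two, ← mul_add_one]
      exact Nat.mul_le_mul_left _ (by omega)
    have := hp.out.two_le
    omega
  obtain ⟨hlow, hvc⟩ := mom_eq_zero hu ht (by omega) hcb hbq hl0 hl hY
  set f := mom ε R (R wey v) with hf
  set c := c₀ + p * c₁ with hc
  set b := p * (c₁ + 1) with hb
  set q := Fintype.card k with hq
  have hv : v = -((-1 : E) ^ n • f c) := eq_neg_of_add_eq_zero_left hvc
  have heig : ∀ (a : kˣ) (i : ℕ), R (dia a 1) (f i) = ε a ^ (n - i) • f i := by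
    intro a i
    simpa using dia_wey_mom ht a 1 i
  obtain ⟨g, hg⟩ := exists_generator (k := k)
  -- As `c ≥ 1`, two indices in this interval differ by less than `q - 1`, the order of `g`, so each
  -- eigenvalue determines its moment.
  have hinj : Set.InjOn (fun i : ℕ => ε g ^ (n - i : ℤ)) (Finset.Ico c q : Finset ℕ) := by
    intro i hi j hj hij
    have h := dvd_of_zpow_eq ε hg hij
    simp only [Finset.coe_Ico, Set.mem_Ico] at hi hj
    have := Int.eq_zero_of_abs_lt_dvd h (by rw [abs_lt]; omega)
    omega
  have hrep : ∀ x : Q, ∃ a : ℕ → E, ∑ i ∈ Finset.Ico c q, a i • f i = x := by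
    intro x
    rw [← mem_span_image_iff_exists_sum]
    have hfm : ∀ i < q, f i ∈ Submodule.span E (f '' (Finset.Ico c q : Finset ℕ)) := by
      intro i hi
      rcases lt_or_ge i c with h | h
      · rw [hlow i h]; exact Submodule.zero_mem _
      · exact Submodule.subset_span ⟨i, by simp [h, hi], rfl⟩
    have hle : Submodule.span E ({v} ∪ Set.range fun t => R (upp t) (R wey v)) ≤
        Submodule.span E (f '' (Finset.Ico c q : Finset ℕ)) := by
      rw [Submodule.span_le, Set.union_subset_iff]
      constructor
      · rw [Set.singleton_subset_iff, SetLike.mem_coe, hv]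
        exact Submodule.neg_mem _ (Submodule.smul_mem _ _ (hfm c (by omega)))
      · rintro _ ⟨t, rfl⟩
        refine (Submodule.span_le.2 ?_) (upp_mem_span_mom ε R (R wey v) t)
        rintro _ ⟨i, hi, rfl⟩
        exact hfm i hi
    exact hle (hspan trivial)
  -- Comparing eigenvalues, `l` is a multiple of the single moment of index `b`; likewise `v` is one
  -- of the moment of index `c` by `hvc`. The remaining task is to exclude all other indices.
  obtain ⟨a, ha0, hfb⟩ : ∃ a : E, a ≠ 0 ∧ a • f b = l := by
    obtain ⟨a, ha⟩ := hrep l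
    let z : ℕ → Q := fun i => a i • f i - if i = b then l else 0
    have hbm : b ∈ Finset.Ico c q := by simp only [Finset.mem_Ico]; omega
    have hz : ∀ i ∈ Finset.Ico c q, R (dia g 1) (z i) = ε g ^ (n - i : ℤ) • z i := by
      intro i _
      simp only [z]
      split_ifs with h
      · subst h
        rw [map_sub, map_smul, heig, hl, smul_sub, smul_comm]
      · rw [sub_zero, map_smul, heig, smul_comm]
    have hsum : ∑ i ∈ Finset.Ico c q, z i = 0 := by
      simp only [z, Finset.sum_sub_distrib, ha, Finset.sum_ite_eq', if_pos hbm, sub_self]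
    have h := eq_zero_of_sum_eigen hz hinj hsum hbm
    simp only [z, if_true, sub_eq_zero] at h
    exact ⟨a b, fun h0 => hl0 (by rw [← h, h0, zero_smul]), h⟩
  have hfb0 : f b ≠ 0 := fun h0 => hl0 (by rw [← hfb, h0, smul_zero])
  have hfc0 : f c ≠ 0 := by
    intro h0
    apply hfb0
    rw [hf, hv, h0]
    simp [mom]
  obtain ⟨d, hd⟩ := hrep w
  have hinv : ∀ i ∈ Finset.Ico c q, ∀ t, R (upp t) (d i • f i) = d i • f i := by
    -- The torus normalizes the unipotent group and so preserves its invariants; hence every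
    -- eigencomponent of `w` is again invariant.
    let S : Submodule E Q :=
      { carrier := {x | ∀ t, R (upp t) x = x}
        add_mem' := fun ha hb t => by rw [map_add, ha, hb]
        zero_mem' := fun t => map_zero _
        smul_mem' := fun r x hx t => by rw [map_smul, hx] }
    have hS : ∀ x ∈ S, R (dia g 1) x ∈ S := by
      intro x hx t
      rw [← Module.End.mul_apply, ← map_mul]
      have h2 : upp t * dia g 1 = dia g 1 * upp (((g⁻¹ : kˣ) : k) * t) := by
        rw [dia_mul_upp]; simp
      rw [h2, map_mul, Module.End.mul_apply, hx]
    intro i hi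
    exact mem_of_sum_eigen (y := fun i => d i • f i) hS (fun i _ => by rw [map_smul, heig, smul_comm]) hinj
      (by rw [hd]; exact hw) hi
  have hcases : ∀ i ∈ Finset.Ico c q, d i ≠ 0 → f i ≠ 0 → i = c ∨ i = b := by
    intro i hi hdi hfi
    rw [Finset.mem_Ico] at hi
    have hfix : ∀ t, R (upp t) (f i) = f i := by
      intro t
      have := hinv i (Finset.mem_Ico.2 hi) t
      rw [map_smul] at this
      exact smul_right_injective Q hdi this
    -- Invariance of `f i` kills the lower terms of `upp_mom`, which have distinct eigenvalues, so
    -- they vanish one by one.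
    have hzero : ∀ j < i, ¬ p ∣ i.choose j → f j = 0 := by
      intro j hj hp
      have h1 := hfix 1
      rw [hf, upp_mom, Finset.sum_range_succ, ← hf] at h1
      have h2 : ∑ j ∈ Finset.range i, ((-ε 1) ^ (i - j) * (i.choose j : E)) • f j = 0 := by
        simpa using h1
      have hinj' : Set.InjOn (fun i : ℕ => ε g ^ (n - i : ℤ)) (Finset.range i : Finset ℕ) := by
        intro i hi j hj hij
        have h := dvd_of_zpow_eq ε hg hij
        simp only [Finset.coe_range, Set.mem_Iio] at hi hj
        have := Int.eq_zero_of_abs_lt_dvd h (by rw [abs_lt]; omega)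
        omega
      have h3 := eq_zero_of_sum_eigen (fun i _ => by rw [map_smul, heig, smul_comm]) hinj' h2
        (Finset.mem_range.2 hj)
      refine (smul_eq_zero.1 h3).resolve_left (mul_ne_zero (by simp) ?_)
      rwa [Ne, CharP.cast_eq_zero_iff E p]
    have hip : i / p < p := by
      rw [Nat.div_lt_iff_lt_mul hp.out.pos, ← pow_two, ← hk]
      exact hi.2
    by_contra! hne
    -- For `c < i < b` the upper base `p` digit of `i` is `c₁` and the lower one exceeds `c₀`, so
    -- the digits of `i` dominate those of `c`. For `i > b` they dominate those of `b`, whose lower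
    -- digit is `0`. By Lucas, `f c` or `f b` would vanish.
    rcases lt_or_gt_of_ne hne.2 with hlt | hgt
    · have hdiv : i / p = c₁ := by
        rw [Nat.div_eq_iff hp.out.pos]
        rw [mul_add, mul_one] at hb
        rw [mul_comm c₁]
        omega
      have hmod := Nat.mod_add_div i p
      rw [hdiv] at hmod
      have hcmod : c % p = c₀ := by rw [hc, Nat.add_mul_mod_self_left, Nat.mod_eq_of_lt hc₀']
      have hcdiv : c / p = c₁ := by
        rw [hc, Nat.add_mul_div_left _ _ hp.out.pos, Nat.div_eq_of_lt hc₀', zero_add]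
      exact hfc0 (hzero c (by omega) (not_dvd_choose_of_digits (by omega) (by omega) hip))
    · refine hfb0 (hzero b hgt (not_dvd_choose_of_digits ?_ ?_ hip))
      · rw [hb, Nat.mul_mod_right]
        exact Nat.zero_le _
      · exact Nat.div_le_div_right hgt.le
  rw [← hd]
  refine Submodule.sum_mem _ fun i hi => ?_
  by_cases hdi : d i = 0
  · rw [hdi, zero_smul]; exact Submodule.zero_mem _
  by_cases hfi : f i = 0
  · rw [hfi, smul_zero]; exact Submodule.zero_mem _
  refine Submodule.smul_mem _ _ ?_
  rcases hcases i hi hdi hfi with rfl | rfl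
  · have h : f c = -((-1 : E) ^ n)⁻¹ • v := by
      rw [hv, smul_neg, neg_smul, neg_neg, smul_smul, inv_mul_cancel₀ (zpow_ne_zero _ (by simp)),
        one_smul]
    rw [h]
    exact Submodule.smul_mem _ _ (Submodule.subset_span (by simp))
  · rw [← inv_smul_smul₀ ha0 (f b), hfb]
    exact Submodule.smul_mem _ _ (Submodule.subset_span (by simp))

end PrincipalSeriesQuotient

/-! ### Irreducible subrepresentations and the socle -/

section Socle

variable {E G V : Type*} [Field E] [AddCommGroup V] [Module E V] [Monoid G]
  {ρ : Representation E G V}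

theorem isIrreducible_toRepresentation_iff {W : Subrepresentation ρ} :
    Representation.IsIrreducible W.toRepresentation ↔ W.toSubmodule ≠ ⊥ ∧
      ∀ Z : Submodule E V, (∀ g, ∀ x ∈ Z, ρ g x ∈ Z) → Z ≤ W.toSubmodule →
        Z = ⊥ ∨ Z = W.toSubmodule := by
  constructor
  · intro h
    refine ⟨fun h0 => ?_, fun Z hZ hle => ?_⟩
    · refine h.1.1.choose_spec.elim fun b hb => hb (Subrepresentation.toSubmodule_injective ?_)
      have : Subsingleton W.toSubmodule := by rw [h0]; infer_instance
      exact Subsingleton.elim _ _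
    · let Z' : Subrepresentation W.toRepresentation :=
        ⟨Z.comap W.toSubmodule.subtype, fun g x hx => hZ g x hx⟩
      have hmap : Z'.toSubmodule.map W.toSubmodule.subtype = Z := by
        rw [Submodule.map_comap_subtype, inf_eq_right.2 hle]
      rcases h.2 Z' with h' | h'
      · left
        rw [← hmap, h']
        exact Submodule.map_bot _
      · right
        rw [← hmap, h']
        exact (Submodule.map_top _).trans (Submodule.range_subtype _)
  · rintro ⟨h0, h⟩
    refine { exists_pair_ne := ⟨⊥, ⊤, fun he => h0 ?_⟩, eq_bot_or_eq_top := fun Z => ?_ }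
    · have h1 : (⊥ : Submodule E W.toSubmodule) = ⊤ := congrArg Subrepresentation.toSubmodule he
      rw [← Submodule.range_subtype W.toSubmodule, ← Submodule.map_top, ← h1, Submodule.map_bot]
    · have hinj := Submodule.map_injective_of_injective W.toSubmodule.injective_subtype
      rcases h (Z.toSubmodule.map W.toSubmodule.subtype) (by
        rintro g _ ⟨x, hx, rfl⟩
        exact ⟨_, Z.apply_mem_toSubmodule g hx, rfl⟩) (Submodule.map_subtype_le _ _) with h' | h'
      · left
        apply Subrepresentation.toSubmodule_injective
        apply hinj
        rw [h']
        exact (Submodule.map_bot _).symm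
      · right
        apply Subrepresentation.toSubmodule_injective
        apply hinj
        rw [h']
        exact ((Submodule.map_top _).trans (Submodule.range_subtype _)).symm

theorem le_socle {W : Subrepresentation ρ} (hW : Representation.IsIrreducible W.toRepresentation) :
    W.toSubmodule ≤ (socle ρ).toSubmodule :=
  le_iSup₂_of_le (f := fun (W : Subrepresentation ρ)
    (_ : Representation.IsIrreducible W.toRepresentation) => W.toSubmodule) W hW le_rfl

theorem exists_irreducible_le [FiniteDimensional E V] {Y : Submodule E V}
    (hY : ∀ g, ∀ x ∈ Y, ρ g x ∈ Y) (h0 : Y ≠ ⊥) :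
    ∃ W : Subrepresentation ρ, Representation.IsIrreducible W.toRepresentation ∧
      W.toSubmodule ≤ Y := by
  obtain ⟨Z, ⟨hZ, hZ0, hZY⟩, hmin⟩ := (wellFounded_lt (α := Submodule E V)).has_min
    {Z | (∀ g, ∀ x ∈ Z, ρ g x ∈ Z) ∧ Z ≠ ⊥ ∧ Z ≤ Y} ⟨Y, hY, h0, le_rfl⟩
  refine ⟨⟨Z, fun g x => hZ g x⟩, isIrreducible_toRepresentation_iff.2 ⟨hZ0, fun T hT hTZ => ?_⟩,
    hZY⟩
  by_contra! h
  exact hmin T ⟨hT, h.1, hTZ.trans hZY⟩ (lt_of_le_of_ne hTZ h.2)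

/-- Injective maps, equivariant along a surjective homomorphism of groups, preserve socles. -/
theorem map_socle_le {G' V' : Type*} [AddCommGroup V'] [Module E V'] [Monoid G']
    {ρ' : Representation E G' V'} {φ : G' →* G} (hφ : Function.Surjective φ) {f : V →ₗ[E] V'}
    (hf : Function.Injective f) (hfφ : ∀ g x, f (ρ (φ g) x) = ρ' g (f x)) :
    (socle ρ).toSubmodule.map f ≤ (socle ρ').toSubmodule := by
  rw [Submodule.map_le_iff_le_comap]
  refine iSup₂_le fun W hW => ?_
  rw [← Submodule.map_le_iff_le_comap]
  have hst : ∀ g, ∀ x ∈ W.toSubmodule.map f, ρ' g x ∈ W.toSubmodule.map f := by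
    rintro g _ ⟨x, hx, rfl⟩
    exact ⟨_, W.apply_mem_toSubmodule (φ g) hx, hfφ g x⟩
  refine le_socle (W := ⟨W.toSubmodule.map f, fun g x => hst g x⟩)
    (isIrreducible_toRepresentation_iff.2 ?_)
  obtain ⟨h0, h⟩ := isIrreducible_toRepresentation_iff.1 hW
  refine ⟨fun hbot => h0 (Submodule.map_injective_of_injective hf (hbot.trans (Submodule.map_bot f).symm)), fun Z hZ hle => ?_⟩
  have hZmap : (Z.comap f).map f = Z := by
    rw [Submodule.map_comap_eq, inf_eq_right]
    exact hle.trans (LinearMap.map_le_range)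
  have hle' : Z.comap f ≤ W.toSubmodule := by
    intro x hx
    obtain ⟨y, hy, hyx⟩ := hle hx
    rwa [← hf hyx]
  rcases h (Z.comap f) (fun g x hx => by
    obtain ⟨g, rfl⟩ := hφ g
    rw [Submodule.mem_comap, hfφ]
    exact hZ g _ hx) hle' with h' | h'
  · left
    rw [← hZmap, h', Submodule.map_bot]
  · right
    rw [← hZmap, h']

end Socle

/-! ### The unipotent invariants of Serre weights -/

section SerreWeight

variable {E : Type*} [Field E]

/-- The monomial `X 0 ^ (r - i) * X 1 ^ i`. -/
def symMonomial (E : Type*) [Field E] (r : ℕ) (i : Fin (r + 1)) :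
    MvPolynomial.homogeneousSubmodule (Fin 2) E r :=
  ⟨MvPolynomial.X 0 ^ (r - i) * MvPolynomial.X 1 ^ (i : ℕ), by
    have h := ((MvPolynomial.isHomogeneous_X E (0 : Fin 2)).pow (r - i)).mul
      ((MvPolynomial.isHomogeneous_X E (1 : Fin 2)).pow (i : ℕ))
    rw [MvPolynomial.mem_homogeneousSubmodule]
    convert h using 1
    have := i.2
    omega⟩

theorem span_symMonomial (r : ℕ) : Submodule.span E (Set.range (symMonomial E r)) = ⊤ := by
  rw [eq_top_iff]
  rintro ⟨P, hP⟩ -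
  have hP' := (MvPolynomial.mem_homogeneousSubmodule _ _).1 hP
  have key : P ∈ (Submodule.span E (Set.range (symMonomial E r))).map
      (MvPolynomial.homogeneousSubmodule (Fin 2) E r).subtype := by
    rw [P.as_sum]
    refine Submodule.sum_mem _ fun d hd => ?_
    have hdeg := hP' (MvPolynomial.mem_support_iff.1 hd)
    rw [Finsupp.weight_apply, Finsupp.sum_fintype _ _ (by simp), Fin.sum_univ_two] at hdeg
    simp only [Pi.one_apply, smul_eq_mul, mul_one] at hdeg
    refine ⟨MvPolynomial.coeff d P • symMonomial E r ⟨d 1, by omega⟩,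
      Submodule.smul_mem _ _ (Submodule.subset_span ⟨_, rfl⟩), ?_⟩
    simp only [Submodule.subtype_apply, Submodule.coe_smul, symMonomial]
    rw [MvPolynomial.monomial_eq, Finsupp.prod_fintype _ _ (by simp), Fin.prod_univ_two,
      MvPolynomial.smul_eq_C_mul, show r - d 1 = d 0 by omega]
  obtain ⟨Q, hQ, hQP⟩ := key
  have : Q = ⟨P, hP⟩ := Subtype.ext hQP
  rwa [← this]

/-- Evaluation of homogeneous polynomials. -/
def symEval (r : ℕ) (z : Fin 2 → E) : MvPolynomial.homogeneousSubmodule (Fin 2) E r →ₗ[E] E :=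
  (MvPolynomial.aeval z).toLinearMap ∘ₗ (MvPolynomial.homogeneousSubmodule (Fin 2) E r).subtype

theorem symEval_symMonomial (r : ℕ) (z : Fin 2 → E) (i : Fin (r + 1)) :
    symEval r z (symMonomial E r i) = z 0 ^ (r - i) * z 1 ^ (i : ℕ) := by
  simp [symEval, symMonomial]

theorem symEval_symPow (r : ℕ) (z : Fin 2 → E) (g : GL (Fin 2) E)
    (P : MvPolynomial.homogeneousSubmodule (Fin 2) E r) :
    symEval r z (symPow E r g P) = symEval r (fun j => ∑ i, g i j * z i) P := by
  change MvPolynomial.aeval z (linSubst _ P.1) = MvPolynomial.aeval _ P.1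
  rw [← AlgHom.comp_apply]
  congr 1
  ext j
  simp [linSubst]

theorem symPow_symMonomial_zero (r : ℕ) (g : GL (Fin 2) E) (hg : g 1 0 = 0) :
    symPow E r g (symMonomial E r 0) = (g 0 0) ^ r • symMonomial E r 0 := by
  apply Subtype.ext
  change linSubst _ (symMonomial E r 0).1 = _
  simp [symMonomial, linSubst, hg, mul_pow, MvPolynomial.smul_eq_C_mul]

/-- A vector spanning the unipotent invariants of a Serre weight. -/
def weightVec (E : Type*) [Field E] (σ : Weight) : σ.Space E :=
  symMonomial E σ.a₀ 0 ⊗ₜ symMonomial E σ.a₁ 0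

/-- The product of the evaluations at `z₀` and `z₁`. -/
def weightEval (σ : Weight) (z₀ z₁ : Fin 2 → E) : σ.Space E →ₗ[E] E :=
  LinearMap.mul' E E ∘ₗ TensorProduct.map (symEval σ.a₀ z₀) (symEval σ.a₁ z₁)

theorem weightVec_ne_zero (σ : Weight) : weightVec E σ ≠ 0 := by
  intro h
  have := congrArg (weightEval σ ![1, 0] ![1, 0]) h
  simp [weightEval, weightVec, symEval_symMonomial] at this

theorem exists_weight_coeff (σ : Weight) (v : σ.Space E) :
    ∃ a : Fin (σ.a₀ + 1) → Fin (σ.a₁ + 1) → E,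
      v = ∑ i, ∑ j, a i j • (symMonomial E σ.a₀ i ⊗ₜ[E] symMonomial E σ.a₁ j) := by
  induction v using TensorProduct.induction_on with
  | zero => exact ⟨0, by simp⟩
  | add v w hv hw =>
    obtain ⟨a, rfl⟩ := hv
    obtain ⟨b, rfl⟩ := hw
    exact ⟨a + b, by simp [add_smul, Finset.sum_add_distrib]⟩
  | tmul x y =>
    have hx : x ∈ Submodule.span E (Set.range (symMonomial E σ.a₀)) := by
      rw [span_symMonomial]; trivial
    have hy : y ∈ Submodule.span E (Set.range (symMonomial E σ.a₁)) := by
      rw [span_symMonomial]; trivial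
    rw [Submodule.mem_span_range_iff_exists_fun] at hx hy
    obtain ⟨a, rfl⟩ := hx
    obtain ⟨b, rfl⟩ := hy
    refine ⟨fun i j => a i * b j, ?_⟩
    simp only [TensorProduct.sum_tmul, TensorProduct.tmul_sum, TensorProduct.smul_tmul_smul]
    exact Finset.sum_comm

variable {p : ℕ} [hp : Fact p.Prime] [CharP E p] {k : Type*} [Field k] (ε : k →+* E)

theorem serreWeight_apply (σ : Weight) (g : GL (Fin 2) k) (v : σ.Space E) :
    serreWeight p ε σ g v = ε (Matrix.det (g : Matrix (Fin 2) (Fin 2) k)) ^ σ.m •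
      TensorProduct.map (symPow E σ.a₀ (Matrix.GeneralLinearGroup.map ε g))
        (symPow E σ.a₁ (Matrix.GeneralLinearGroup.map ((frobenius E p).comp ε) g)) v := rfl

theorem serreWeight_upp_weightVec (σ : Weight) (t : k) :
    serreWeight p ε σ (upp t) (weightVec E σ) = weightVec E σ := by
  rw [serreWeight_apply, weightVec, TensorProduct.map_tmul, symPow_symMonomial_zero,
    symPow_symMonomial_zero]
  all_goals simp [coe_upp]

theorem serreWeight_dia_weightVec (σ : Weight) (a d : kˣ) :
    serreWeight p ε σ (dia a d) (weightVec E σ) =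
      (ε a ^ (σ.m + σ.a₀ + p * σ.a₁) * ε d ^ σ.m) • weightVec E σ := by
  rw [serreWeight_apply, weightVec, TensorProduct.map_tmul, symPow_symMonomial_zero,
    symPow_symMonomial_zero, TensorProduct.smul_tmul_smul, smul_smul]
  · congr 1
    have ha : ε (a : k) ≠ 0 := by simp
    simp only [coe_dia, Matrix.GeneralLinearGroup.map_apply]
    simp [Matrix.det_fin_two, frobenius_def, mul_zpow, zpow_add₀ ha, zpow_mul]
    ring_nf
  all_goals simp [coe_dia]

/-- Evaluating at `(1, t)` and `(1, t ^ p)` turns the coefficients of `v` into those of the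
polynomial `∑ a i j T ^ (i + p * j)`. Invariance makes it constant on the image of `k`; its degree
is less than `q`, so it is constant, and uniqueness of base `p` digits leaves only `a 0 0`. -/
theorem mem_span_weightVec [Fintype k] (hk : Fintype.card k = p ^ 2) {σ : Weight} (h₀ : σ.a₀ < p)
    (h₁ : σ.a₁ < p) {v : σ.Space E} (hv : ∀ t, serreWeight p ε σ (upp t) v = v) :
    v ∈ Submodule.span E {weightVec E σ} := by
  classical
  obtain ⟨a, ha⟩ := exists_weight_coeff σ v
  have heval : ∀ t, weightEval σ ![1, ε t] ![1, ε t ^ p] v = weightEval σ ![1, 0] ![1, 0] v := by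
    intro t
    conv_rhs => rw [← hv t]
    rw [ha, serreWeight_apply]
    simp only [map_sum, map_smul, TensorProduct.map_tmul, weightEval, LinearMap.comp_apply,
      LinearMap.mul'_apply, symEval_symPow]
    simp [coe_upp, Fin.sum_univ_two, symEval_symMonomial, frobenius_def]
  have hev : ∀ s : E, weightEval σ ![1, s] ![1, s ^ p] v =
      ∑ i, ∑ j, a i j * s ^ ((i : ℕ) + p * (j : ℕ)) := by
    intro s
    rw [ha]
    simp [weightEval, symEval_symMonomial, pow_add, pow_mul]
  set K := weightEval σ ![1, 0] ![1, 0] v with hK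
  let P : Polynomial E := ∑ i, ∑ j, Polynomial.C (a i j) * Polynomial.X ^ ((i : ℕ) + p * (j : ℕ)) -
    Polynomial.C K
  have hdigit : ∀ (i : Fin (σ.a₀ + 1)) (j : Fin (σ.a₁ + 1)), (i : ℕ) + p * (j : ℕ) < p ^ 2 := by
    intro i j
    have h := Nat.mul_le_mul_left p (show (j : ℕ) + 1 ≤ p by omega)
    rw [← pow_two, mul_add] at h
    omega
  have hdeg : P ∈ Polynomial.degreeLT E (p ^ 2) := by
    refine Submodule.sub_mem _ (Submodule.sum_mem _ fun i _ => Submodule.sum_mem _ fun j _ => ?_) ?_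
    · rw [Polynomial.mem_degreeLT]
      exact lt_of_le_of_lt (Polynomial.degree_C_mul_X_pow_le _ _) (by exact_mod_cast hdigit i j)
    · rw [Polynomial.mem_degreeLT]
      exact lt_of_le_of_lt Polynomial.degree_C_le (by exact_mod_cast pow_pos hp.out.pos 2)
  have hP : P = 0 := by
    by_contra h0
    refine h0 (Polynomial.eq_zero_of_natDegree_lt_card_of_eval_eq_zero P ε.injective
      (fun t => ?_) ?_)
    · simp only [P, Polynomial.eval_sub, Polynomial.eval_finsetSum, Polynomial.eval_mul,
        Polynomial.eval_C, Polynomial.eval_pow, Polynomial.eval_X]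
      rw [← hev, heval, sub_self]
    · rw [hk, Polynomial.natDegree_lt_iff_degree_lt h0]
      exact Polynomial.mem_degreeLT.1 hdeg
  have hinj : ∀ (i i' : Fin (σ.a₀ + 1)) (j j' : Fin (σ.a₁ + 1)),
      (i : ℕ) + p * (j : ℕ) = (i' : ℕ) + p * (j' : ℕ) → i = i' ∧ j = j' := by
    intro i i' j j' h
    have hi : (i : ℕ) < p := by omega
    have hi' : (i' : ℕ) < p := by omega
    have h1 := congrArg (· % p) h
    simp only [Nat.add_mul_mod_self_left, Nat.mod_eq_of_lt hi, Nat.mod_eq_of_lt hi'] at h1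
    rw [h1, Nat.add_left_cancel_iff] at h
    exact ⟨Fin.ext h1, Fin.ext (Nat.eq_of_mul_eq_mul_left hp.out.pos h)⟩
  have hcoeff : ∀ i j, ¬ (i = 0 ∧ j = 0) → a i j = 0 := by
    intro i j hij
    have h := congrArg (fun f => Polynomial.coeff f ((i : ℕ) + p * (j : ℕ))) hP
    simp only [P, Polynomial.coeff_sub, Polynomial.finsetSum_coeff, Polynomial.coeff_C_mul,
      Polynomial.coeff_X_pow, Polynomial.coeff_zero, Polynomial.coeff_C] at h
    rw [if_neg, sub_zero, Finset.sum_eq_single i, Finset.sum_eq_single j] at h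
    · simpa using h
    · intro j' _ hj'
      rw [if_neg fun h' => hj' (hinj _ _ _ _ h').2.symm, mul_zero]
    · simp
    · intro i' _ hi'
      refine Finset.sum_eq_zero fun j' _ => ?_
      rw [if_neg fun h' => hi' (hinj _ _ _ _ h').1.symm, mul_zero]
    · simp
    · intro h0
      exact hij (hinj i 0 j 0 (by simpa using h0))
  rw [Submodule.mem_span_singleton]
  refine ⟨a 0 0, ?_⟩
  rw [ha, Finset.sum_eq_single 0, Finset.sum_eq_single 0, weightVec]
  · intro j _ hj
    rw [hcoeff 0 j (by simp [hj]), zero_smul]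
  · simp
  · intro i _ hi
    exact Finset.sum_eq_zero fun j _ => by rw [hcoeff i j (by simp [hi]), zero_smul]
  · simp

end SerreWeight

/-! ### The canonical generator of a principal series -/

section PrincipalSeries

variable {k E : Type*} [Field k] [Field E] (χ : borel k →* E)

open Classical in
/-- The function supported on the Borel subgroup and extending the character there. -/
def indGen : Representation.coindV (borel k).subtype
    (twist χ (Representation.trivial E (borel k) E)) :=
  ⟨fun g => if h : g ∈ borel k then χ ⟨g, h⟩ else 0, by
    intro b g
    change _ = χ b • (_ : E)
    beta_reduce
    by_cases h : g ∈ borel k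
    · have h' : (borel k).subtype b * g ∈ borel k := (borel k).mul_mem b.2 h
      rw [dif_pos h, dif_pos h', smul_eq_mul, Representation.trivial_apply, ← map_mul]
      rfl
    · have h' : (borel k).subtype b * g ∉ borel k := fun hg =>
        h (((borel k).mul_mem_cancel_left b.2).1 hg)
      rw [dif_neg h, dif_neg h', map_zero, smul_zero]⟩

theorem indGen_of_mem {g : GL (Fin 2) k} (h : g ∈ borel k) : (indGen χ).1 g = χ ⟨g, h⟩ := dif_pos h

theorem indGen_of_notMem {g : GL (Fin 2) k} (h : g ∉ borel k) : (indGen χ).1 g = 0 := dif_neg h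

theorem coind_mul (f : Representation.coindV (borel k).subtype
    (twist χ (Representation.trivial E (borel k) E))) (b : borel k) (g : GL (Fin 2) k) :
    f.1 (b * g) = χ b * f.1 g := f.2 b g

theorem indBorel_indGen (b : borel k) : indBorel χ b (indGen χ) = χ b • indGen χ := by
  apply Subtype.ext
  funext g
  change (indGen χ).1 (g * b) = χ b * (indGen χ).1 g
  by_cases h : g ∈ borel k
  · rw [indGen_of_mem χ h, indGen_of_mem χ ((borel k).mul_mem h b.2), mul_comm, ← map_mul]
    rfl
  · rw [indGen_of_notMem χ h, indGen_of_notMem χ fun hg =>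
      h (((borel k).mul_mem_cancel_right b.2).1 hg), mul_zero]

theorem mem_borel_iff {g : GL (Fin 2) k} : g ∈ borel k ↔ g 1 0 = 0 := Iff.rfl

theorem mul_upp_wey_mem {g : GL (Fin 2) k} {t : k} :
    g * (upp (-t) * wey) ∈ borel k ↔ g 1 1 = t * g 1 0 := by
  rw [mem_borel_iff]
  have : (g * (upp (-t) * wey) : GL (Fin 2) k) 1 0 = g 1 1 - t * g 1 0 := by
    simp only [Units.val_mul, coe_upp, coe_wey, Matrix.mul_apply, Fin.sum_univ_two]
    simp
    ring
  rw [this, sub_eq_zero]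

/-- This is the Bruhat decomposition: the cosets `B` and `B w u(t)` partition the group, and the
translate by `u(-t) w` of the function supported on `B` is supported on `B w u(t)`. -/
theorem indBorel_eq_sum [Fintype k] (f : Representation.coindV (borel k).subtype
    (twist χ (Representation.trivial E (borel k) E))) :
    f = f.1 1 • indGen χ +
      ∑ t : k, f.1 (wey * upp t) • indBorel χ (upp (-t)) (indBorel χ wey (indGen χ)) := by
  apply Subtype.ext
  funext g
  have hsum : (∑ t : k, f.1 (wey * upp t) • indBorel χ (upp (-t)) (indBorel χ wey (indGen χ))).1 g =
      ∑ t : k, f.1 (wey * upp t) * (indGen χ).1 (g * (upp (-t) * wey)) := by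
    rw [← Submodule.subtype_apply, map_sum, Finset.sum_apply]
    refine Finset.sum_congr rfl fun t _ => ?_
    rw [← mul_assoc]
    rfl
  change f.1 g = f.1 1 * (indGen χ).1 g + (∑ t : k, f.1 (wey * upp t) •
    indBorel χ (upp (-t)) (indBorel χ wey (indGen χ))).1 g
  rw [hsum]
  by_cases h : g ∈ borel k
  · have hg11 : g 1 1 ≠ 0 := by
      have := (Matrix.isUnit_iff_isUnit_det _).1 g.isUnit
      rw [Matrix.det_fin_two, mem_borel_iff.1 h] at this
      simp at this
      exact this.2
    rw [Finset.sum_eq_zero, add_zero, indGen_of_mem χ h, mul_comm, ← coind_mul, mul_one]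
    intro t _
    rw [indGen_of_notMem, mul_zero]
    rw [mul_upp_wey_mem, mem_borel_iff.1 h, mul_zero]
    exact hg11
  · have hg10 : g 1 0 ≠ 0 := h
    rw [indGen_of_notMem χ h, mul_zero, zero_add, Finset.sum_eq_single (g 1 1 / g 1 0)]
    · have hb : g * (upp (-(g 1 1 / g 1 0)) * wey) ∈ borel k := by
        rw [mul_upp_wey_mem, div_mul_cancel₀ _ hg10]
      rw [indGen_of_mem χ hb, mul_comm, ← coind_mul]
      rw [mul_assoc, mul_assoc, ← mul_assoc wey wey, wey_mul_wey, one_mul, upp_mul_upp,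
        neg_add_cancel, upp_zero, mul_one]
    · intro t _ ht
      rw [indGen_of_notMem, mul_zero]
      rw [mul_upp_wey_mem]
      intro h'
      exact ht (by rw [h', mul_div_cancel_right₀ _ hg10])
    · simp

end PrincipalSeries

/-! ### The structure of `Q_{j}(σ)` -/

/-- The numerator in the definition is an exact double, so the twist can be written without
division. The same holds for `cosocle_one`. -/
theorem cosocle_zero {p : ℕ} {σ : Weight} (h₀ : σ.a₀ + 2 ≤ p) :
    σ.cosocle p 0 = ⟨σ.m + (σ.a₀ + 1 - p), p - 2 - σ.a₀, σ.a₁ + 1⟩ := by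
  obtain ⟨u₀, hu₀⟩ := Nat.exists_eq_add_of_le h₀
  have hp₀ : (p : ℤ) = σ.a₀ + 2 + u₀ := by exact_mod_cast hu₀
  have h : ((σ.a₀ - u₀ : ℤ) + p * (σ.a₁ - (σ.a₁ + 1 : ℕ) : ℤ)) = 2 * (σ.a₀ + 1 - p) := by
    push_cast
    linear_combination hp₀
  simp only [Weight.cosocle, if_true, Weight.plus]
  rw [show p - 2 - σ.a₀ = u₀ by omega, h, Int.mul_ediv_cancel_left _ two_ne_zero]

theorem cosocle_one {p : ℕ} {σ : Weight} (h₁ : σ.a₁ + 2 ≤ p) :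
    σ.cosocle p 1 = ⟨σ.m + (p * σ.a₁ + p - 1), σ.a₀ + 1, p - 2 - σ.a₁⟩ := by
  obtain ⟨u₁, hu₁⟩ := Nat.exists_eq_add_of_le h₁
  have hp₁ : (p : ℤ) = σ.a₁ + 2 + u₁ := by exact_mod_cast hu₁
  have h : ((p : ℤ) ^ 2 - 1 + (σ.a₀ - (σ.a₀ + 1 : ℕ) : ℤ) + p * (σ.a₁ - u₁ : ℤ)) =
      2 * (p * σ.a₁ + p - 1) := by
    push_cast
    linear_combination p * hp₁
  simp only [Weight.cosocle, Weight.minus, one_ne_zero, if_false]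
  rw [show p - 2 - σ.a₁ = u₁ by omega, h, Int.mul_ediv_cancel_left _ two_ne_zero]

section QStructure

variable {p : ℕ} [hp : Fact p.Prime] {k E : Type*} [Field k] [Field E] [CharP E p]
  {ε₀ : k →+* E} {X : Type*} [AddCommGroup X] [Module E X]

/-- `v` is a unipotent invariant vector on which `B` acts by `χ(κ)`. -/
structure IsHighestWeight (p : ℕ) (ε₀ : k →+* E) (κ : Weight)
    (R : Representation E (GL (Fin 2) k) X) (v : X) : Prop where
  upp : ∀ t, R (upp t) v = v
  dia : ∀ a d : kˣ, R (dia a d) v = (ε₀ a ^ (κ.m + κ.a₀ + p * κ.a₁) * ε₀ d ^ κ.m) • v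

omit hp [CharP E p] in
theorem exists_generator_of_surjective [Fintype k] {κ : Weight}
    {R : Representation E (GL (Fin 2) k) X}
    {f : Representation.IntertwiningMap (indBorel (weightChar p ε₀ κ)) R}
    (hf : Function.Surjective f) : ∃ v : X, IsHighestWeight p ε₀ κ R v ∧
      ⊤ ≤ Submodule.span E ({v} ∪ Set.range fun t => R (upp t) (R wey v)) := by
  have hB : ∀ b : borel k, R b (f (indGen _)) = weightChar p ε₀ κ b • f (indGen _) := by
    intro b
    rw [← f.isIntertwining, indBorel_indGen]
    exact map_smul f.toLinearMap _ _
  refine ⟨f (indGen _), ⟨fun t => ?_, fun a d => ?_⟩, fun x _ => ?_⟩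
  · rw [hB ⟨upp t, by simp [mem_borel_iff, coe_upp]⟩]
    simp [weightChar, coe_upp]
  · rw [hB ⟨dia a d, by simp [mem_borel_iff, coe_dia]⟩]
    simp [weightChar, coe_dia]
  · obtain ⟨y, rfl⟩ := hf x
    rw [indBorel_eq_sum _ y]
    change f.toLinearMap _ ∈ _
    rw [map_add, map_smul, map_sum]
    refine Submodule.add_mem _ (Submodule.smul_mem _ _ (Submodule.subset_span (Or.inl rfl)))
      (Submodule.sum_mem _ fun t _ => ?_)
    rw [map_smul]
    refine Submodule.smul_mem _ _ (Submodule.subset_span (Or.inr ⟨-t, ?_⟩))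
    change _ = f _
    rw [f.isIntertwining, f.isIntertwining]

/-- The properties of `Q_{j}(σ)`, in terms of vectors `v` and `l` generating the unipotent
invariants. -/
structure IsQGen (p : ℕ) [Fact p.Prime] [CharP E p] (ε₀ : k →+* E) (κ σ : Weight)
    (R : Representation E (GL (Fin 2) k) X) (v l : X) : Prop where
  finite : FiniteDimensional E X
  gen : IsHighestWeight p ε₀ κ R v
  soc : IsHighestWeight p ε₀ σ R l
  ne_zero : l ≠ 0
  mem_socle : l ∈ (socle R).toSubmodule
  eq_top : ∀ Y : Submodule E X, (∀ g, ∀ x ∈ Y, R g x ∈ Y) → v ∈ Y → Y = ⊤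
  fixed : ∀ w, (∀ t, R (upp t) w = w) → w ∈ Submodule.span E {v, l}
  fixed_socle : ∀ w ∈ (socle R).toSubmodule, (∀ t, R (upp t) w = w) → w ∈ Submodule.span E {l}

variable {σ : Weight} {R : Representation E (GL (Fin 2) k) X}

/-- A nonzero subrepresentation contains an irreducible one, which lies in the socle and has a
nonzero unipotent invariant by `exists_fixed`. As the invariants of the socle form the line of `l`,
this vector is a multiple of `l`. -/
theorem exists_socle_generator [Fintype k] [FiniteDimensional E X] (hk : Fintype.card k = p ^ 2)
    (h₀ : σ.a₀ < p) (h₁ : σ.a₁ < p)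
    (φ : (socle R).toRepresentation.Equiv (serreWeight p ε₀ σ)) :
    ∃ l ∈ (socle R).toSubmodule, l ≠ 0 ∧ IsHighestWeight p ε₀ σ R l ∧
      (∀ w ∈ (socle R).toSubmodule, (∀ t, R (upp t) w = w) → w ∈ Submodule.span E {l}) ∧
      ∀ Y : Submodule E X, (∀ g, ∀ x ∈ Y, R g x ∈ Y) → Y ≠ ⊥ → l ∈ Y := by
  have hφ : ∀ g x, φ ((socle R).toRepresentation g x) = serreWeight p ε₀ σ g (φ x) :=
    fun g x => φ.toIntertwiningMap.isIntertwining _ _ g x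
  set l := φ.toLinearEquiv.symm (weightVec E σ) with hl
  have hφl : φ l = weightVec E σ := φ.toLinearEquiv.apply_symm_apply _
  have hfix : ∀ w ∈ (socle R).toSubmodule, (∀ t, R (upp t) w = w) →
      w ∈ Submodule.span E {(l : X)} := by
    intro w hw hwt
    have h : φ ⟨w, hw⟩ ∈ Submodule.span E {weightVec E σ} := by
      refine mem_span_weightVec ε₀ hk h₀ h₁ fun t => ?_
      rw [← hφ]
      congr 1
      exact Subtype.ext (hwt t)
    obtain ⟨a, ha⟩ := Submodule.mem_span_singleton.1 h
    refine Submodule.mem_span_singleton.2 ⟨a, ?_⟩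
    have : a • l = ⟨w, hw⟩ := by
      apply φ.toLinearEquiv.injective
      rw [map_smul]
      exact (congrArg (a • ·) hφl).trans ha
    exact congrArg Subtype.val this
  refine ⟨l, l.2, fun h0 => ?_, ⟨fun t => ?_, fun a d => ?_⟩, hfix, fun Y hY hY0 => ?_⟩
  · apply weightVec_ne_zero (E := E) σ
    rw [← hφl, show l = 0 from Subtype.ext h0]
    exact map_zero φ.toLinearEquiv
  · have : (socle R).toRepresentation (upp t) l = l := by
      apply φ.toLinearEquiv.injective
      change φ _ = φ _
      rw [hφ, hφl, serreWeight_upp_weightVec]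
    exact congrArg Subtype.val this
  · have : (socle R).toRepresentation (dia a d) l =
        (ε₀ a ^ (σ.m + σ.a₀ + p * σ.a₁) * ε₀ d ^ σ.m) • l := by
      apply φ.toLinearEquiv.injective
      rw [map_smul]
      change φ _ = _ • φ _
      rw [hφ, hφl, serreWeight_dia_weightVec]
    exact congrArg Subtype.val this
  · obtain ⟨W, hW, hWY⟩ := exists_irreducible_le hY hY0
    obtain ⟨y, hy, hy0, hyt⟩ := exists_fixed R ε₀ (S := W.toSubmodule)
      (fun t x hx => W.apply_mem_toSubmodule _ hx) (isIrreducible_toRepresentation_iff.1 hW).1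
    obtain ⟨a, ha⟩ := Submodule.mem_span_singleton.1 (hfix y (le_socle hW hy) hyt)
    have ha0 : a ≠ 0 := fun h => hy0 (by rw [← ha, h, zero_smul])
    rw [← inv_smul_smul₀ ha0 (l : X), ha]
    exact Y.smul_mem _ (hWY hy)

theorem zpow_eq_of_dvd [Fintype k] (ε : k →+* E) (a : kˣ) {i j : ℤ}
    (h : ((Fintype.card k : ℤ) - 1) ∣ i - j) : ε a ^ i = ε a ^ j := by
  classical
  obtain ⟨m, hm⟩ := h
  have h1 : ε (a : k) ^ ((Fintype.card k : ℤ) - 1) = 1 := by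
    have h2 := FiniteField.pow_card_sub_one_eq_one (a : k) a.ne_zero
    rw [← map_zpow₀, ← Nat.cast_one, ← Nat.cast_sub Fintype.card_pos, zpow_natCast, h2, map_one]
  rw [show i = j + ((Fintype.card k : ℤ) - 1) * m by omega, zpow_add₀ (by simp), zpow_mul, h1,
    one_zpow, mul_one]

/-- Both cases reduce to `invariants_mem_span`, where the digits of `c` are complementary to those
of the cosocle. For `j = 1` the two digits play exchanged roles, which is achieved by replacing `ε₀`
with its Frobenius twist. -/
theorem exists_isQGen [Fintype k] (hk : Fintype.card k = p ^ 2) {j : Fin 2} (h₀ : σ.a₀ + 2 ≤ p)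
    (h₁ : σ.a₁ + 2 ≤ p) (hX : IsQ p ε₀ j σ R) :
    ∃ v l : X, IsQGen p ε₀ (σ.cosocle p j) σ R v l := by
  obtain ⟨⟨f, hf⟩, ⟨φ⟩⟩ := hX
  obtain ⟨v, hv, hspan⟩ := exists_generator_of_surjective hf
  have hfin : FiniteDimensional E X := by
    refine Module.finite_def.2 (Submodule.fg_def.2 ⟨_, ?_, top_le_iff.1 hspan⟩)
    exact (Set.finite_singleton v).union (Set.finite_range _)
  obtain ⟨l, hls, hl0, hl, hfix, hY⟩ := exists_socle_generator hk (by omega) (by omega) φ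
  refine ⟨v, l, hfin, hv, hl, hl0, hls, fun Y hY hvY => ?_, fun w hw => ?_, hfix⟩
  · rw [eq_top_iff]
    refine hspan.trans (Submodule.span_le.2 ?_)
    rintro _ (rfl | ⟨t, rfl⟩)
    · exact hvY
    · exact hY _ _ (hY _ _ hvY)
  · have hkz : (Fintype.card k : ℤ) = p ^ 2 := by rw [hk]; push_cast; rfl
    obtain ⟨u₀, hu₀⟩ := Nat.exists_eq_add_of_le h₀
    obtain ⟨u₁, hu₁⟩ := Nat.exists_eq_add_of_le h₁
    have hp₀ : (p : ℤ) = σ.a₀ + 2 + u₀ := by exact_mod_cast hu₀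
    have hp₁ : (p : ℤ) = σ.a₁ + 2 + u₁ := by exact_mod_cast hu₁
    by_cases hj : j = 0
    · subst hj
      rw [cosocle_zero h₀, show p - 2 - σ.a₀ = u₀ by omega] at hv
      refine invariants_mem_span (ε := ε₀) (n := σ.m + (σ.a₀ + 1 - p)) hk
        (c₀ := σ.a₀ + 1) (c₁ := u₁) (by omega) (by omega) (by omega) hv.upp (fun a d => ?_) hspan
        hl0 (fun a => ?_) hY hw
      · rw [hv.dia]
        congr 2
        refine zpow_eq_of_dvd ε₀ a ⟨1, ?_⟩
        rw [hkz]
        push_cast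
        linear_combination -p * hp₁ - hp₀
      · have := hl.dia a 1
        simp only [Units.val_one, map_one, one_zpow, mul_one] at this
        rw [this]
        congr 1
        refine zpow_eq_of_dvd ε₀ a ⟨1, ?_⟩
        rw [hkz]
        push_cast
        linear_combination -p * hp₁
    · obtain rfl : j = 1 := by omega
      rw [cosocle_one h₁, show p - 2 - σ.a₁ = u₁ by omega] at hv
      have hε : ∀ (a : kˣ) (i : ℤ), ((frobenius E p).comp ε₀) a ^ i = ε₀ a ^ (p * i) := by
        intro a i
        rw [zpow_mul, zpow_natCast]
        rfl
      -- Since `ε₀ = ε₁ ^ p` on `k`, passing to `ε₁` multiplies exponents by `p`, which modulo `p ^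
      -- 2 - 1` swaps the digits.
      refine invariants_mem_span (ε := (frobenius E p).comp ε₀)
        (n := p * (σ.m + (p * σ.a₁ + p - 1))) hk
        (c₀ := σ.a₁ + 1) (c₁ := u₀) (by omega) (by omega) (by omega) hv.upp (fun a d => ?_) hspan
        hl0 (fun a => ?_) hY hw
      · rw [hv.dia, hε, hε]
        congr 2
        · refine zpow_eq_of_dvd ε₀ a ⟨-(σ.m + (p * σ.a₁ + p - 1)) + u₀ + 1, ?_⟩
          rw [hkz]
          push_cast
          linear_combination -p * hp₁ - hp₀
        · refine zpow_eq_of_dvd ε₀ d ⟨-(σ.m + (p * σ.a₁ + p - 1)), ?_⟩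
          rw [hkz]
          push_cast
          ring
      · have := hl.dia a 1
        simp only [Units.val_one, map_one, one_zpow, mul_one] at this
        rw [this, hε]
        congr 1
        refine zpow_eq_of_dvd ε₀ a ⟨-(σ.m + (p * σ.a₁ + p - 1) - u₀ - 1), ?_⟩
        rw [hkz]
        push_cast
        linear_combination -hp₀

end QStructure

/-! ### Distinctness of characters -/

section CharacterDistinct

variable {p : ℕ}

/-- The weights have the same digits, and their twists agree modulo `p ^ 2 - 1`. -/
def Weight.Congr (p : ℕ) (κ κ' : Weight) : Prop :=
  ((p : ℤ) ^ 2 - 1) ∣ κ.m - κ'.m ∧ κ.a₀ = κ'.a₀ ∧ κ.a₁ = κ'.a₁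

/-- Digits less than `p`, not all equal to `p - 1`. -/
structure Weight.IsDigits (p : ℕ) (κ : Weight) : Prop where
  lt₀ : κ.a₀ < p
  lt₁ : κ.a₁ < p
  lt : κ.a₀ + p * κ.a₁ + 1 < p ^ 2

/-- The exponents of the two torus variables determine the twist and `a₀ + p * a₁` modulo `p ^ 2 -
1`. The only ambiguity in the digits, between `(0, 0)` and `(p - 1, p - 1)`, is excluded by
`IsDigits`. -/
theorem IsHighestWeight.congr [hp : Fact p.Prime] {k E X : Type*} [Field k] [Fintype k] [Field E]
    (hk : Fintype.card k = p ^ 2) {ε₀ : k →+* E} [AddCommGroup X] [Module E X] {κ κ' : Weight}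
    {R : Representation E (GL (Fin 2) k) X} {v : X} (hv : IsHighestWeight p ε₀ κ R v)
    (hv' : IsHighestWeight p ε₀ κ' R v) (h0 : v ≠ 0) (hκ : κ.IsDigits p) (hκ' : κ'.IsDigits p) :
    κ.Congr p κ' := by
  have key : ∀ a d : kˣ, ε₀ a ^ (κ.m + κ.a₀ + p * κ.a₁) * ε₀ d ^ κ.m =
      ε₀ a ^ (κ'.m + κ'.a₀ + p * κ'.a₁) * ε₀ d ^ κ'.m := fun a d =>
    smul_left_injective E h0 ((hv.dia a d).symm.trans (hv'.dia a d))
  obtain ⟨g, hg⟩ := exists_generator (k := k)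
  have hpos : 1 ≤ p ^ 2 := Nat.one_le_pow _ _ hp.out.pos
  have hcast : ((Fintype.card k - 1 : ℕ) : ℤ) = (p : ℤ) ^ 2 - 1 := by
    rw [hk, Nat.cast_sub hpos]
    push_cast
    rfl
  have h1 := dvd_of_zpow_eq ε₀ hg (by simpa using key 1 g)
  have h2 := dvd_of_zpow_eq ε₀ hg (by simpa using key g 1)
  rw [hcast] at h1 h2
  have h3 : ((p : ℤ) ^ 2 - 1) ∣ ((κ.a₀ + p * κ.a₁ : ℕ) : ℤ) - ((κ'.a₀ + p * κ'.a₁ : ℕ) : ℤ) := by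
    have := dvd_sub h2 h1
    rwa [show κ.m + κ.a₀ + p * κ.a₁ - (κ'.m + κ'.a₀ + p * κ'.a₁) - (κ.m - κ'.m) =
      ((κ.a₀ + p * κ.a₁ : ℕ) : ℤ) - ((κ'.a₀ + p * κ'.a₁ : ℕ) : ℤ) by push_cast; ring] at this
  have hl : ((κ.a₀ + p * κ.a₁ : ℕ) : ℤ) + 1 < (p : ℤ) ^ 2 := by exact_mod_cast hκ.lt
  have hl' : ((κ'.a₀ + p * κ'.a₁ : ℕ) : ℤ) + 1 < (p : ℤ) ^ 2 := by exact_mod_cast hκ'.lt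
  have h4 := Int.eq_zero_of_abs_lt_dvd h3 (by rw [abs_lt]; omega)
  have h5 : κ.a₀ + p * κ.a₁ = κ'.a₀ + p * κ'.a₁ := by omega
  have h6 := congrArg (· % p) h5
  simp only [Nat.add_mul_mod_self_left, Nat.mod_eq_of_lt hκ.lt₀, Nat.mod_eq_of_lt hκ'.lt₀] at h6
  rw [h6, Nat.add_left_cancel_iff] at h5
  exact ⟨h1, h6, Nat.eq_of_mul_eq_mul_left hp.out.pos h5⟩

/-- Whenever two weights below have the same digits by accident, their twists differ by half of `p ^
2 - 1`; this lemma then separates them. -/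
theorem not_dvd_of_two_mul_eq (hp : 2 ≤ p) {d : ℤ} (h : 2 * d = p ^ 2 - 1) :
    ¬ ((p : ℤ) ^ 2 - 1) ∣ d := by
  rintro ⟨t, rfl⟩
  have hq : (p : ℤ) ^ 2 - 1 ≠ 0 := by
    have : (2 : ℤ) ≤ p := by exact_mod_cast hp
    nlinarith
  have h1 : (p : ℤ) ^ 2 - 1 = ((p : ℤ) ^ 2 - 1) * (2 * t) := by linear_combination -h
  have h2 := mul_left_cancel₀ hq (h1.symm.trans (mul_one _).symm)
  omega

variable {σ : Weight}

theorem IsDigits.of_add_two_le (h₀ : σ.a₀ + 2 ≤ p) (h₁ : σ.a₁ + 2 ≤ p) : σ.IsDigits p := by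
  obtain ⟨u, hu⟩ := Nat.exists_eq_add_of_le h₁
  refine ⟨by omega, by omega, ?_⟩
  have : p ^ 2 = p * σ.a₁ + p * 2 + p * u := by
    rw [pow_two, ← mul_add, ← mul_add, ← hu]
  omega

theorem isDigits_cosocle (h₀ : σ.a₀ + 2 ≤ p) (h₁ : σ.a₁ + 2 ≤ p) (j : Fin 2) :
    (σ.cosocle p j).IsDigits p := by
  obtain ⟨u, hu⟩ := Nat.exists_eq_add_of_le h₁
  have hp2 : p ^ 2 = p * σ.a₁ + p * 2 + p * u := by
    rw [pow_two, ← mul_add, ← mul_add, ← hu]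
  by_cases hj : j = 0
  · subst hj
    rw [cosocle_zero h₀]
    refine ⟨by dsimp only; omega, by dsimp only; omega, ?_⟩
    dsimp only
    rw [mul_add]
    omega
  · obtain rfl : j = 1 := by omega
    rw [cosocle_one h₁]
    refine ⟨by dsimp only; omega, by dsimp only; omega, ?_⟩
    dsimp only
    have : p ^ 2 = p * (p - 2 - σ.a₁) + p * 2 + p * σ.a₁ := by
      rw [pow_two, ← mul_add, ← mul_add]
      congr 1
      omega
    omega

theorem cosocle_not_congr (hodd : p % 2 = 1) (h₀ : σ.a₀ + 2 ≤ p) (h₁ : σ.a₁ + 2 ≤ p) (j : Fin 2) :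
    ¬ (σ.cosocle p j).Congr p σ := by
  rintro ⟨-, h, -⟩
  by_cases hj : j = 0
  · subst hj
    rw [cosocle_zero h₀] at h
    dsimp only at h
    omega
  · obtain rfl : j = 1 := by omega
    rw [cosocle_one h₁] at h
    dsimp only at h
    omega

/-- The digits agree only if `p = 2 * a₀ + 3 = 2 * a₁ + 3`, and in that case the twists differ by
`(p ^ 2 - 1) / 2`. -/
theorem cosocle_congr (h₀ : σ.a₀ + 2 ≤ p) (h₁ : σ.a₁ + 2 ≤ p)
    {i j : Fin 2} (h : (σ.cosocle p i).Congr p (σ.cosocle p j)) : i = j := by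
  have key : ¬ (σ.cosocle p 1).Congr p (σ.cosocle p 0) := by
    rw [cosocle_zero h₀, cosocle_one h₁]
    rintro ⟨hm, ha₀, ha₁⟩
    dsimp only at hm ha₀ ha₁
    refine not_dvd_of_two_mul_eq (by omega) ?_ hm
    have e₀ : (p : ℤ) = 2 * σ.a₀ + 3 := by omega
    have e₁ : (p : ℤ) = 2 * σ.a₁ + 3 := by omega
    linear_combination -p * e₁ + e₀
  fin_cases i <;> fin_cases j
  · rfl
  · refine absurd ⟨?_, h.2.1.symm, h.2.2.symm⟩ key
    exact dvd_sub_comm.1 h.1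
  · exact absurd h key
  · rfl

end CharacterDistinct

/-! ### The weights in `𝒟(ρ)` are distinct, and the summand types determine the walk -/

section ModularWeights

variable {p e : ℕ} {τ : Weight}

/-- The genericity bounds on `(r₀, r₁)`. -/
structure Weight.IsGeneric (p e : ℕ) (τ : Weight) : Prop where
  le_r₀ : 2 * e ≤ τ.a₀ + 1
  r₀_le : τ.a₀ + 2 ≤ p
  le_r₁ : 2 * e ≤ τ.a₁ + 2
  r₁_le : τ.a₁ + 3 ≤ p

/-- Explicit form of the weights, in terms of `x₀ = r₀ - 2 δ₀` and `x₁ = r₁ - 2 δ₁`. -/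
theorem exists_modularWeight_eq (hτ : τ.IsGeneric p e) (δ : Fin e × Fin e) :
    ∃ x₀ x₁ : ℕ, x₀ + 2 * (δ.1 : ℕ) = τ.a₀ ∧ x₁ + 2 * (δ.2 : ℕ) = τ.a₁ ∧ 1 ≤ x₀ ∧
      modularWeight p τ (δ, ∅) = ⟨τ.m + (δ.1 + p * δ.2), x₀, x₁⟩ ∧
      modularWeight p τ (δ, {0}) = ⟨τ.m + (δ.1 + p * (x₁ + δ.2 + 1)), x₀ - 1, p - 2 - x₁⟩ ∧
      modularWeight p τ (δ, {1}) =
        ⟨τ.m + (x₀ + δ.1 + 1 + p * δ.2 - p), p - 2 - x₀, x₁ + 1⟩ ∧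
      modularWeight p τ (δ, {0, 1}) =
        ⟨τ.m + (x₀ + δ.1 + p * (x₁ + δ.2 + 1)), p - 1 - x₀, p - 3 - x₁⟩ := by
  obtain ⟨h1, h2, h3, h4⟩ := hτ
  have hδ₁ := δ.1.2
  have hδ₂ := δ.2.2
  obtain ⟨x₀, hx₀⟩ := Nat.exists_eq_add_of_le (show 2 * (δ.1 : ℕ) + 1 ≤ τ.a₀ by omega)
  obtain ⟨x₁, hx₁⟩ := Nat.exists_eq_add_of_le (show 2 * (δ.2 : ℕ) ≤ τ.a₁ by omega)
  obtain ⟨u₀, hu₀⟩ := Nat.exists_eq_add_of_le (show x₀ + 3 ≤ p by omega)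
  obtain ⟨u₁, hu₁⟩ := Nat.exists_eq_add_of_le (show x₁ + 3 ≤ p by omega)
  have hz₀ : (τ.a₀ : ℤ) = 2 * (δ.1 : ℕ) + 1 + x₀ := by exact_mod_cast hx₀
  have hz₁ : (τ.a₁ : ℤ) = 2 * (δ.2 : ℕ) + x₁ := by exact_mod_cast hx₁
  have hp₀ : (p : ℤ) = x₀ + 3 + u₀ := by exact_mod_cast hu₀
  have hp₁ : (p : ℤ) = x₁ + 3 + u₁ := by exact_mod_cast hu₁
  have half : ∀ {a b : ℤ}, a = 2 * b → τ.m + a / 2 = τ.m + b := by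
    rintro a b rfl
    rw [Int.mul_ediv_cancel_left _ two_ne_zero]
  refine ⟨x₀ + 1, x₁, by omega, by omega, by omega, ?_, ?_, ?_, ?_⟩
  · simp only [modularWeight, if_true, Weight.plus]
    rw [show τ.a₀ - 2 * (δ.1 : ℕ) = x₀ + 1 by omega, show τ.a₁ - 2 * (δ.2 : ℕ) = x₁ by omega]
    refine Weight.ext (half ?_) rfl rfl
    push_cast
    linear_combination hz₀ + p * hz₁
  · simp only [modularWeight, if_true, Finset.singleton_ne_empty, if_false, Weight.minus]
    rw [show τ.a₀ - 2 * (δ.1 : ℕ) - 1 = x₀ by omega,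
      show p + 2 * (δ.2 : ℕ) - τ.a₁ - 2 = u₁ + 1 by omega]
    refine Weight.ext (half ?_) (by dsimp only; omega) (by dsimp only; omega)
    push_cast
    linear_combination hz₀ + p * hz₁ + p * hp₁
  · simp only [modularWeight, if_true, Finset.singleton_ne_empty, if_false, Weight.plus,
      show ({1} : Finset (Fin 2)) ≠ {0} by decide]
    rw [show p + 2 * (δ.1 : ℕ) - τ.a₀ - 2 = u₀ by omega,
      show τ.a₁ - 2 * (δ.2 : ℕ) + 1 = x₁ + 1 by omega]
    refine Weight.ext (half ?_) (by dsimp only; omega) (by dsimp only)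
    push_cast
    linear_combination hz₀ + p * hz₁ + hp₀
  · simp only [modularWeight, if_false, Weight.minus,
      show ({0, 1} : Finset (Fin 2)) ≠ ∅ by decide, show ({0, 1} : Finset (Fin 2)) ≠ {0} by decide,
      show ({0, 1} : Finset (Fin 2)) ≠ {1} by decide]
    rw [show p + 2 * (δ.1 : ℕ) - τ.a₀ - 1 = u₀ + 1 by omega,
      show p + 2 * (δ.2 : ℕ) - τ.a₁ - 3 = u₁ by omega]
    refine Weight.ext (half ?_) (by dsimp only; omega) (by dsimp only; omega)
    push_cast
    linear_combination hz₀ + p * hz₁ + hp₀ + p * hp₁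

theorem finset_fin_two_cases (J : Finset (Fin 2)) : J = ∅ ∨ J = {0} ∨ J = {1} ∨ J = {0, 1} := by
  revert J
  decide

theorem modularWeight_le (hτ : τ.IsGeneric p e) (i : WeightIndex e) :
    (modularWeight p τ i).a₀ + 2 ≤ p ∧ (modularWeight p τ i).a₁ + 2 ≤ p := by
  obtain ⟨δ, J⟩ := i
  obtain ⟨x₀, x₁, h₀, h₁, hx, e₁, e₂, e₃, e₄⟩ := exists_modularWeight_eq hτ δ
  obtain ⟨g1, g2, g3, g4⟩ := hτ
  have hδ₁ := δ.1.2
  have hδ₂ := δ.2.2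
  rcases finset_fin_two_cases J with rfl | rfl | rfl | rfl
  · rw [e₁]; dsimp only; omega
  · rw [e₂]; dsimp only; omega
  · rw [e₃]; dsimp only; omega
  · rw [e₄]; dsimp only; omega

/-- The parity of the first digit separates `|J|` even from `|J|` odd, because `p` is odd. Within
each class, weights for different `J` with equal digits have twists differing by `(p ^ 2 - 1) / 2`,
and for equal `J` the digits determine `δ`. -/
theorem modularWeight_congr (hodd : p % 2 = 1) (hτ : τ.IsGeneric p e) {i i' : WeightIndex e}
    (h : (modularWeight p τ i).Congr p (modularWeight p τ i')) : i = i' := by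
  obtain ⟨δ, J⟩ := i
  obtain ⟨δ', J'⟩ := i'
  obtain ⟨x₀, x₁, h₀, h₁, hx, e₁, e₂, e₃, e₄⟩ := exists_modularWeight_eq hτ δ
  obtain ⟨y₀, y₁, k₀, k₁, hy, f₁, f₂, f₃, f₄⟩ := exists_modularWeight_eq hτ δ'
  obtain ⟨g1, g2, g3, g4⟩ := hτ
  have hδ : x₀ = y₀ → x₁ = y₁ → δ = δ' := by
    rintro rfl rfl
    exact Prod.ext (Fin.ext (by omega)) (Fin.ext (by omega))
  have hz₀ : (x₀ : ℤ) + 2 * (δ.1 : ℕ) = τ.a₀ := by exact_mod_cast h₀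
  have hz₁ : (x₁ : ℤ) + 2 * (δ.2 : ℕ) = τ.a₁ := by exact_mod_cast h₁
  have hw₀ : (y₀ : ℤ) + 2 * (δ'.1 : ℕ) = τ.a₀ := by exact_mod_cast k₀
  have hw₁ : (y₁ : ℤ) + 2 * (δ'.2 : ℕ) = τ.a₁ := by exact_mod_cast k₁
  have hu₀ : x₀ + 2 ≤ p := by omega
  have hu₁ : x₁ + 3 ≤ p := by omega
  have hv₀ : y₀ + 2 ≤ p := by omega
  have hv₁ : y₁ + 3 ≤ p := by omega
  rcases finset_fin_two_cases J with rfl | rfl | rfl | rfl <;>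
  rcases finset_fin_two_cases J' with rfl | rfl | rfl | rfl
  all_goals first | rw [e₁] at h | rw [e₂] at h | rw [e₃] at h | rw [e₄] at h
  all_goals first | rw [f₁] at h | rw [f₂] at h | rw [f₃] at h | rw [f₄] at h
  all_goals obtain ⟨hm, ha₀, ha₁⟩ := h
  all_goals dsimp only at hm ha₀ ha₁
  all_goals clear e₁ e₂ e₃ e₄ f₁ f₂ f₃ f₄
  · rw [hδ ha₀ ha₁]
  · omega
  · omega
  · exfalso
    refine not_dvd_of_two_mul_eq (by omega) ?_ (dvd_sub_comm.1 hm)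
    have q₀ : (x₀ : ℤ) + y₀ + 1 = p := by omega
    have q₁ : (x₁ : ℤ) + y₁ + 3 = p := by omega
    linear_combination hw₀ - hz₀ + p * (hw₁ - hz₁) + q₀ + p * q₁
  · omega
  · rw [hδ (by omega) (by omega)]
  · exfalso
    refine not_dvd_of_two_mul_eq (by omega) ?_ hm
    have q₀ : (x₀ : ℤ) + y₀ + 1 = p := by omega
    have q₁ : (x₁ : ℤ) + y₁ + 3 = p := by omega
    linear_combination hz₀ - hw₀ + p * (hz₁ - hw₁) - q₀ + p * q₁
  · omega
  · omega
  · exfalso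
    refine not_dvd_of_two_mul_eq (by omega) ?_ (dvd_sub_comm.1 hm)
    have q₀ : (x₀ : ℤ) + y₀ + 1 = p := by omega
    have q₁ : (x₁ : ℤ) + y₁ + 3 = p := by omega
    linear_combination hw₀ - hz₀ + p * (hw₁ - hz₁) - q₀ + p * q₁
  · rw [hδ (by omega) (by omega)]
  · omega
  · exfalso
    refine not_dvd_of_two_mul_eq (by omega) ?_ hm
    have q₀ : (x₀ : ℤ) + y₀ + 1 = p := by omega
    have q₁ : (x₁ : ℤ) + y₁ + 3 = p := by omega
    linear_combination hz₀ - hw₀ + p * (hz₁ - hw₁) + q₀ + p * q₁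
  · omega
  · omega
  · rw [hδ (by omega) (by omega)]

/-- Each lattice edge is seen from its lower or left endpoint: `J = {0}` detects the edges
increasing the second coordinate and `J = {0, 1}` those increasing the first. -/
theorem HamiltonianWalk.ext_of_summandType {γ γ' : HamiltonianWalk e}
    (h : ∀ i, summandType γ i = summandType γ' i) : γ = γ' := by
  have hvert : ∀ δ : Fin e × Fin e, γ.Adjacent δ (((δ.1 : ℕ) : ℤ), ((δ.2 : ℕ) : ℤ) + 1) ↔
      γ'.Adjacent δ (((δ.1 : ℕ) : ℤ), ((δ.2 : ℕ) : ℤ) + 1) := by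
    intro δ
    have := h (δ, {0})
    simp only [summandType, if_true] at this
    split_ifs at this with h1 h2 h2 <;> simp_all
  have hhor : ∀ δ : Fin e × Fin e, γ.Adjacent δ (((δ.1 : ℕ) : ℤ) + 1, ((δ.2 : ℕ) : ℤ)) ↔
      γ'.Adjacent δ (((δ.1 : ℕ) : ℤ) + 1, ((δ.2 : ℕ) : ℤ)) := by
    intro δ
    have := h (δ, {0, 1})
    simp only [summandType, if_true, show ({0, 1} : Finset (Fin 2)) ≠ {0} by decide,
      show ({0, 1} : Finset (Fin 2)) ≠ {1} by decide, if_false] at this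
    split_ifs at this with h1 h2 h2 <;> simp_all
  have hadj : ∀ (γ : HamiltonianWalk e) (δ δ' : Fin e × Fin e) (x : ℤ × ℤ),
      ((δ'.1 : ℕ) : ℤ) = x.1 → ((δ'.2 : ℕ) : ℤ) = x.2 → (γ.Adjacent δ x ↔ s(δ, δ') ∈ γ.1) := by
    intro γ δ δ' x h1 h2
    constructor
    · rintro ⟨δ'', h1', h2', hmem⟩
      have : δ'' = δ' := Prod.ext (Fin.ext (by omega)) (Fin.ext (by omega))
      rwa [this] at hmem
    · intro hmem
      exact ⟨δ', h1, h2, hmem⟩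
  have hlat : ∀ (γ : HamiltonianWalk e) (δ δ' : Fin e × Fin e), s(δ, δ') ∈ γ.1 →
      (lattice e).Adj δ δ' := by
    intro γ δ δ' hmem
    obtain ⟨u, v, w, -, hS⟩ := γ.2
    rw [hS] at hmem
    exact w.adj_of_mem_edges hmem
  have key : ∀ δ δ' : Fin e × Fin e, (lattice e).Adj δ δ' → (s(δ, δ') ∈ γ.1 ↔ s(δ, δ') ∈ γ'.1) := by
    intro δ δ' hδ
    rw [lattice, SimpleGraph.boxProd_adj, SimpleGraph.pathGraph_adj, SimpleGraph.pathGraph_adj] at hδ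
    rcases hδ with ⟨h1 | h1, h2⟩ | ⟨h1 | h1, h2⟩
    · have e1 : ((δ'.1 : ℕ) : ℤ) = ((δ.1 : ℕ) : ℤ) + 1 := by omega
      have e2 : ((δ'.2 : ℕ) : ℤ) = ((δ.2 : ℕ) : ℤ) := by rw [h2]
      rw [← hadj γ δ δ' (_, _) e1 e2, ← hadj γ' δ δ' (_, _) e1 e2, hhor]
    · have e1 : ((δ.1 : ℕ) : ℤ) = ((δ'.1 : ℕ) : ℤ) + 1 := by omega
      have e2 : ((δ.2 : ℕ) : ℤ) = ((δ'.2 : ℕ) : ℤ) := by rw [h2]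
      rw [Sym2.eq_swap, ← hadj γ δ' δ (_, _) e1 e2, ← hadj γ' δ' δ (_, _) e1 e2, hhor]
    · have e1 : ((δ'.2 : ℕ) : ℤ) = ((δ.2 : ℕ) : ℤ) + 1 := by omega
      have e2 : ((δ'.1 : ℕ) : ℤ) = ((δ.1 : ℕ) : ℤ) := by rw [h2]
      rw [← hadj γ δ δ' (_, _) e2 e1, ← hadj γ' δ δ' (_, _) e2 e1, hvert]
    · have e1 : ((δ.2 : ℕ) : ℤ) = ((δ'.2 : ℕ) : ℤ) + 1 := by omega
      have e2 : ((δ.1 : ℕ) : ℤ) = ((δ'.1 : ℕ) : ℤ) := by rw [h2]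
      rw [Sym2.eq_swap, ← hadj γ δ' δ (_, _) e2 e1, ← hadj γ' δ' δ (_, _) e2 e1, hvert]
  apply Subtype.ext
  ext x
  induction x using Sym2.ind with
  | _ δ δ' =>
    exact ⟨fun hx => (key δ δ' (hlat γ δ δ' hx)).1 hx, fun hx => (key δ δ' (hlat γ' δ δ' hx)).2 hx⟩

end ModularWeights

/-! ### Subgroups of `GL₂(F)` -/

section Integers

variable {F : Type*} [Field F] [ValuativeRel F]

theorem residue_eq_zero_iff {x : 𝒪[F]} :
    IsLocalRing.residue 𝒪[F] x = 0 ↔ ValuativeRel.valuation F x < 1 := by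
  rw [IsLocalRing.residue_eq_zero_iff, IsLocalRing.mem_maximalIdeal, mem_nonunits_iff,
    Valuation.Integers.isUnit_iff_valuation_eq_one (Valuation.integer.integers _)]
  exact (lt_iff_le_and_ne.trans (and_iff_right x.2)).symm

theorem red_upp (x : 𝒪[F]) : red F (upp x) = upp (IsLocalRing.residue 𝒪[F] x) := by
  apply Units.ext
  ext i j
  fin_cases i <;> fin_cases j <;> simp [red, coe_upp]

theorem red_dia (a d : (𝒪[F])ˣ) : red F (dia a d) =
    dia (Units.map (IsLocalRing.residue 𝒪[F]).toMonoidHom a)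
      (Units.map (IsLocalRing.residue 𝒪[F]).toMonoidHom d) := by
  apply Units.ext
  ext i j
  fin_cases i <;> fin_cases j <;> simp [red, coe_dia]

theorem red_wey : red F wey = wey := by
  apply Units.ext
  ext i j
  fin_cases i <;> fin_cases j <;> simp [red, coe_wey]

theorem red_surjective : Function.Surjective (red F) := by
  intro g
  induction g using gl_induction with
  | hmul g h hg hh =>
    obtain ⟨g, rfl⟩ := hg
    obtain ⟨h, rfl⟩ := hh
    exact ⟨g * h, map_mul _ _ _⟩
  | hu t =>
    obtain ⟨t, rfl⟩ := IsLocalRing.residue_surjective t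
    exact ⟨_, red_upp t⟩
  | hd a d =>
    obtain ⟨a, rfl⟩ := IsLocalRing.surjective_units_map_of_local_ringHom
      (IsLocalRing.residue 𝒪[F]) IsLocalRing.residue_surjective inferInstance a
    obtain ⟨d, rfl⟩ := IsLocalRing.surjective_units_map_of_local_ringHom
      (IsLocalRing.residue 𝒪[F]) IsLocalRing.residue_surjective inferInstance d
    exact ⟨_, red_dia a d⟩
  | hw => exact ⟨_, red_wey⟩

theorem mem_unipotent_iff {k : Type*} [Field k] {g : GL (Fin 2) k} :
    g ∈ unipotent k ↔ ∃ t, g = upp t := by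
  constructor
  · rintro ⟨h1, h2, h3⟩
    refine ⟨g 0 1, Units.ext ?_⟩
    ext i j
    fin_cases i <;> fin_cases j <;> simp [coe_upp, h1, h2, h3]
  · rintro ⟨t, rfl⟩
    exact ⟨by simp [coe_upp], by simp [coe_upp], by simp [coe_upp]⟩

theorem exists_incl_eq {g : GL (Fin 2) F} (hg : ∀ i j, ValuativeRel.valuation F (g i j) ≤ 1)
    (hdet : ValuativeRel.valuation F (g : Matrix (Fin 2) (Fin 2) F).det = 1) :
    ∃ h : GL (Fin 2) 𝒪[F], incl F h = g := by
  let A : Matrix (Fin 2) (Fin 2) 𝒪[F] := fun i j => ⟨g i j, hg i j⟩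
  have hA : IsUnit A.det := by
    rw [Valuation.Integers.isUnit_iff_valuation_eq_one (Valuation.integer.integers _), ← hdet]
    congr 1
  exact ⟨Matrix.GeneralLinearGroup.mk'' A hA, Units.ext rfl⟩

theorem mem_Iw_of_valuation {g : GL (Fin 2) F} (hg : ∀ i j, ValuativeRel.valuation F (g i j) ≤ 1)
    (hdet : ValuativeRel.valuation F (g : Matrix (Fin 2) (Fin 2) F).det = 1)
    (h10 : ValuativeRel.valuation F (g 1 0) < 1) : g ∈ Iw F := by
  obtain ⟨h, rfl⟩ := exists_incl_eq hg hdet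
  exact ⟨h, residue_eq_zero_iff.2 h10, rfl⟩

theorem mem_Iw1_iff {g : GL (Fin 2) F} : g ∈ Iw1 F ↔
    ValuativeRel.valuation F (g 0 0 - 1) < 1 ∧ ValuativeRel.valuation F (g 1 1 - 1) < 1 ∧
    ValuativeRel.valuation F (g 1 0) < 1 ∧ ValuativeRel.valuation F (g 0 1) ≤ 1 := by
  constructor
  · rintro ⟨h, ⟨h1, h2, h3⟩, rfl⟩
    refine ⟨?_, ?_, residue_eq_zero_iff.1 h1, (h 0 1).2⟩
    · refine residue_eq_zero_iff (x := h 0 0 - 1) |>.1 ?_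
      rw [map_sub, map_one, sub_eq_zero]
      exact h2
    · refine residue_eq_zero_iff (x := h 1 1 - 1) |>.1 ?_
      rw [map_sub, map_one, sub_eq_zero]
      exact h3
  · rintro ⟨h1, h2, h3, h4⟩
    have hone : ∀ x : F, ValuativeRel.valuation F (x - 1) < 1 → ValuativeRel.valuation F x = 1 := by
      intro x hx
      have := Valuation.map_add_eq_of_lt_right (ValuativeRel.valuation F) (x := x - 1) (y := 1)
        (by simpa using hx)
      simpa using this
    obtain ⟨h, rfl⟩ : ∃ h : GL (Fin 2) 𝒪[F], incl F h = g := by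
      refine exists_incl_eq (fun i j => ?_) ?_
      · fin_cases i <;> fin_cases j
        · exact (hone _ h1).le
        · exact h4
        · exact h3.le
        · exact (hone _ h2).le
      · rw [Matrix.det_fin_two, Valuation.map_sub_eq_of_lt_left]
        · rw [map_mul, hone _ h1, hone _ h2, one_mul]
        · rw [map_mul, map_mul, hone _ h1, hone _ h2, one_mul]
          exact mul_lt_one_of_nonneg_of_lt_one_right h4 zero_le h3
    refine ⟨h, ⟨residue_eq_zero_iff.2 h3, ?_, ?_⟩, rfl⟩
    · have := (residue_eq_zero_iff (x := h 0 0 - 1)).2 h1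
      rw [map_sub, map_one, sub_eq_zero] at this
      exact this
    · have := (residue_eq_zero_iff (x := h 1 1 - 1)).2 h2
      rw [map_sub, map_one, sub_eq_zero] at this
      exact this

variable [TopologicalSpace F] [IsNonarchimedeanLocalField F] {ϖ : 𝒪[F]}

theorem valuation_le_of_lt_one (hϖ : Irreducible ϖ) {x : F} (hx : ValuativeRel.valuation F x < 1) :
    ValuativeRel.valuation F x ≤ ValuativeRel.valuation F ϖ := by
  have h : (⟨x, hx.le⟩ : 𝒪[F]) ∈ 𝓂[F] := by
    rw [← IsLocalRing.residue_eq_zero_iff]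
    exact residue_eq_zero_iff.2 hx
  rw [hϖ.maximalIdeal_eq, Ideal.mem_span_singleton] at h
  obtain ⟨y, hy⟩ := h
  have hxy : x = ϖ * y := congrArg Subtype.val hy
  rw [hxy, map_mul]
  exact mul_le_of_le_one_right' y.2

theorem exists_valuation_eq_zpow (hϖ : Irreducible ϖ) {x : F} (hx : x ≠ 0) :
    ∃ n : ℤ, ValuativeRel.valuation F x = ValuativeRel.valuation F ϖ ^ n := by
  have key : ∀ x : F, x ≠ 0 → ValuativeRel.valuation F x ≤ 1 →
      ∃ n : ℤ, ValuativeRel.valuation F x = ValuativeRel.valuation F ϖ ^ n := by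
    intro x hx h
    obtain ⟨n, u, hu⟩ := IsDiscreteValuationRing.associated_pow_irreducible
      (x := (⟨x, h⟩ : 𝒪[F])) (fun h0 => hx (congrArg Subtype.val h0)) hϖ
    refine ⟨n, ?_⟩
    have h1 : x * (u : 𝒪[F]) = (ϖ : F) ^ n := congrArg Subtype.val hu
    have h2 : ValuativeRel.valuation F (u : 𝒪[F]) = 1 :=
      (Valuation.Integers.isUnit_iff_valuation_eq_one (Valuation.integer.integers _)).1 u.isUnit
    rw [zpow_natCast, ← map_pow, ← h1, map_mul, h2, mul_one]
  rcases le_total (ValuativeRel.valuation F x) 1 with h | h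
  · exact key x hx h
  · obtain ⟨n, hn⟩ := key x⁻¹ (inv_ne_zero hx) (by rw [map_inv₀]; exact inv_le_one_of_one_le₀ h)
    refine ⟨-n, ?_⟩
    rw [zpow_neg, ← hn, map_inv₀, inv_inv]

/-- The matrix `(0, 1; x, 0)`. -/
def antidiag (x : Fˣ) : GL (Fin 2) F :=
  ⟨!![0, 1; (x : F), 0], !![0, ((x⁻¹ : Fˣ) : F); 1, 0], by simp [Matrix.one_fin_two],
    by simp [Matrix.one_fin_two]⟩

omit [ValuativeRel F] [TopologicalSpace F] [IsNonarchimedeanLocalField F] in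
theorem coe_antidiag (x : Fˣ) :
    (antidiag x : Matrix (Fin 2) (Fin 2) F) = !![0, 1; (x : F), 0] := rfl

omit [ValuativeRel F] [TopologicalSpace F] [IsNonarchimedeanLocalField F] in
theorem coe_antidiag_inv (x : Fˣ) :
    ((antidiag x)⁻¹ : GL (Fin 2) F).1 = !![0, (x : F)⁻¹; 1, 0] := by
  rw [← Units.val_inv_eq_inv_val]
  rfl

omit [ValuativeRel F] [TopologicalSpace F] [IsNonarchimedeanLocalField F] in
theorem dia_self_mem_center (x : Fˣ) : dia x x ∈ Subgroup.center (GL (Fin 2) F) := by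
  rw [Subgroup.mem_center_iff]
  intro g
  apply Units.ext
  ext i j
  fin_cases i <;> fin_cases j <;> simp [coe_dia, Matrix.mul_apply, Fin.sum_univ_two, mul_comm]

omit [ValuativeRel F] [TopologicalSpace F] [IsNonarchimedeanLocalField F] in
theorem antidiag_mul_self (x : Fˣ) : antidiag x * antidiag x = dia x x := by
  apply Units.ext
  simp [coe_antidiag, coe_dia]

/-- A uniformizer as a unit of the field. -/
def unif (hϖ : Irreducible ϖ) : Fˣ := Units.mk0 ϖ fun h => hϖ.ne_zero (Subtype.ext h)

omit [TopologicalSpace F] [IsNonarchimedeanLocalField F] in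
theorem valuation_unif_lt_one (hϖ : Irreducible ϖ) : ValuativeRel.valuation F (unif hϖ : F) < 1 :=
  (Valuation.integer.integers _).valuation_irreducible_lt_one hϖ

theorem antidiag_conj_mem (hϖ : Irreducible ϖ) {g : GL (Fin 2) F} (hg : g ∈ Iw1 F) :
    antidiag (unif hϖ) * g * (antidiag (unif hϖ))⁻¹ ∈ Iw1 F := by
  rw [mem_Iw1_iff] at hg ⊢
  obtain ⟨h1, h2, h3, h4⟩ := hg
  have h0 : (unif hϖ : F) ≠ 0 := Units.ne_zero _
  have e : (antidiag (unif hϖ) * g * (antidiag (unif hϖ))⁻¹ : GL (Fin 2) F).1 =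
      !![g 1 1, g 1 0 * (unif hϖ : F)⁻¹; unif hϖ * g 0 1, g 0 0] := by
    rw [Units.val_mul, Units.val_mul, coe_antidiag, coe_antidiag_inv]
    ext i j
    fin_cases i <;> fin_cases j <;>
      simp [Matrix.mul_apply, Fin.sum_univ_two, Matrix.vecMul, dotProduct]
    field_simp
  simp only [e]
  refine ⟨h2, h1, ?_, ?_⟩
  · change ValuativeRel.valuation F (unif hϖ * g 0 1) < 1
    rw [map_mul, mul_comm]
    exact mul_lt_one_of_nonneg_of_lt_one_right h4 zero_le (valuation_unif_lt_one hϖ)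
  · change ValuativeRel.valuation F (g 1 0 * (unif hϖ : F)⁻¹) ≤ 1
    rw [map_mul, map_inv₀]
    exact mul_inv_le_one_of_le₀ (valuation_le_of_lt_one hϖ h3) zero_le

theorem antidiag_mem_Nm (hϖ : Irreducible ϖ) : antidiag (unif hϖ) ∈ Nm F := by
  rw [Nm, Subgroup.mem_normalizer_iff]
  refine fun g => ⟨antidiag_conj_mem hϖ, fun h => ?_⟩
  have h1 := antidiag_conj_mem hϖ h
  have h2 := Subgroup.mem_center_iff.1 (dia_self_mem_center (unif hϖ)) g
  rw [← antidiag_mul_self] at h2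
  have h3 : antidiag (unif hϖ) * (antidiag (unif hϖ) * g * (antidiag (unif hϖ))⁻¹) *
      (antidiag (unif hϖ))⁻¹ = (antidiag (unif hϖ) * antidiag (unif hϖ)) * g *
      (antidiag (unif hϖ) * antidiag (unif hϖ))⁻¹ := by group
  rw [h3, ← h2, mul_inv_cancel_right] at h1
  exact h1

/-- This uses discreteness: if `|x| > 1`, then `|x|⁻¹ ≤ |ϖ|`, so `|ϖ| |x| ^ 2 ≥ |x| > 1`. -/
theorem valuation_le_one_of_mul_sq_le (hϖ : Irreducible ϖ) {x : F}
    (h : ValuativeRel.valuation F ϖ * ValuativeRel.valuation F x ^ 2 ≤ 1) :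
    ValuativeRel.valuation F x ≤ 1 := by
  by_contra! hx
  have hx0 : ValuativeRel.valuation F x ≠ 0 := (zero_lt_one.trans hx).ne'
  have h1 : ValuativeRel.valuation F x⁻¹ ≤ ValuativeRel.valuation F ϖ :=
    valuation_le_of_lt_one hϖ (by rw [map_inv₀]; exact inv_lt_one_of_one_lt₀ hx)
  rw [map_inv₀] at h1
  have h2 := mul_le_mul_left h1 (ValuativeRel.valuation F x ^ 2)
  rw [pow_two, inv_mul_cancel_left₀ hx0, ← pow_two] at h2
  exact absurd (h2.trans h) (not_le.2 hx)

-- Conjugating a single element of `I(1)` exposes the squares of the entries in the first column of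
-- `n`, so that normalizing `I(1)` bounds that column in terms of the determinant.
omit [ValuativeRel F] [TopologicalSpace F] [IsNonarchimedeanLocalField F] in
theorem conj_upp_apply (n : GL (Fin 2) F) :
    (n * upp 1 * n⁻¹ : GL (Fin 2) F) 0 1 = n 0 0 ^ 2 / (n : Matrix (Fin 2) (Fin 2) F).det ∧
    (n * upp 1 * n⁻¹ : GL (Fin 2) F) 1 0 = -(n 1 0 ^ 2 / (n : Matrix (Fin 2) (Fin 2) F).det) := by
  rw [Units.val_mul, Units.val_mul, Matrix.coe_units_inv, Matrix.inv_def, Matrix.adjugate_fin_two,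
    coe_upp, Ring.inverse_eq_inv']
  constructor
  · simp [Matrix.mul_apply, Fin.sum_univ_two]
    ring
  · simp [Matrix.mul_apply, Fin.sum_univ_two]
    ring

omit [TopologicalSpace F] [IsNonarchimedeanLocalField F] in
theorem upp_one_mem_Iw1 : upp (1 : F) ∈ Iw1 F := by
  rw [mem_Iw1_iff]
  simp [coe_upp]

omit [TopologicalSpace F] [IsNonarchimedeanLocalField F] in
theorem valuation_sq_of_mem_Nm {n : GL (Fin 2) F} (hn : n ∈ Nm F) :
    ValuativeRel.valuation F (n 0 0) ^ 2 ≤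
      ValuativeRel.valuation F (n : Matrix (Fin 2) (Fin 2) F).det ∧
    ValuativeRel.valuation F (n 1 0) ^ 2 <
      ValuativeRel.valuation F (n : Matrix (Fin 2) (Fin 2) F).det := by
  have hdet : (n : Matrix (Fin 2) (Fin 2) F).det ≠ 0 :=
    ((Matrix.isUnit_iff_isUnit_det _).1 n.isUnit).ne_zero
  have hpos : 0 < ValuativeRel.valuation F (n : Matrix (Fin 2) (Fin 2) F).det := by
    rw [zero_lt_iff]
    exact (map_ne_zero _).2 hdet
  have h := mem_Iw1_iff.1 ((Subgroup.mem_normalizer_iff.1 hn _).1 upp_one_mem_Iw1)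
  obtain ⟨-, -, h10, h01⟩ := h
  rw [(conj_upp_apply n).2, Valuation.map_neg, map_div₀, map_pow, div_lt_one₀ hpos] at h10
  rw [(conj_upp_apply n).1, map_div₀, map_pow, div_le_one₀ hpos] at h01
  exact ⟨h01, h10⟩

theorem mem_Iw_of_mem_Nm (hϖ : Irreducible ϖ) {n : GL (Fin 2) F} (hn : n ∈ Nm F)
    (hdet : ValuativeRel.valuation F (n : Matrix (Fin 2) (Fin 2) F).det = 1) : n ∈ Iw F := by
  have h1 := valuation_sq_of_mem_Nm hn
  -- Right multiplication by the antidiagonal matrix moves the second column, scaled by `ϖ`, into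
  -- the first, so the same estimate bounds the remaining entries.
  have h2 := valuation_sq_of_mem_Nm ((Nm F).mul_mem hn (antidiag_mem_Nm hϖ))
  have hpos : 0 < ValuativeRel.valuation F ϖ := by
    rw [zero_lt_iff]
    exact (map_ne_zero _).2 (Units.ne_zero (unif hϖ))
  have e0 : (n * antidiag (unif hϖ) : GL (Fin 2) F) 0 0 = n 0 1 * ϖ := by
    simp [coe_antidiag, Matrix.mul_apply, Fin.sum_univ_two, unif]
  have e1 : (n * antidiag (unif hϖ) : GL (Fin 2) F) 1 0 = n 1 1 * ϖ := by
    simp [coe_antidiag, Matrix.mul_apply, Fin.sum_univ_two, unif]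
  have e2 : ValuativeRel.valuation F
      ((n * antidiag (unif hϖ) : GL (Fin 2) F) : Matrix (Fin 2) (Fin 2) F).det =
      ValuativeRel.valuation F ϖ := by
    rw [Units.val_mul, Matrix.det_mul, map_mul, hdet, one_mul, coe_antidiag]
    simp [Matrix.det_fin_two, unif]
  have key : ∀ x : F, ValuativeRel.valuation F (x * ϖ) ^ 2 ≤ ValuativeRel.valuation F ϖ →
      ValuativeRel.valuation F x ≤ 1 := by
    intro x hx
    refine valuation_le_one_of_mul_sq_le hϖ ?_
    rw [map_mul, mul_pow, pow_two (ValuativeRel.valuation F (ϖ : F)), ← mul_assoc] at hx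
    rw [mul_comm]
    exact (mul_le_iff_le_one_left hpos).1 hx
  rw [e0, e1, e2] at h2
  rw [hdet] at h1
  have h10 : ValuativeRel.valuation F (n 1 0) < 1 := by
    by_contra! h
    exact absurd h1.2 (not_lt.2 (one_le_pow₀ h))
  refine mem_Iw_of_valuation (fun i j => ?_) hdet h10
  fin_cases i <;> fin_cases j
  · change ValuativeRel.valuation F (n 0 0) ≤ 1
    by_contra! h
    exact absurd h1.1 (not_le.2 (one_lt_pow₀ h two_ne_zero))
  · exact key _ h2.1
  · exact h10.le
  · exact key _ h2.2.le

theorem mem_IZ_of_even (hϖ : Irreducible ϖ) {n : GL (Fin 2) F} (hn : n ∈ Nm F) {t : ℤ}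
    (hdet : ValuativeRel.valuation F (n : Matrix (Fin 2) (Fin 2) F).det =
      ValuativeRel.valuation F ϖ ^ (2 * t)) : n ∈ IZ F := by
  have hz := dia_self_mem_center (unif hϖ ^ t)
  have hzN : dia (unif hϖ ^ t) (unif hϖ ^ t) ∈ Nm F := by
    rw [Nm, Subgroup.mem_normalizer_iff]
    intro g
    rw [← Subgroup.mem_center_iff.1 hz g, mul_inv_cancel_right]
  have h1 : (dia (unif hϖ ^ t) (unif hϖ ^ t))⁻¹ * n ∈ Iw F := by
    refine mem_Iw_of_mem_Nm hϖ ((Nm F).mul_mem ((Nm F).inv_mem hzN) hn) ?_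
    have hpos : ValuativeRel.valuation F ϖ ≠ 0 := (map_ne_zero _).2 (Units.ne_zero (unif hϖ))
    have h2 : ValuativeRel.valuation F
        ((dia (unif hϖ ^ t) (unif hϖ ^ t) : GL (Fin 2) F) : Matrix (Fin 2) (Fin 2) F).det =
        ValuativeRel.valuation F ϖ ^ (2 * t) := by
      rw [coe_dia, Matrix.det_fin_two_of, mul_zero, sub_zero, map_mul, Units.val_zpow_eq_zpow_val,
        map_zpow₀, two_mul, zpow_add₀ hpos]
      rfl
    have h3 : dia (unif hϖ ^ t) (unif hϖ ^ t) * ((dia (unif hϖ ^ t) (unif hϖ ^ t))⁻¹ * n) = n :=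
      mul_inv_cancel_left _ _
    have h4 := congrArg (fun g : GL (Fin 2) F =>
      ValuativeRel.valuation F (g : Matrix (Fin 2) (Fin 2) F).det) h3
    rw [Units.val_mul, Matrix.det_mul, map_mul, h2, hdet] at h4
    exact mul_left_cancel₀ (zpow_ne_zero (2 * t) hpos) (h4.trans (mul_one _).symm)
  rw [← mul_inv_cancel_left (dia (unif hϖ ^ t) (unif hϖ ^ t)) n]
  exact (IZ F).mul_mem (Subgroup.mem_sup_right hz) (Subgroup.mem_sup_left h1)

/-- The normalizer of `I(1)` is generated by `IZ` and `(0, 1; ϖ, 0)`. -/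
theorem mem_IZ_or_of_mem_Nm (hϖ : Irreducible ϖ) {n : GL (Fin 2) F} (hn : n ∈ Nm F) :
    n ∈ IZ F ∨ (antidiag (unif hϖ))⁻¹ * n ∈ IZ F := by
  have hdet : (n : Matrix (Fin 2) (Fin 2) F).det ≠ 0 :=
    ((Matrix.isUnit_iff_isUnit_det _).1 n.isUnit).ne_zero
  obtain ⟨k, hk⟩ := exists_valuation_eq_zpow hϖ hdet
  -- The antidiagonal matrix has determinant of valuation that of `ϖ`, so dividing by it makes an
  -- odd exponent even; an even exponent is removed by a scalar matrix.
  rcases Int.even_or_odd' k with ⟨t, rfl | rfl⟩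
  · exact Or.inl (mem_IZ_of_even hϖ hn hk)
  · refine Or.inr (mem_IZ_of_even (t := t) hϖ
      ((Nm F).mul_mem ((Nm F).inv_mem (antidiag_mem_Nm hϖ)) hn) ?_)
    have hpos : ValuativeRel.valuation F ϖ ≠ 0 := (map_ne_zero _).2 (Units.ne_zero (unif hϖ))
    rw [Units.val_mul, Matrix.det_mul, map_mul, hk, coe_antidiag_inv, Matrix.det_fin_two_of,
      zpow_add₀ hpos, zpow_one]
    simp only [zero_mul, mul_one, zero_sub, Valuation.map_neg, map_inv₀]
    rw [mul_comm, mul_assoc]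
    change _ * (_ * (ValuativeRel.valuation F ϖ)⁻¹) = _
    rw [mul_inv_cancel₀ hpos, mul_one]

end Integers

/-! ### Components in an internal direct sum -/

section Internal

variable {E V ι : Type*} [Field E] [AddCommGroup V] [Module E V] [Fintype ι] [DecidableEq ι]
  {A : ι → Submodule E V}

theorem exists_eq_sum_of_isInternal (h : DirectSum.IsInternal A) (x : V) :
    ∃ y : ∀ i, A i, x = ∑ i, (y i : V) := by
  obtain ⟨d, rfl⟩ := h.surjective x
  refine ⟨fun i => d i, ?_⟩
  conv_lhs => rw [← DirectSum.sum_univ_of d]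
  rw [map_sum]
  exact Finset.sum_congr rfl fun i _ => DirectSum.coeAddMonoidHom_of _ _ _

theorem sum_injective_of_isInternal (h : DirectSum.IsInternal A) {y y' : ∀ i, A i}
    (hy : ∑ i, (y i : V) = ∑ i, (y' i : V)) : y = y' := by
  have key : ∀ y : ∀ i, A i, DirectSum.coeAddMonoidHom A (∑ i, DirectSum.of (fun i => A i) i (y i)) =
      ∑ i, (y i : V) := by
    intro y
    rw [map_sum]
    exact Finset.sum_congr rfl fun i _ => DirectSum.coeAddMonoidHom_of _ _ _
  have h1 := h.injective ((key y).trans (hy.trans (key y').symm))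
  funext i
  have h2 := congrArg (fun d : DirectSum ι fun i => A i => d i) h1
  have h3 : ∀ y : ∀ i, A i, (∑ j, DirectSum.of (fun i => A i) j (y j)) i = y i := by
    intro y
    rw [DFinsupp.finsetSum_apply, Finset.sum_eq_single i]
    · exact DirectSum.of_eq_same _ _
    · intro j _ hj
      exact DirectSum.of_eq_of_ne _ _ _ hj.symm
    · simp
  exact (h3 y).symm.trans (h2.trans (h3 y'))

end Internal

/-! ### The `I(1)`-invariants of `D₀` inside `V` -/

section Model

variable {F : Type*} [Field F] [ValuativeRel F] {E : Type*} [Field E] {p : ℕ} [hp : Fact p.Prime]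
  [CharP E p] {ε₀ : 𝓀[F] →+* E} {τ : Weight} {e : ℕ} {γ : HamiltonianWalk e}
  {V : Type*} [AddCommGroup V] [Module E V] {π : Representation E (GL (Fin 2) F) V}
  {D₀ : Type*} [AddCommGroup D₀] [Module E D₀]

/-- A representation of `GL₂(k)` isomorphic to `D₀^γ(ρ)`, embedded in a representation of `GL₂(F)`
as in the basic diagrams. -/
structure IsModel (p : ℕ) [Fact p.Prime] [CharP E p] (ε₀ : 𝓀[F] →+* E) (τ : Weight)
    (γ : HamiltonianWalk e) (π : Representation E (GL (Fin 2) F) V)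
    (R : Representation E (GL (Fin 2) 𝓀[F]) D₀) (X : WeightIndex e → Subrepresentation R)
    (f : D₀ →ₗ[E] V) (v l : ∀ i, (X i).toSubmodule) : Prop where
  internal : DirectSum.IsInternal fun i => (X i).toSubmodule
  gen : ∀ i, IsQGen p ε₀ ((modularWeight p τ i).cosocle p (summandType γ i)) (modularWeight p τ i)
    (X i).toRepresentation (v i) (l i)
  injective : Function.Injective f
  equivariant : ∀ g x, f (R (red F g) x) = π (incl F g) (f x)
  exists_eq_sum : ∀ x ∈ (socle (π.comp (incl F))).toSubmodule, ∃ y : ∀ i, (X i).toSubmodule,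
    (∀ i, y i ∈ (socle (X i).toRepresentation).toSubmodule) ∧ x = ∑ i, f (y i)
  stable : ∀ n ∈ Nm F, ∀ x, (∀ t, R (upp t) x = x) →
    ∃ x', (∀ t, R (upp t) x' = x') ∧ π n (f x) = f x'
  pairing : ∀ x, (∀ t, R (upp t) x = x) → x ≠ 0 →
    ∃ n ∈ Nm F, π n (f x) ∉ (socle (π.comp (incl F))).toSubmodule

theorem map_socle_le_socle {R : Representation E (GL (Fin 2) 𝓀[F]) D₀} (Y : Subrepresentation R)
    {f : D₀ →ₗ[E] V} (hf : Function.Injective f)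
    (hR : ∀ g x, f (R (red F g) x) = π (incl F g) (f x)) {y : Y.toSubmodule}
    (hy : y ∈ (socle Y.toRepresentation).toSubmodule) :
    f y ∈ (socle (π.comp (incl F))).toSubmodule :=
  map_socle_le (red_surjective (F := F)) (f := f ∘ₗ Y.toSubmodule.subtype)
    (hf.comp Y.toSubmodule.injective_subtype) (fun g x => hR g x) ⟨y, hy, rfl⟩

/-- The socles of the summands map injectively into the `K`-socle of `V`. Both sides are abstractly
the sum of the same weights and have the same finite dimension, so the map is onto. -/
theorem exists_eq_sum_of_socle_equiv {R : Representation E (GL (Fin 2) 𝓀[F]) D₀}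
    {X : WeightIndex e → Subrepresentation R} (hX : DirectSum.IsInternal fun i => (X i).toSubmodule)
    (hfin : ∀ i, FiniteDimensional E (X i).toSubmodule)
    (hsoc : ∀ i, Nonempty ((socle (X i).toRepresentation).toRepresentation.Equiv
      (serreWeight p ε₀ (modularWeight p τ i))))
    {f : D₀ →ₗ[E] V} (hf : Function.Injective f)
    (hR : ∀ g x, f (R (red F g) x) = π (incl F g) (f x))
    (hV : Nonempty ((socle (π.comp (incl F))).toRepresentation.Equiv
      (Representation.directSum fun i : WeightIndex e =>
        (serreWeight p ε₀ (modularWeight p τ i)).comp (red F)))) :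
    ∀ x ∈ (socle (π.comp (incl F))).toSubmodule, ∃ y : ∀ i, (X i).toSubmodule,
      (∀ i, y i ∈ (socle (X i).toRepresentation).toSubmodule) ∧ x = ∑ i, f (y i) := by
  obtain ⟨φ⟩ := hV
  let ψ := fun i => (hsoc i).some
  let Φ : (socle (π.comp (incl F))).toSubmodule ≃ₗ[E]
      ∀ i, (socle (X i).toRepresentation).toSubmodule :=
    φ.toLinearEquiv ≪≫ₗ DFinsupp.mapRange.linearEquiv (fun i => (ψ i).toLinearEquiv.symm) ≪≫ₗ
      DirectSum.linearEquivFunOnFintype E _ _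
  let T : (∀ i, (socle (X i).toRepresentation).toSubmodule) →ₗ[E]
      (socle (π.comp (incl F))).toSubmodule :=
    LinearMap.codRestrict _ (∑ i, f ∘ₗ (X i).toSubmodule.subtype ∘ₗ
      (socle (X i).toRepresentation).toSubmodule.subtype ∘ₗ LinearMap.proj i) fun y => by
        simp only [LinearMap.sum_apply]
        exact Submodule.sum_mem _ fun i _ => map_socle_le_socle (X i) hf hR (y i).2
  have hT : ∀ y, (T y : V) = f (∑ i, ((y i : (X i).toSubmodule) : D₀)) := by
    intro y
    simp [T, LinearMap.sum_apply]
  have hTinj : Function.Injective T := by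
    intro y y' h
    have h1 := hf ((hT y).symm.trans ((congrArg Subtype.val h).trans (hT y')))
    have h2 := sum_injective_of_isInternal hX (y := fun i => (y i).1) (y' := fun i => (y' i).1) h1
    funext i
    exact Subtype.ext (congrFun h2 i)
  have hfinS : FiniteDimensional E (socle (π.comp (incl F))).toSubmodule :=
    Module.Finite.equiv Φ.symm
  have hsurj : Function.Surjective (T ∘ₗ Φ.toLinearMap) :=
    LinearMap.injective_iff_surjective.1 (hTinj.comp Φ.injective)
  intro x hx
  obtain ⟨y, hy⟩ := hsurj ⟨x, hx⟩
  refine ⟨fun i => (Φ y i).1, fun i => (Φ y i).2, ?_⟩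
  rw [← map_sum, ← hT]
  exact (congrArg Subtype.val hy).symm

/-- The `K`-socle is stable under `IZ`. -/
theorem socle_stable {n : GL (Fin 2) F} (hn : n ∈ IZ F) {x : V}
    (hx : x ∈ (socle (π.comp (incl F))).toSubmodule) :
    π n x ∈ (socle (π.comp (incl F))).toSubmodule := by
  have hn' : n ∈ Iw F ⊔ Subgroup.center (GL (Fin 2) F) := hn
  rw [Subgroup.mem_sup_of_normal_right] at hn'
  obtain ⟨a, ⟨h, -, rfl⟩, z, hz, rfl⟩ := hn'
  rw [map_mul, Module.End.mul_apply]
  refine (socle (π.comp (incl F))).apply_mem_toSubmodule h ?_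
  refine map_socle_le (ρ := π.comp (incl F)) (φ := MonoidHom.id _) Function.surjective_id
    (f := π z) (fun a b hab => ?_) (fun g y => ?_) ⟨x, hx, rfl⟩
  · have := congrArg (π z⁻¹) hab
    simpa only [← Module.End.mul_apply, ← map_mul, inv_mul_cancel, map_one,
      Module.End.one_apply] using this
  · change π z (π (incl F g) y) = π (incl F g) (π z y)
    rw [← Module.End.mul_apply, ← Module.End.mul_apply, ← map_mul, ← map_mul,
      Subgroup.mem_center_iff.1 hz]

/-- The `I(1)`-invariants of the `K`-socle. -/
def socleInvariants (π : Representation E (GL (Fin 2) F) V) : Submodule E V where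
  carrier := {x | x ∈ (socle (π.comp (incl F))).toSubmodule ∧ ∀ g ∈ Iw1 F, π g x = x}
  add_mem' hx hy := ⟨Submodule.add_mem _ hx.1 hy.1, fun g hg => by
    rw [map_add, hx.2 g hg, hy.2 g hg]⟩
  zero_mem' := ⟨Submodule.zero_mem _, fun g _ => map_zero _⟩
  smul_mem' c x hx := ⟨Submodule.smul_mem _ _ hx.1, fun g hg => by rw [map_smul, hx.2 g hg]⟩

variable {R : Representation E (GL (Fin 2) 𝓀[F]) D₀} {X : WeightIndex e → Subrepresentation R}
  {f : D₀ →ₗ[E] V} {v l : ∀ i, (X i).toSubmodule}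

theorem IsModel.fixed_iff (h : IsModel p ε₀ τ γ π R X f v l) {x : D₀} :
    (∀ t, R (upp t) x = x) ↔ ∀ g ∈ Iw1 F, π g (f x) = f x := by
  constructor
  · rintro hx _ ⟨g, hg, rfl⟩
    obtain ⟨t, ht⟩ := mem_unipotent_iff.1 (Subgroup.mem_comap.1 hg)
    rw [← h.equivariant, ht, hx]
  · intro hx t
    obtain ⟨g, hg⟩ := red_surjective (F := F) (upp t)
    apply h.injective
    rw [← hg, h.equivariant]
    exact hx _ ⟨g, Subgroup.mem_comap.2 (hg ▸ mem_unipotent_iff.2 ⟨t, rfl⟩), rfl⟩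

theorem IsModel.socle_mem (h : IsModel p ε₀ τ γ π R X f v l) (i : WeightIndex e) :
    f (l i) ∈ socleInvariants π := by
  refine ⟨map_socle_le_socle (X i) h.injective h.equivariant (h.gen i).mem_socle,
    h.fixed_iff.1 fun t => ?_⟩
  exact congrArg Subtype.val ((h.gen i).soc.upp t)

theorem IsModel.exists_of_mem_socleInvariants (h : IsModel p ε₀ τ γ π R X f v l) {x : V}
    (hx : x ∈ socleInvariants π) : ∃ y, (∀ t, R (upp t) y = y) ∧ x = f y := by
  obtain ⟨y, -, hy⟩ := h.exists_eq_sum x hx.1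
  rw [← map_sum] at hy
  subst hy
  exact ⟨_, h.fixed_iff.2 hx.2, rfl⟩

theorem IsModel.fixed_component (h : IsModel p ε₀ τ γ π R X f v l)
    {y : ∀ i, (X i).toSubmodule} {g : GL (Fin 2) 𝓀[F]} {a : E}
    (hy : R g (∑ i, (y i : D₀)) = a • ∑ i, (y i : D₀)) (i : WeightIndex e) :
    (X i).toRepresentation g (y i) = a • y i := by
  have h1 : ∑ i, (((X i).toRepresentation g (y i) : (X i).toSubmodule) : D₀) =
      ∑ i, ((a • y i : (X i).toSubmodule) : D₀) := by
    rw [map_sum, Finset.smul_sum] at hy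
    exact hy
  exact congrFun (sum_injective_of_isInternal h.internal h1) i

theorem IsModel.fixed_le_span (h : IsModel p ε₀ τ γ π R X f v l) {x : D₀}
    (hx : ∀ t, R (upp t) x = x) :
    f x ∈ Submodule.span E (Set.range (Sum.elim (fun i => f (v i)) fun i => f (l i))) := by
  obtain ⟨y, rfl⟩ := exists_eq_sum_of_isInternal h.internal x
  rw [map_sum]
  refine Submodule.sum_mem _ fun i _ => ?_
  have h1 := (h.gen i).fixed (y i) fun t => by
    have := h.fixed_component (a := 1) (by rw [one_smul]; exact hx t) i
    rwa [one_smul] at this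
  obtain ⟨a, b, hab⟩ := Submodule.mem_span_pair.1 h1
  rw [← hab, Submodule.coe_add, Submodule.coe_smul, Submodule.coe_smul, map_add, map_smul, map_smul]
  exact Submodule.add_mem _ (Submodule.smul_mem _ _ (Submodule.subset_span ⟨Sum.inl i, rfl⟩))
    (Submodule.smul_mem _ _ (Submodule.subset_span ⟨Sum.inr i, rfl⟩))

variable [TopologicalSpace F] [IsNonarchimedeanLocalField F] {ϖ : 𝒪[F]}

/-- The space generated by the invariants of the socle under the action of `N`. -/
def normalizerSpan (hϖ : Irreducible ϖ) (π : Representation E (GL (Fin 2) F) V) : Submodule E V :=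
  socleInvariants π ⊔ (socleInvariants π).map (π (antidiag (unif hϖ)))

/-- The `I(1)`-invariants of `D₀` are determined by those of the socle. -/
theorem IsModel.fixed_iff_mem_normalizerSpan (h : IsModel p ε₀ τ γ π R X f v l)
    (hϖ : Irreducible ϖ) {x : V} :
    (∃ y, (∀ t, R (upp t) y = y) ∧ x = f y) ↔ x ∈ normalizerSpan hϖ π := by
  let W : Submodule E V :=
    { carrier := {x | ∃ y, (∀ t, R (upp t) y = y) ∧ x = f y}
      add_mem' := by
        rintro _ _ ⟨y, hy, rfl⟩ ⟨z, hz, rfl⟩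
        exact ⟨y + z, fun t => by rw [map_add, hy, hz], (map_add _ _ _).symm⟩
      zero_mem' := ⟨0, fun t => map_zero _, (map_zero _).symm⟩
      smul_mem' := by
        rintro c _ ⟨y, hy, rfl⟩
        exact ⟨c • y, fun t => by rw [map_smul, hy], (map_smul _ _ _).symm⟩ }
  set M := socleInvariants π with hM
  set P := π (antidiag (unif hϖ)) with hP
  have hMW : M ≤ W := fun x hx => h.exists_of_mem_socleInvariants hx
  have hPW : M.map P ≤ W := by
    rintro _ ⟨x, hx, rfl⟩
    obtain ⟨y, hy, rfl⟩ := h.exists_of_mem_socleInvariants hx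
    exact h.stable _ (antidiag_mem_Nm hϖ) y hy
  -- For `z` in the intersection, the whole `N`-orbit of `z` stays in the socle: elements of `IZ`
  -- preserve it, and those in the other coset move `z = P y` to a translate of `y` by `IZ`. The
  -- pairing condition then gives `z = 0`.
  have hdisj : M ⊓ M.map P = ⊥ := by
    rw [eq_bot_iff]
    rintro z ⟨hz, y, hy, hyz⟩
    obtain ⟨x, hx, rfl⟩ := hMW hz
    rw [Submodule.mem_bot]
    by_contra h0
    obtain ⟨n, hn, hns⟩ := h.pairing x hx fun hx0 => h0 (by rw [hx0, map_zero])
    apply hns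
    -- The dichotomy is applied to `n⁻¹`, so that inverting puts the antidiagonal factor to the
    -- right of `n`, where it meets `y`.
    rcases mem_IZ_or_of_mem_Nm hϖ ((Nm F).inv_mem hn) with h1 | h1
    · exact socle_stable (by simpa using (IZ F).inv_mem h1) hz.1
    · rw [← hyz, hP, ← Module.End.mul_apply, ← map_mul]
      refine socle_stable ?_ hy.1
      simpa using (IZ F).inv_mem h1
  have hspan : W ≤ Submodule.span E
      (Set.range (Sum.elim (fun i => f (v i)) fun i => f (l i))) := by
    rintro _ ⟨y, hy, rfl⟩
    exact h.fixed_le_span hy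
  have hfinspan : FiniteDimensional E (Submodule.span E
      (Set.range (Sum.elim (fun i => f (v i)) fun i => f (l i)))) :=
    FiniteDimensional.span_of_finite E (Set.finite_range _)
  have hfinW : FiniteDimensional E W := Submodule.finiteDimensional_of_le hspan
  have hfinM : FiniteDimensional E M := Submodule.finiteDimensional_of_le hMW
  have hWle : Module.finrank E W ≤ 2 * Fintype.card (WeightIndex e) := by
    refine (Submodule.finrank_mono hspan).trans ((finrank_range_le_card _).trans ?_)
    rw [Fintype.card_sum, two_mul]
  have hMge : Fintype.card (WeightIndex e) ≤ Module.finrank E M := by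
    have hind : LinearIndependent E fun i => ((l i : (X i).toSubmodule) : D₀) :=
      h.internal.submodule_iSupIndep.linearIndependent _ (fun i => (l i).2) fun i h0 =>
        (h.gen i).ne_zero (Subtype.ext h0)
    have hind' : LinearIndependent E fun i => f (l i) :=
      hind.map' f (LinearMap.ker_eq_bot.2 h.injective)
    have hind'' : LinearIndependent E fun i => (⟨f (l i), h.socle_mem i⟩ : M) :=
      LinearIndependent.of_comp M.subtype hind'
    exact hind''.fintype_card_le_finrank
  have hPinj : Function.Injective P := fun a b hab => by
    have := congrArg (π (antidiag (unif hϖ))⁻¹) hab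
    simpa only [hP, ← Module.End.mul_apply, ← map_mul, inv_mul_cancel, map_one,
      Module.End.one_apply] using this
  have hsum := Submodule.finrank_sup_add_finrank_inf_eq M (M.map P)
  rw [hdisj, finrank_bot, add_zero, ← (Submodule.equivMapOfInjective P hPinj M).finrank_eq] at hsum
  -- The sum is direct and `P` is injective, so its dimension is at least twice the number of
  -- weights, which is the upper bound for `W`.
  have heq : normalizerSpan hϖ π = W :=
    Submodule.eq_of_le_of_finrank_le (sup_le hMW hPW) (by
      change _ ≤ Module.finrank E (M ⊔ M.map P : Submodule E V)
      omega)
  rw [heq]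
  rfl

end Model

/-! ### Comparing two models in the same representation -/

section Comparison

theorem IsHighestWeight.smul {p : ℕ} {k E X : Type*} [Field k] [Field E] {ε₀ : k →+* E}
    [AddCommGroup X] [Module E X] {κ : Weight} {R : Representation E (GL (Fin 2) k) X} {v : X}
    (hv : IsHighestWeight p ε₀ κ R v) (c : E) : IsHighestWeight p ε₀ κ R (c • v) :=
  ⟨fun t => by rw [map_smul, hv.upp], fun a d => by rw [map_smul, hv.dia, smul_comm]⟩

/-- A unipotent invariant eigenvector in the span of two others has one of their weights. -/
theorem congr_or_congr_of_mem_span {p : ℕ} [hp : Fact p.Prime] {k E X : Type*} [Field k] [Fintype k]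
    [Field E] (hk : Fintype.card k = p ^ 2) {ε₀ : k →+* E} [AddCommGroup X] [Module E X]
    {κ κ₁ κ₂ : Weight} {R : Representation E (GL (Fin 2) k) X} {v v₁ v₂ : X}
    (hv : IsHighestWeight p ε₀ κ R v) (h₁ : IsHighestWeight p ε₀ κ₁ R v₁)
    (h₂ : IsHighestWeight p ε₀ κ₂ R v₂) (hmem : v ∈ Submodule.span E {v₁, v₂}) (h0 : v ≠ 0)
    (hκ : κ.IsDigits p) (hκ₁ : κ₁.IsDigits p) (hκ₂ : κ₂.IsDigits p) :
    κ.Congr p κ₁ ∨ κ.Congr p κ₂ := by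
  obtain ⟨a, b, hab⟩ := Submodule.mem_span_pair.1 hmem
  by_cases hall : ∀ x y : kˣ, ε₀ x ^ (κ.m + κ.a₀ + p * κ.a₁) * ε₀ y ^ κ.m =
      ε₀ x ^ (κ₂.m + κ₂.a₀ + p * κ₂.a₁) * ε₀ y ^ κ₂.m
  · right
    exact hv.congr hk ⟨hv.upp, fun x y => by rw [hv.dia, hall]⟩ h0 hκ hκ₂
  · left
    push Not at hall
    obtain ⟨x, y, hxy⟩ := hall
    set c := ε₀ x ^ (κ.m + κ.a₀ + p * κ.a₁) * ε₀ y ^ κ.m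
    set c₂ := ε₀ x ^ (κ₂.m + κ₂.a₀ + p * κ₂.a₁) * ε₀ y ^ κ₂.m
    set c₁ := ε₀ x ^ (κ₁.m + κ₁.a₀ + p * κ₁.a₁) * ε₀ y ^ κ₁.m
    have e : c • v = a • c₁ • v₁ + b • c₂ • v₂ := by
      rw [← hv.dia, ← hab, map_add, map_smul, map_smul, h₁.dia, h₂.dia]
    -- Some torus element has different eigenvalues `c` on `v` and `c₂` on `v₂`; subtracting `c₂`
    -- times the identity from its action eliminates `v₂`.
    have e' : (c - c₂) • v = (a * (c₁ - c₂)) • v₁ := by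
      rw [sub_smul, e, ← hab]
      module
    have hcc : c - c₂ ≠ 0 := sub_ne_zero.2 hxy
    have hv' : v = ((c - c₂)⁻¹ * (a * (c₁ - c₂))) • v₁ := by
      rw [mul_smul, ← e', inv_smul_smul₀ hcc]
    refine hv.congr hk ?_ h0 hκ hκ₁
    rw [hv']
    exact h₁.smul _

variable {F : Type*} [Field F] [ValuativeRel F] {E : Type*} [Field E] {p : ℕ} [hp : Fact p.Prime]
  [CharP E p] {ε₀ : 𝓀[F] →+* E} {τ : Weight} {e : ℕ} {γ γ' : HamiltonianWalk e}
  {V : Type*} [AddCommGroup V] [Module E V] {π : Representation E (GL (Fin 2) F) V}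
  {D₀ D₀' : Type*} [AddCommGroup D₀] [Module E D₀] [AddCommGroup D₀'] [Module E D₀']
  {R : Representation E (GL (Fin 2) 𝓀[F]) D₀} {X : WeightIndex e → Subrepresentation R}
  {f : D₀ →ₗ[E] V} {v l : ∀ i, (X i).toSubmodule}
  {R' : Representation E (GL (Fin 2) 𝓀[F]) D₀'} {X' : WeightIndex e → Subrepresentation R'}
  {f' : D₀' →ₗ[E] V} {v' l' : ∀ i, (X' i).toSubmodule}

theorem IsModel.transfer (h : IsModel p ε₀ τ γ π R X f v l) (h' : IsModel p ε₀ τ γ' π R' X' f' v' l')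
    {x : D₀} {y : D₀'} (hxy : f x = f' y) {g : GL (Fin 2) 𝓀[F]} {c : E} (hx : R g x = c • x) :
    R' g y = c • y := by
  obtain ⟨g, rfl⟩ := red_surjective (F := F) g
  apply h'.injective
  rw [h'.equivariant, ← hxy, ← h.equivariant, hx, map_smul, map_smul, hxy]

theorem IsModel.component (h : IsModel p ε₀ τ γ π R X f v l)
    (h' : IsModel p ε₀ τ γ' π R' X' f' v' l') {κ : Weight} {i : WeightIndex e}
    {x : (X i).toSubmodule} (hx : IsHighestWeight p ε₀ κ (X i).toRepresentation x)
    {y : ∀ i, (X' i).toSubmodule} (hxy : f x = f' (∑ j, (y j : D₀'))) (j : WeightIndex e) :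
    IsHighestWeight p ε₀ κ (X' j).toRepresentation (y j) := by
  refine ⟨fun t => ?_, fun a d => ?_⟩
  · have h1 : R (upp t) x = (1 : E) • (x : D₀) := by
      rw [one_smul]
      exact congrArg Subtype.val (hx.upp t)
    have := h'.fixed_component (h.transfer h' hxy h1) j
    rwa [one_smul] at this
  · exact h'.fixed_component (h.transfer h' hxy (congrArg Subtype.val (hx.dia a d))) j

variable [Fintype 𝓀[F]]

/-- If the generator of the `i`-th summand had zero `i`-th component in the other model, so would
everything it generates, in particular the socle vector `l i`. The other components of `l i` lie in
socles of different weights and vanish as well, which contradicts `l i ≠ 0`. -/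
theorem IsModel.component_ne_zero (hk : Fintype.card 𝓀[F] = p ^ 2) (hodd : p % 2 = 1)
    (hτ : τ.IsGeneric p e) (h : IsModel p ε₀ τ γ π R X f v l)
    (h' : IsModel p ε₀ τ γ' π R' X' f' v' l') {i : WeightIndex e}
    {y : ∀ i, (X' i).toSubmodule} (hy : f (v i) = f' (∑ j, (y j : D₀'))) : y i ≠ 0 := by
  intro hyi
  -- Only the vectors of the summand that land in the other model, with zero `i`-th component, are
  -- collected here. This is a subrepresentation containing `v i`, hence everything.
  let Y : Submodule E (X i).toSubmodule :=
    { carrier := {x | ∃ z : ∀ j, (X' j).toSubmodule, z i = 0 ∧ f x = f' (∑ j, (z j : D₀'))}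
      add_mem' := by
        rintro x x' ⟨z, hz, hxz⟩ ⟨z', hz', hxz'⟩
        refine ⟨z + z', by simp [hz, hz'], ?_⟩
        rw [Submodule.coe_add, map_add, hxz, hxz', ← map_add, ← Finset.sum_add_distrib]
        rfl
      zero_mem' := ⟨0, rfl, by simp⟩
      smul_mem' := by
        rintro c x ⟨z, hz, hxz⟩
        refine ⟨c • z, by simp [hz], ?_⟩
        rw [Submodule.coe_smul, map_smul, hxz, ← map_smul, Finset.smul_sum]
        rfl }
  have hY : Y = ⊤ := by
    refine (h.gen i).eq_top Y ?_ ⟨y, hyi, hy⟩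
    rintro g x ⟨z, hz, hxz⟩
    refine ⟨fun j => (X' j).toRepresentation g (z j), by simp [hz], ?_⟩
    obtain ⟨g, rfl⟩ := red_surjective (F := F) g
    change f (R (red F g) x) = f' (∑ j, R' (red F g) (z j))
    rw [← map_sum, h.equivariant, hxz, h'.equivariant]
  have hlY : l i ∈ Y := hY ▸ Submodule.mem_top
  obtain ⟨z, hz, hlz⟩ := hlY
  obtain ⟨w, hw, hlw⟩ := h'.exists_eq_sum _ (h.socle_mem i).1
  rw [← map_sum] at hlw
  have hzw := sum_injective_of_isInternal h'.internal (h'.injective (hlz.symm.trans hlw))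
  subst hzw
  have hzero : ∀ j, z j = 0 := by
    intro j
    by_contra hj0
    have h1 := h.component h' (h.gen i).soc hlz j
    obtain ⟨c, hc⟩ := Submodule.mem_span_singleton.1 ((h'.gen j).fixed_socle _ (hw j) h1.upp)
    have h2 := (h'.gen j).soc.smul c
    rw [hc] at h2
    have hi := modularWeight_le hτ i
    have hj := modularWeight_le hτ j
    have := modularWeight_congr hodd hτ (h1.congr hk h2 hj0 (IsDigits.of_add_two_le hi.1 hi.2)
      (IsDigits.of_add_two_le hj.1 hj.2))
    subst this
    exact hj0 hz
  apply (h.gen i).ne_zero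
  apply Subtype.ext
  apply h.injective
  rw [hlz]
  simp [hzero]

variable [TopologicalSpace F] [IsNonarchimedeanLocalField F] {ϖ : 𝒪[F]}

/-- The generator `v i` lies in the other model since both have the same `I(1)`-invariants. Its
nonzero `i`-th component there carries the character of the cosocle for `γ`, which must be that of
the cosocle for `γ'` or of the socle; the latter is excluded by `cosocle_not_congr`. -/
theorem IsModel.summandType_eq (hϖ : Irreducible ϖ) (hk : Fintype.card 𝓀[F] = p ^ 2)
    (hodd : p % 2 = 1) (hτ : τ.IsGeneric p e) (h : IsModel p ε₀ τ γ π R X f v l)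
    (h' : IsModel p ε₀ τ γ' π R' X' f' v' l') (i : WeightIndex e) :
    summandType γ i = summandType γ' i := by
  obtain ⟨y₀, -, hy₀⟩ := (h'.fixed_iff_mem_normalizerSpan hϖ).2
    ((h.fixed_iff_mem_normalizerSpan hϖ).1
      ⟨v i, fun t => congrArg Subtype.val ((h.gen i).gen.upp t), rfl⟩)
  obtain ⟨y, rfl⟩ := exists_eq_sum_of_isInternal h'.internal y₀
  have hne := h.component_ne_zero hk hodd hτ h' hy₀
  have hw := h.component h' (h.gen i).gen hy₀ i
  obtain ⟨h₀, h₁⟩ := modularWeight_le hτ i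
  rcases congr_or_congr_of_mem_span hk hw (h'.gen i).gen (h'.gen i).soc
    ((h'.gen i).fixed _ hw.upp) hne (isDigits_cosocle h₀ h₁ _) (isDigits_cosocle h₀ h₁ _)
    (IsDigits.of_add_two_le h₀ h₁) with hc | hc
  · exact cosocle_congr h₀ h₁ hc
  · exact absurd hc (cosocle_not_congr hodd h₀ h₁ _)

end Comparison

/-! ### From diagrams to models, and transport along an isomorphism -/

section Diagrams

variable {F : Type*} [Field F] [ValuativeRel F] [TopologicalSpace F]
  {E : Type*} [Field E] {p : ℕ} [hp : Fact p.Prime]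
  [CharP E p] {ε₀ : 𝓀[F] →+* E} {τ : Weight} {e : ℕ} {γ : HamiltonianWalk e}
  {V V' : Type*} [AddCommGroup V] [Module E V] {π : Representation E (GL (Fin 2) F) V}
  [AddCommGroup V'] [Module E V'] {π' : Representation E (GL (Fin 2) F) V'} {D : Diagram F E}
  {ϖ : 𝒪[F]}

omit [TopologicalSpace F] in
theorem mem_fixedBy_iff {D₀ : Type*} [AddCommGroup D₀] [Module E D₀]
    {ρ : Representation E (KZ F) D₀} {R : Representation E (GL (Fin 2) 𝓀[F]) D₀}
    (hR : ∀ g, ρ (inclKZ F g) = R (red F g)) {x : D₀} :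
    x ∈ fixedBy ρ (Iw1 F) ↔ ∀ t, R (upp t) x = x := by
  constructor
  · intro hx t
    obtain ⟨g, hg⟩ := red_surjective (F := F) (upp t)
    rw [← hg, ← hR]
    exact hx _ ⟨g, Subgroup.mem_comap.2 (hg ▸ mem_unipotent_iff.2 ⟨t, rfl⟩), rfl⟩
  · rintro hx g ⟨h, hh, hhg⟩
    obtain ⟨t, ht⟩ := mem_unipotent_iff.1 (Subgroup.mem_comap.1 hh)
    have : g = inclKZ F h := Subtype.ext hhg.symm
    rw [this, hR, ht, hx]

theorem exists_isModel [Fintype 𝓀[F]] (hk : Fintype.card 𝓀[F] = p ^ 2) (hτ : τ.IsGeneric p e)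
    (hD : D.ArisesFrom p ϖ ε₀ τ γ) (hV : SatisfiesHypotheses p π D ε₀ τ e) :
    ∃ (R : Representation E (GL (Fin 2) 𝓀[F]) D.D₀) (X : WeightIndex e → Subrepresentation R)
      (f : D.D₀ →ₗ[E] V) (v l : ∀ i, (X i).toSubmodule), IsModel p ε₀ τ γ π R X f v l := by
  obtain ⟨R, hR, X, hX, hQ⟩ := hD.inflation
  obtain ⟨f, f₁, hf, hf₁, -, -, hfK, hfN, hff, -⟩ := hV.embedding
  choose v l hvl using fun i =>
    exists_isQGen hk (modularWeight_le hτ i).1 (modularWeight_le hτ i).2 (hQ i)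
  have heq : ∀ g x, f (R (red F g) x) = π (incl F g) (f x) := by
    intro g x
    rw [← hR, hfK]
    rfl
  have hsum := exists_eq_sum_of_socle_equiv hX (fun i => (hvl i).finite) (fun i => (hQ i).2) hf heq
    hV.socle_equiv
  have hrange : ∀ x, (∀ t, R (upp t) x = x) ↔ ∃ d, D.ι d = x := by
    intro x
    rw [← mem_fixedBy_iff hR, ← hD.range_eq]
    rfl
  have hN : ∀ (n : GL (Fin 2) F) (hn : n ∈ Nm F) d,
      π n (f (D.ι d)) = f (D.ι (D.ρ₁ ⟨n, hn⟩ d)) := by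
    intro n hn d
    rw [hff, hff, hfN]
  refine ⟨R, X, f, v, l, hX, hvl, hf, heq, hsum, fun n hn x hx => ?_, fun x hx hx0 => ?_⟩
  · obtain ⟨d, rfl⟩ := (hrange x).1 hx
    exact ⟨_, (hrange _).2 ⟨_, rfl⟩, hN n hn d⟩
  · obtain ⟨d, rfl⟩ := (hrange x).1 hx
    obtain ⟨⟨n, hn⟩, hnd⟩ := hD.pairing d fun h0 => hx0 (by rw [h0, map_zero])
    refine ⟨n, hn, fun hmem => hnd ?_⟩
    rw [hN n hn] at hmem
    -- The pairing of a diagram refers to the socle of `D₀`, that of a model to the socle of `V`;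
    -- the decomposition `hsum` brings a vector of the latter back into the former.
    obtain ⟨y, hy, hy'⟩ := hsum _ hmem
    rw [← map_sum] at hy'
    rw [hf hy']
    refine Submodule.sum_mem (socle (D.ρ₀.comp (inclKZ F))).toSubmodule fun i _ => ?_
    refine map_socle_le (red_surjective (F := F)) (f := (X i).toSubmodule.subtype)
      (X i).toSubmodule.injective_subtype (fun g x => ?_) ⟨y i, hy i, rfl⟩
    change R (red F g) x = D.ρ₀ (inclKZ F g) x
    rw [hR]

/-- Transporting the second embedding along the isomorphism places both diagrams in one
representation, where they can be compared. -/
theorem SatisfiesHypotheses.of_equiv (φ : π.Equiv π') {D' : Diagram F E}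
    (hπ : SatisfiesHypotheses p π D ε₀ τ e) (hπ' : SatisfiesHypotheses p π' D' ε₀ τ e) :
    SatisfiesHypotheses p π D' ε₀ τ e := by
  refine ⟨hπ.admissible, hπ.socle_equiv, ?_⟩
  obtain ⟨f, f₁, hf, hf₁, hK1, hI1, hK, hN, hff, htop⟩ := hπ'.embedding
  set ψ := φ.toLinearEquiv.symm with hψ
  have hψπ : ∀ g x, ψ (π' g x) = π g (ψ x) := by
    intro g x
    apply φ.toLinearEquiv.injective
    have h1 : φ.toLinearEquiv (π g (ψ x)) = π' g (φ.toLinearEquiv (ψ x)) :=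
      φ.toIntertwiningMap.isIntertwining _ _ g (ψ x)
    rw [h1, hψ, LinearEquiv.apply_symm_apply, LinearEquiv.apply_symm_apply]
  refine ⟨ψ.toLinearMap ∘ₗ f, ψ.toLinearMap ∘ₗ f₁, ψ.injective.comp hf, ψ.injective.comp hf₁,
    fun x g hg => ?_, fun x g hg => ?_, fun g x => ?_, fun g x => ?_, fun x => ?_, fun W hW => ?_⟩
  · change π g (ψ _) = ψ _
    rw [← hψπ, hK1 x g hg]
  · change π g (ψ _) = ψ _
    rw [← hψπ, hI1 x g hg]
  · change ψ _ = π g (ψ _)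
    rw [← hψπ, hK]
  · change ψ _ = π g (ψ _)
    rw [← hψπ, hN]
  · exact congrArg ψ (hff x)
  · have h1 := htop ⟨W.toSubmodule.comap ψ.toLinearMap, fun g x hx => by
      change ψ (π' g x) ∈ W.toSubmodule
      rw [hψπ]
      exact W.apply_mem_toSubmodule g hx⟩ fun x => hW x
    apply Subrepresentation.toSubmodule_injective
    have h2 : W.toSubmodule.comap ψ.toLinearMap = ⊤ := congrArg Subrepresentation.toSubmodule h1
    change W.toSubmodule = ⊤
    rw [eq_top_iff]
    intro x _
    have h3 : φ.toLinearEquiv x ∈ W.toSubmodule.comap ψ.toLinearMap := h2 ▸ Submodule.mem_top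
    have h4 : ψ (φ.toLinearEquiv x) = x := φ.toLinearEquiv.symm_apply_apply x
    have h5 : ψ (φ.toLinearEquiv x) ∈ W.toSubmodule := h3
    rwa [h4] at h5

end Diagrams

end GLTwo
end

/-! ### The main theorem -/

open GLTwo
theorem mainTheorem4 {p : ℕ} [Fact p.Prime]
    -- a finite extension `F` of `ℚ_p` with residue field of order `p ^ 2`, ramification index `e`
    {F : Type*} [Field F] [ValuativeRel F] [TopologicalSpace F] [IsNonarchimedeanLocalField F]
    [Algebra ℚ_[p] F] [FiniteDimensional ℚ_[p] F]
    (hk : Nat.card 𝓀[F] = p ^ 2)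
    (e : ℕ) (he : Ideal.span {(p : 𝒪[F])} = 𝓂[F] ^ e)
    (ϖ : 𝒪[F]) (hϖ : Irreducible ϖ)
    -- the embedding `ε₀` and its extension to the residue field of the algebraic closure
    (ε₀ : 𝓀[F] →+* AlgebraicClosure (ZMod p))
    (θ : IntegersAlg F →+* AlgebraicClosure (ZMod p))
    (hθ : ∀ a : 𝒪[F], θ (algebraMap 𝒪[F] (IntegersAlg F) a) = ε₀ (IsLocalRing.residue 𝒪[F] a))
    -- the generic Galois representation and the weight attached to it
    (ρ : Representation (AlgebraicClosure (ZMod p)) (Field.absoluteGaloisGroup F)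
      (Fin 2 → AlgebraicClosure (ZMod p)))
    (τ : Weight) (hρ : IsGenericOfType p e ϖ θ ρ τ)
    -- two distinct Hamiltonian walks
    (γ γ' : HamiltonianWalk e) (hγ : γ ≠ γ')
    -- diagrams in the two families
    (D D' : Diagram F (AlgebraicClosure (ZMod p)))
    (hD : D.ArisesFrom p ϖ ε₀ τ γ) (hD' : D'.ArisesFrom p ϖ ε₀ τ γ')
    -- the two representations
    {V V' : Type*} [AddCommGroup V] [AddCommGroup V']
    [Module (AlgebraicClosure (ZMod p)) V] [Module (AlgebraicClosure (ZMod p)) V']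
    (π : Representation (AlgebraicClosure (ZMod p)) (GL (Fin 2) F) V)
    (π' : Representation (AlgebraicClosure (ZMod p)) (GL (Fin 2) F) V')
    (hπ : SatisfiesHypotheses p π D ε₀ τ e) (hπ' : SatisfiesHypotheses p π' D' ε₀ τ e) :
    ¬ Nonempty (π.Equiv π') := by
  rintro ⟨φ⟩
  have hτ : τ.IsGeneric p e := ⟨hρ.le_r₀, hρ.r₀_le, hρ.le_r₁, hρ.r₁_le⟩
  have hcard0 : Nat.card 𝓀[F] ≠ 0 := hk ▸ pow_ne_zero 2 (Fact.out : p.Prime).ne_zero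
  have := Nat.finite_of_card_ne_zero hcard0
  have : Fintype 𝓀[F] := Fintype.ofFinite _
  rw [Nat.card_eq_fintype_card] at hk
  obtain ⟨R, X, f, v, l, h⟩ := exists_isModel hk hτ hD hπ
  obtain ⟨R', X', f', v', l', h'⟩ := exists_isModel hk hτ hD' (hπ.of_equiv φ hπ')
  -- A walk has a starting vertex, so `e ≥ 1`; the genericity bounds then give `p ≥ 3`, and all
  -- parity arguments apply.
  obtain ⟨u, -⟩ := γ.2
  have hodd : p % 2 = 1 := by
    refine (Fact.out : p.Prime).eq_two_or_odd.resolve_left fun h2 => ?_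
    have := u.1.2
    have := hτ.le_r₀
    have := hτ.r₀_le
    have := hτ.r₁_le
    omega
  exact hγ (HamiltonianWalk.ext_of_summandType fun i =>
    h.summandType_eq hϖ hk hodd hτ h' i)
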